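/- Let $a=(3/2)^{1/3}$ and $K=(3/2)^{5/3}$. There is, uniquely up to translation in $\zeta$, a positive $C^3$ solution $\varphi:\mathbb R\to(0,\infty)$ of $\varphi'''=1/\varphi^3$ with $\varphi(\zeta)\sim -K\zeta$ as $\zeta\to-\infty$ (the quotient of the two sides tends to $1$). It attains its minimum, and there is a constant $\Gamma>0$ with $\varphi(\zeta)\sim\Gamma\zeta^2$ as $\zeta\to+\infty$. The following holds with these $\varphi$ and $\Gamma$. Let $\Phi$ be a positive $C^3$ solution of $(\Phi'''+1)\,\Phi^3=1$ on a half-line $(\tau_0,\infty)$ that does not lie on the stable manifold of the critical point $(1,0,0)$, i.e. $(\Phi,\Phi',\Phi'')(\tau)$ does not converge to $(1,0,0)$ as $\tau\to\infty$. Then there are two increasing sequences $(\tau_n^+)_{n\ge 0}$ of local maxima and $(\tau_n^-)_{n\ge 0}$ of local minima of $\Phi$ in $(\tau_0,\infty)$ such that $\tau_n^+<\tau_n^-<\tau_{n+1}^+$ for all $n$, $\lim_{n\to\infty}\tau_n^+=\infty$, $$\Phi'(\tau_n^+)=\Phi'(\tau_n^-)=0,\qquad \Phi'<0\ \text{ in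 }(\tau_n^+,\tau_n^-),\qquad \Phi'>0\ \text{ in }(\tau_n^-,\tau_{n+1}^+).$$ Moreover, with $L_n:=\Phi(\tau_n^+)$ and $M_n:=\Phi(\tau_n^-)$, there is a constant $C>0$ such that, as $n\to\infty$, $$L_n=\frac{a^{1/3}\exp(C\,10^n)}{(2\Gamma)^{1/3}}(1+o(1)),\qquad \tau_n^+=2a^{10/9}(2\Gamma)^{-1/9}\exp\Big(\frac C3 10^n\Big)(1+o(1)),$$ $$M_n=\frac{\min_{\mathbb R}\varphi}{L_n^2}(1+o(1)),\qquad \tau_n^-=\Big[2a^{10/9}(2\Gamma)^{-1/9}+\frac{a\cdot a^{1/9}}{(2\Gamma)^{1/9}}\Big]\exp\Big(\frac C3 10^n\Big)(1+o(1)),$$ and $$\Phi''(\tau_n^+)=-\Big(\frac32\Big)^{1/3}L_n^{1/3}(1+o(1)).$$ -/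

import Mathlib

open Filter Topology Set Asymptotics

/-- `Φ` is a positive (classical, `C³`) solution of `(Φ''' + 1) Φ³ = 1` on the half-line
`(τ₀, ∞)`.  The values of `Φ` outside this half-line play no role. -/
def IsFilmSolution (τ₀ : ℝ) (Φ : ℝ → ℝ) : Prop :=
  ContDiffOn ℝ 3 Φ (Ioi τ₀) ∧
    ∀ τ ∈ Ioi τ₀, 0 < Φ τ ∧ (iteratedDeriv 3 Φ τ + 1) * Φ τ ^ 3 = 1

/-- The trajectory `(Φ, Φ', Φ'')` lies on the stable manifold of the critical point
`(1, 0, 0)`, that is, it converges to this point as `τ → ∞`. -/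
def OnStableManifold (Φ : ℝ → ℝ) : Prop :=
  Tendsto (fun τ => (Φ τ, deriv Φ τ, iteratedDeriv 2 Φ τ)) atTop (𝓝 ((1 : ℝ), (0 : ℝ), (0 : ℝ)))

/-- The constant `a = (3/2)^(1/3)`. -/
noncomputable def filmA : ℝ := (3 / 2 : ℝ) ^ (1 / 3 : ℝ)

/-- The constant `K = (3/2)^(5/3)`. -/
noncomputable def filmK : ℝ := (3 / 2 : ℝ) ^ (5 / 3 : ℝ)

/-- `φ` is a positive solution on the whole line of `φ''' = 1 / φ³` with the matching condition
`φ(ζ) ∼ -K ζ` as `ζ → -∞` (the quotient of the two sides tends to `1`). -/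
def IsInnerProfile (φ : ℝ → ℝ) : Prop :=
  ContDiff ℝ 3 φ ∧
    (∀ ζ, 0 < φ ζ ∧ iteratedDeriv 3 φ ζ = 1 / φ ζ ^ 3) ∧
    φ ~[atBot] (fun ζ => -filmK * ζ)

/-! A film solution alternates between long arcs with Φ''' ≈ -1 and very short layers around its
minima with Φ''' ≈ Φ⁻³. Write λ³ for the height of a maximum and suppose Φ'' ≈ -aλ there, where a³ =
3/2. The height lost after time s is about aλs²/2 + s³/6, so height one is reached at s ≈ aλ with
slope ≈ -(3/2)a²λ² = -Kλ². Scaling time by κ⁴ and height by κ³, with κ ≈ λ⁻², makes the slope at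
height one exactly -K and turns the equation into u''' = u⁻³ - κ⁹ (`SolvesOn.rescale`). Hence the
layer follows the profile φ, and the minimum is ≈ κ³ min φ. The profile leaves with second
derivative ℓ = 2Γ. From then on the term -c = -κ⁹ decides: in scaled variables the next maximum
comes after time ≈ 2ℓ/c, at height ≈ 2ℓ³/(3c²), with second derivative ≈ -ℓ. There the quotient of
Φ'' by the cube root of the height is again ≈ -a, whatever the previous maximum was like, so the
assumption on Φ'' is produced by the passage itself. Undoing the scaling gives λₙ₊₁ ~ (ℓ/a) λₙ¹⁰,
hence the exponent C·10ⁿ.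

The profile is a limit of solutions descending from ever greater heights (`exists_isProfile`). Its
uniqueness, and the fact that an incoming solution approaches it (`IsProfile.arrival`), both rest on
`backward_estimate`, whose constants do not grow exponentially with the length of the time interval.

A solution off the stable manifold cannot be eventually monotone, and its critical points after the
first one are nondegenerate, so maxima and minima alternate (`exists_filmOscillation`). The energy
Φ'Φ'' + Φ + 1/(2Φ²) has derivative (Φ'')², which forces the maxima to infinity
(`FilmOscillation.tendsto_max_height`).

One period is described by `FallBounds`, `IsProfile.arrival`, `IsProfile.passage_min` and
`IsProfile.passage_max`, combined in `FilmOscillation.exists_filmPassage`. The recursion for λₙ is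
solved in `exists_tendsto_div_exp`. -/

open scoped NNReal

/-! ### Comparison of functions through their derivatives -/

/-- Replaces integration of inequalities: an estimate of f' is integrated by exhibiting an explicit
primitive g of the bound. -/
theorem sub_le_sub_of_deriv_le {f g f' g' : ℝ → ℝ} {a b : ℝ} (hab : a ≤ b)
    (hf : ∀ t ∈ Icc a b, HasDerivAt f (f' t) t) (hg : ∀ t ∈ Icc a b, HasDerivAt g (g' t) t)
    (h : ∀ t ∈ Ioo a b, f' t ≤ g' t) : f b - f a ≤ g b - g a := by
  have hm : MonotoneOn (fun t => g t - f t) (Icc a b) := by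
    apply monotoneOn_of_deriv_nonneg (convex_Icc a b)
    · intro t ht
      exact ((hg t ht).sub (hf t ht)).continuousAt.continuousWithinAt
    · intro t ht
      rw [interior_Icc] at ht
      exact ((hg t (Ioo_subset_Icc_self ht)).sub
        (hf t (Ioo_subset_Icc_self ht))).differentiableAt.differentiableWithinAt
    · intro t ht
      rw [interior_Icc] at ht
      rw [((hg t (Ioo_subset_Icc_self ht)).fun_sub (hf t (Ioo_subset_Icc_self ht))).deriv]
      linarith [h t ht]
  have := hm (left_mem_Icc.2 hab) (right_mem_Icc.2 hab) hab
  simp only at this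
  linarith

theorem sub_lt_sub_of_deriv_lt {f g f' g' : ℝ → ℝ} {a b : ℝ} (hab : a < b)
    (hf : ∀ t ∈ Icc a b, HasDerivAt f (f' t) t) (hg : ∀ t ∈ Icc a b, HasDerivAt g (g' t) t)
    (h : ∀ t ∈ Ioo a b, f' t < g' t) : f b - f a < g b - g a := by
  have hm : StrictMonoOn (fun t => g t - f t) (Icc a b) := by
    apply strictMonoOn_of_deriv_pos (convex_Icc a b)
    · intro t ht
      exact ((hg t ht).sub (hf t ht)).continuousAt.continuousWithinAt
    · intro t ht
      rw [interior_Icc] at ht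
      rw [((hg t (Ioo_subset_Icc_self ht)).fun_sub (hf t (Ioo_subset_Icc_self ht))).deriv]
      linarith [h t ht]
  have := hm (left_mem_Icc.2 hab.le) (right_mem_Icc.2 hab.le) hab
  simp only at this
  linarith

theorem le_of_deriv_nonneg {f f' : ℝ → ℝ} {a b : ℝ} (hab : a ≤ b)
    (hf : ∀ t ∈ Icc a b, HasDerivAt f (f' t) t) (h : ∀ t ∈ Ioo a b, 0 ≤ f' t) : f a ≤ f b := by
  have := sub_le_sub_of_deriv_le (f := fun _ => (0 : ℝ)) (f' := fun _ => 0) hab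
    (fun t _ => hasDerivAt_const t 0) hf h
  linarith

theorem le_of_deriv_nonpos {f f' : ℝ → ℝ} {a b : ℝ} (hab : a ≤ b)
    (hf : ∀ t ∈ Icc a b, HasDerivAt f (f' t) t) (h : ∀ t ∈ Ioo a b, f' t ≤ 0) : f b ≤ f a := by
  have := sub_le_sub_of_deriv_le (g := fun _ => (0 : ℝ)) (g' := fun _ => 0) hab
    hf (fun t _ => hasDerivAt_const t 0) h
  linarith

theorem lt_of_deriv_pos {f f' : ℝ → ℝ} {a b : ℝ} (hab : a < b)
    (hf : ∀ t ∈ Icc a b, HasDerivAt f (f' t) t) (h : ∀ t ∈ Ioo a b, 0 < f' t) : f a < f b := by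
  have := sub_lt_sub_of_deriv_lt (f := fun _ => (0 : ℝ)) (f' := fun _ => 0) hab
    (fun t _ => hasDerivAt_const t 0) hf h
  linarith

theorem lt_of_deriv_neg {f f' : ℝ → ℝ} {a b : ℝ} (hab : a < b)
    (hf : ∀ t ∈ Icc a b, HasDerivAt f (f' t) t) (h : ∀ t ∈ Ioo a b, f' t < 0) : f b < f a := by
  have := sub_lt_sub_of_deriv_lt (g := fun _ => (0 : ℝ)) (g' := fun _ => 0) hab
    hf (fun t _ => hasDerivAt_const t 0) h
  linarith

theorem abs_sub_le_sub_of_abs_deriv_le {f g f' g' : ℝ → ℝ} {a b : ℝ} (hab : a ≤ b)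
    (hf : ∀ t ∈ Icc a b, HasDerivAt f (f' t) t) (hg : ∀ t ∈ Icc a b, HasDerivAt g (g' t) t)
    (h : ∀ t ∈ Ioo a b, |f' t| ≤ g' t) : |f b - f a| ≤ g b - g a := by
  have h1 := sub_le_sub_of_deriv_le hab hf hg (fun t ht => (abs_le.1 (h t ht)).2)
  have h2 := sub_le_sub_of_deriv_le (f := fun t => - f t) (f' := fun t => - f' t) hab
    (fun t ht => (hf t ht).neg) hg (fun t ht => by linarith [(abs_le.1 (h t ht)).1])
  exact abs_le.2 ⟨by linarith, h1⟩

theorem hasDerivAt_quadratic (p q r a t : ℝ) :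
    HasDerivAt (fun s => p + q * (s - a) + r * (s - a) ^ 2 / 2) (q + r * (t - a)) t := by
  have h := (hasDerivAt_id' t).sub_const a
  exact (((h.const_mul q).const_add p).fun_add (((h.fun_pow 2).const_mul r).div_const 2)).congr_deriv
    (by norm_num; ring)

theorem hasDerivAt_cubic (p q r c a t : ℝ) :
    HasDerivAt (fun s => p + q * (s - a) + r * (s - a) ^ 2 / 2 + c * (s - a) ^ 3 / 6)
      (q + r * (t - a) + c * (t - a) ^ 2 / 2) t := by
  have h := (hasDerivAt_id' t).sub_const a
  exact ((hasDerivAt_quadratic p q r a t).fun_add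
    (((h.fun_pow 3).const_mul c).div_const 6)).congr_deriv (by norm_num; ring)

theorem hasDerivAt_affine (p q a t : ℝ) :
    HasDerivAt (fun s => p + q * (s - a)) q t := by
  exact ((((hasDerivAt_id' t).sub_const a).const_mul q).const_add p).congr_deriv (by simp)

/-! ### Third-order equations `u''' = u⁻³ - c` -/

/-- On `I` the function `u` is a positive solution of `u''' = u⁻³ - c` with first and second
derivatives `v` and `w`. -/
def SolvesOn (c : ℝ) (I : Set ℝ) (u v w : ℝ → ℝ) : Prop :=
  ∀ t ∈ I, 0 < u t ∧ HasDerivAt u (v t) t ∧ HasDerivAt v (w t) t ∧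
    HasDerivAt w ((u t ^ 3)⁻¹ - c) t

theorem SolvesOn.mono {c : ℝ} {I J : Set ℝ} {u v w : ℝ → ℝ} (h : SolvesOn c I u v w)
    (hJ : J ⊆ I) : SolvesOn c J u v w := fun t ht => h t (hJ ht)

theorem SolvesOn.comp_add {c : ℝ} {I J : Set ℝ} {u v w : ℝ → ℝ} (h : SolvesOn c I u v w) (s : ℝ)
    (hJ : ∀ t ∈ J, t + s ∈ I) :
    SolvesOn c J (fun t => u (t + s)) (fun t => v (t + s)) (fun t => w (t + s)) := by
  intro t ht
  obtain ⟨h0, h1, h2, h3⟩ := h _ (hJ t ht)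
  exact ⟨h0, h1.comp_add_const t s, h2.comp_add_const t s, h3.comp_add_const t s⟩

/-- The exponents 3 and 4 are those leaving u''' = u⁻³ invariant; the slope is then multiplied by κ
and the constant forcing becomes κ⁹, negligible as κ → 0. -/
theorem SolvesOn.rescale {I J : Set ℝ} {u v w : ℝ → ℝ} (h : SolvesOn 1 I u v w) {κ : ℝ}
    (hκ : 0 < κ) (t₀ : ℝ) (hJ : ∀ t ∈ J, t₀ + κ ^ 4 * t ∈ I) :
    SolvesOn (κ ^ 9) J (fun t => u (t₀ + κ ^ 4 * t) / κ ^ 3) (fun t => κ * v (t₀ + κ ^ 4 * t))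
      (fun t => κ ^ 5 * w (t₀ + κ ^ 4 * t)) := by
  intro t ht
  obtain ⟨h0, h1, h2, h3⟩ := h _ (hJ t ht)
  have hl : HasDerivAt (fun t => t₀ + κ ^ 4 * t) (κ ^ 4) t := by
    simpa using ((hasDerivAt_id t).const_mul (κ ^ 4)).const_add t₀
  refine ⟨by positivity, ?_, ?_, ?_⟩
  · exact ((h1.comp t hl).div_const (κ ^ 3)).congr_deriv (by field_simp)
  · exact ((h2.comp t hl).const_mul κ).congr_deriv (by ring)
  · exact ((h3.comp t hl).const_mul (κ ^ 5)).congr_deriv (by field_simp)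

/-! ### The regularised equation -/

/-- A `C¹`, globally Lipschitz extension of `y ↦ y⁻³` from `[δ, ∞)` to the whole line. -/
noncomputable def truncCube (δ y : ℝ) : ℝ :=
  if δ ≤ y then (y ^ 3)⁻¹ else (δ ^ 3)⁻¹ - 3 * (δ ^ 4)⁻¹ * (y - δ)

theorem truncCube_of_le {δ y : ℝ} (h : δ ≤ y) : truncCube δ y = (y ^ 3)⁻¹ := if_pos h

theorem truncCube_nonneg {δ : ℝ} (hδ : 0 < δ) (y : ℝ) : 0 ≤ truncCube δ y := by
  unfold truncCube
  split_ifs with h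
  · have : 0 < y := hδ.trans_le h
    positivity
  · push Not at h
    have : 0 ≤ 3 * (δ ^ 4)⁻¹ * (δ - y) := mul_nonneg (by positivity) (by linarith)
    have h2 : 0 ≤ (δ ^ 3)⁻¹ := by positivity
    linarith

theorem hasDerivAt_inv_cube {y : ℝ} (hy : 0 < y) :
    HasDerivAt (fun y : ℝ => (y ^ 3)⁻¹) (-3 * (y ^ 4)⁻¹) y := by
  exact ((hasDerivAt_pow 3 y).fun_inv (by positivity)).congr_deriv (by norm_num; field_simp)

theorem hasDerivAt_truncCube {δ : ℝ} (hδ : 0 < δ) (y : ℝ) :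
    HasDerivAt (truncCube δ) (-3 * (max y δ ^ 4)⁻¹) y := by
  have hlin : ∀ y, HasDerivAt (fun y : ℝ => (δ ^ 3)⁻¹ - 3 * (δ ^ 4)⁻¹ * (y - δ))
      (-3 * (δ ^ 4)⁻¹) y := fun y => by
    have := hasDerivAt_affine (δ ^ 3)⁻¹ (-3 * (δ ^ 4)⁻¹) δ y
    simpa only [neg_mul, ← sub_eq_add_neg] using this
  rcases lt_trichotomy y δ with h | h | h
  · rw [max_eq_right h.le]
    apply (hlin y).congr_of_eventuallyEq
    filter_upwards [gt_mem_nhds h] with z hz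
    exact if_neg (not_le.2 hz)
  · subst h
    rw [max_self, ← hasDerivWithinAt_univ, ← Iic_union_Ici (a := y)]
    apply HasDerivWithinAt.union
    · apply (hlin y).hasDerivWithinAt.congr
      · intro z hz
        rcases eq_or_lt_of_le (mem_Iic.1 hz) with h | h
        · rw [truncCube_of_le h.ge, h]; simp
        · exact if_neg (not_le.2 h)
      · rw [truncCube_of_le le_rfl]; simp
    · exact (hasDerivAt_inv_cube hδ).hasDerivWithinAt.congr (fun z hz => truncCube_of_le hz)
        (truncCube_of_le le_rfl)
  · rw [max_eq_left h.le]
    apply (hasDerivAt_inv_cube (hδ.trans h)).congr_of_eventuallyEq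
    filter_upwards [lt_mem_nhds h] with z hz
    exact truncCube_of_le (le_of_lt hz)

theorem contDiff_truncCube {δ : ℝ} (hδ : 0 < δ) : ContDiff ℝ 1 (truncCube δ) := by
  rw [contDiff_one_iff_deriv]
  refine ⟨fun y => (hasDerivAt_truncCube hδ y).differentiableAt, ?_⟩
  rw [funext fun y => (hasDerivAt_truncCube hδ y).deriv]
  have : ∀ y, max y δ ^ 4 ≠ 0 := fun y => (pow_pos (hδ.trans_le (le_max_right _ _)) 4).ne'
  fun_prop (disch := assumption)

/-- A Lipschitz constant of the first-order system attached to `truncCube δ`. -/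
noncomputable def truncLip (δ : ℝ) : ℝ≥0 := 1 + (3 * (δ ^ 4)⁻¹).toNNReal

theorem truncCube_sub_le {δ : ℝ} (hδ : 0 < δ) (x y : ℝ) :
    |truncCube δ x - truncCube δ y| ≤ 3 * (δ ^ 4)⁻¹ * |x - y| := by
  have := Convex.norm_image_sub_le_of_norm_hasDerivWithin_le (f := truncCube δ) (s := univ)
    (C := 3 * (δ ^ 4)⁻¹) (x := y) (y := x)
    (fun z _ => (hasDerivAt_truncCube hδ z).hasDerivWithinAt) ?_ convex_univ (mem_univ _)
    (mem_univ _)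
  · simpa [Real.norm_eq_abs] using this
  · intro z _
    rw [Real.norm_eq_abs, neg_mul, abs_neg, abs_of_nonneg (by positivity)]
    gcongr
    exact le_max_right _ _

/-- The vector field of the first-order system attached to `u''' = truncCube δ u`. -/
noncomputable def truncField (δ : ℝ) (x : ℝ × ℝ × ℝ) : ℝ × ℝ × ℝ :=
  (x.2.1, x.2.2, truncCube δ x.1)

theorem lipschitzWith_truncField {δ : ℝ} (hδ : 0 < δ) :
    LipschitzWith (truncLip δ) (truncField δ) := by
  apply LipschitzWith.of_dist_le_mul
  intro x y
  have hc : (truncLip δ : ℝ) = 1 + 3 * (δ ^ 4)⁻¹ := by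
    rw [truncLip, NNReal.coe_add, Real.coe_toNNReal _ (by positivity), NNReal.coe_one]
  have hp : 0 ≤ 3 * (δ ^ 4)⁻¹ := by positivity
  have h1 : dist x.1 y.1 ≤ dist x y := le_max_left _ _
  have h2 : dist x.2.1 y.2.1 ≤ dist x y := (le_max_left _ _).trans (le_max_right _ _)
  have h3 : dist x.2.2 y.2.2 ≤ dist x y := (le_max_right _ _).trans (le_max_right _ _)
  have h0 : 0 ≤ dist x y := dist_nonneg
  have h4 := truncCube_sub_le hδ x.1 y.1
  rw [← Real.dist_eq, ← Real.dist_eq] at h4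
  rw [hc]
  refine max_le ?_ (max_le ?_ ?_)
  · change dist x.2.1 y.2.1 ≤ _; nlinarith
  · change dist x.2.2 y.2.2 ≤ _; nlinarith
  · change dist (truncCube δ x.1) (truncCube δ y.1) ≤ _; nlinarith

-- For a globally Lipschitz field the Picard–Lindelöf existence time can be chosen independently of
-- the initial point, and uniform local existence gives global existence.
open scoped Manifold in
theorem exists_global_curve {E : Type*} [NormedAddCommGroup E] [NormedSpace ℝ E]
    [CompleteSpace E] {f : E → E} {L : ℝ≥0} (hL : 0 < L) (hf : LipschitzWith L f)
    (hc : ContDiff ℝ 1 f) (x : E) : ∃ γ : ℝ → E, γ 0 = x ∧ ∀ t, HasDerivAt γ (f (γ t)) t := by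
  have hL' : (0 : ℝ) < L := hL
  have key := exists_isMIntegralCurve_of_isMIntegralCurveOn (I := 𝓘(ℝ, E)) (M := E) (v := f)
    (contMDiff_vectorSpace_iff_contDiff.2 hc) (ε := 1 / (2 * L)) (by positivity) ?_ x
  · obtain ⟨γ, h0, h⟩ := key
    refine ⟨γ, h0, fun t => ?_⟩
    have h1 : HasFDerivAt γ ((1 : ℝ →L[ℝ] ℝ).smulRight (f (γ t))) t := (h t).hasFDerivAt
    simpa using h1.hasDerivAt
  · intro x
    set T : ℝ := 1 / (2 * L)
    have hT : 0 < T := by positivity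
    -- On the ball of radius ‖f x‖/L the field is bounded by 2‖f x‖; the quotient of the two is T =
    -- 1/(2L).
    have hP : IsPicardLindelof (fun _ => f) (tmin := -T) (tmax := T) ⟨0, by constructor <;> linarith⟩
        x (‖f x‖₊ / L) 0 (2 * ‖f x‖₊) L := by
      apply IsPicardLindelof.of_time_independent
      · intro y hy
        have h1 := hf.dist_le_mul y x
        have h2 : dist y x ≤ ‖f x‖ / L := by simpa using hy
        have h3 : ‖f y‖ ≤ ‖f x‖ + dist (f y) (f x) := by
          rw [dist_eq_norm]; linarith [norm_sub_norm_le (f y) (f x)]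
        have h4 : L * dist y x ≤ ‖f x‖ := by
          calc L * dist y x ≤ L * (‖f x‖ / L) := by gcongr
            _ = ‖f x‖ := by field_simp
        push_cast
        linarith
      · exact hf.lipschitzOnWith
      · simp only [sub_zero, zero_sub, neg_neg, max_self, NNReal.coe_mul, NNReal.coe_div,
          coe_nnnorm, NNReal.coe_zero, NNReal.coe_ofNat]
        apply le_of_eq
        simp only [T]
        field_simp
    obtain ⟨α, h0, hα⟩ := hP.exists_eq_forall_mem_Icc_hasDerivWithinAt₀
    refine ⟨α, h0, fun t ht => ?_⟩
    have := ((hα t (Ioo_subset_Icc_self ht)).hasDerivAt (Icc_mem_nhds ht.1 ht.2))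
    exact this.hasFDerivAt.hasMFDerivAt.hasMFDerivWithinAt

theorem exists_trunc_solution {δ : ℝ} (hδ : 0 < δ) (p q r : ℝ) :
    ∃ u v w : ℝ → ℝ, u 0 = p ∧ v 0 = q ∧ w 0 = r ∧ ∀ t, HasDerivAt u (v t) t ∧
      HasDerivAt v (w t) t ∧ HasDerivAt w (truncCube δ (u t)) t := by
  have hc : ContDiff ℝ 1 (truncField δ) := by
    unfold truncField
    exact (contDiff_fst.comp contDiff_snd).prodMk ((contDiff_snd.comp contDiff_snd).prodMk
      ((contDiff_truncCube hδ).comp contDiff_fst))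
  have hL : 0 < truncLip δ := by unfold truncLip; positivity
  obtain ⟨γ, h0, h⟩ := exists_global_curve hL (lipschitzWith_truncField hδ) hc (p, q, r)
  refine ⟨fun t => (γ t).1, fun t => (γ t).2.1, fun t => (γ t).2.2, by simp [h0], by simp [h0],
    by simp [h0], fun t => ⟨?_, ?_, ?_⟩⟩
  · exact (hasFDerivAt_fst (p := γ t)).comp_hasDerivAt t (h t)
  · exact (hasFDerivAt_fst (p := (γ t).2)).comp_hasDerivAt t
      ((hasFDerivAt_snd (p := γ t)).comp_hasDerivAt t (h t))
  · exact (hasFDerivAt_snd (p := (γ t).2)).comp_hasDerivAt t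
      ((hasFDerivAt_snd (p := γ t)).comp_hasDerivAt t (h t))

/-- Grönwall's inequality for the second system, the first solution being an approximate trajectory
with defect |c₁ - c₂|. Since `truncLip δ` is at least 1, the defect contributes at most as much as
the initial error, hence the factor 2. -/
theorem trunc_stability {δ T η : ℝ} (hδ : 0 < δ) {c₁ c₂ : ℝ}
    {u₁ v₁ w₁ u₂ v₂ w₂ : ℝ → ℝ}
    (h₁ : ∀ t ∈ Icc 0 T, HasDerivAt u₁ (v₁ t) t ∧ HasDerivAt v₁ (w₁ t) t ∧
      HasDerivAt w₁ (truncCube δ (u₁ t) - c₁) t)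
    (h₂ : ∀ t ∈ Icc 0 T, HasDerivAt u₂ (v₂ t) t ∧ HasDerivAt v₂ (w₂ t) t ∧
      HasDerivAt w₂ (truncCube δ (u₂ t) - c₂) t)
    (hu : |u₁ 0 - u₂ 0| ≤ η) (hv : |v₁ 0 - v₂ 0| ≤ η) (hw : |w₁ 0 - w₂ 0| ≤ η)
    (hc : |c₁ - c₂| ≤ η) :
    ∀ t ∈ Icc 0 T, |u₁ t - u₂ t| ≤ 2 * η * Real.exp (truncLip δ * t) ∧
      |v₁ t - v₂ t| ≤ 2 * η * Real.exp (truncLip δ * t) ∧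
      |w₁ t - w₂ t| ≤ 2 * η * Real.exp (truncLip δ * t) := by
  have hη : 0 ≤ η := (abs_nonneg _).trans hu
  have hG := dist_le_of_approx_trajectories_ODE (v := fun _ x => truncField δ x - (0, 0, c₂))
    (K := truncLip δ) (a := 0) (b := T)
    (f := fun t => (u₁ t, v₁ t, w₁ t)) (g := fun t => (u₂ t, v₂ t, w₂ t))
    (f' := fun t => (v₁ t, w₁ t, truncCube δ (u₁ t) - c₁))
    (g' := fun t => (v₂ t, w₂ t, truncCube δ (u₂ t) - c₂)) (εf := η) (εg := 0) (δ := η)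
    (fun _ => by
      apply LipschitzWith.of_dist_le_mul
      intro x y
      rw [dist_sub_right]
      exact (lipschitzWith_truncField hδ).dist_le_mul x y)
    (fun t ht => ((h₁ t ht).1.prodMk ((h₁ t ht).2.1.prodMk
      (h₁ t ht).2.2)).continuousAt.continuousWithinAt)
    (fun t ht => have ht := Ico_subset_Icc_self ht
      ((h₁ t ht).1.prodMk ((h₁ t ht).2.1.prodMk (h₁ t ht).2.2)).hasDerivWithinAt)
    (fun t ht => by
      simp only [truncField, Prod.mk_sub_mk, Prod.dist_eq, Real.dist_eq, sub_zero, sub_self,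
        abs_zero]
      refine max_le hη (max_le hη ?_)
      rw [show truncCube δ (u₁ t) - c₁ - (truncCube δ (u₁ t) - c₂) = -(c₁ - c₂) by ring, abs_neg]
      exact hc)
    (fun t ht => ((h₂ t ht).1.prodMk ((h₂ t ht).2.1.prodMk
      (h₂ t ht).2.2)).continuousAt.continuousWithinAt)
    (fun t ht => have ht := Ico_subset_Icc_self ht
      ((h₂ t ht).1.prodMk ((h₂ t ht).2.1.prodMk (h₂ t ht).2.2)).hasDerivWithinAt)
    (fun t ht => by simp [truncField])
    (by
      simp only [Prod.dist_eq, Real.dist_eq]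
      exact max_le hu (max_le hv hw))
  have hL : (1 : ℝ) ≤ truncLip δ := by
    rw [truncLip, NNReal.coe_add, NNReal.coe_one]; linarith [NNReal.coe_nonneg (3 * (δ ^ 4)⁻¹).toNNReal]
  intro t ht
  have hB := hG t ht
  rw [gronwallBound_of_K_ne_0 (by linarith)] at hB
  have hE : 1 ≤ Real.exp (truncLip δ * t) := Real.one_le_exp (by nlinarith [ht.1])
  have hB' : dist (u₁ t, v₁ t, w₁ t) (u₂ t, v₂ t, w₂ t)
      ≤ 2 * η * Real.exp (truncLip δ * t) := by
    refine hB.trans ?_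
    simp only [sub_zero, add_zero]
    have h1 : η / truncLip δ ≤ η := div_le_self hη hL
    have h2 : 0 ≤ η / truncLip δ := by positivity
    nlinarith
  simp only [Prod.dist_eq, Real.dist_eq, max_le_iff] at hB'
  exact ⟨hB'.1, hB'.2.1, hB'.2.2⟩

/-- Solutions starting close to a solution bounded away from zero stay close on bounded time
intervals. -/
theorem SolvesOn.stability {δ T η : ℝ} (hδ : 0 < δ) {c₁ c₂ : ℝ}
    {u₁ v₁ w₁ u₂ v₂ w₂ : ℝ → ℝ} (h₁ : SolvesOn c₁ (Icc 0 T) u₁ v₁ w₁)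
    (h₂ : SolvesOn c₂ (Icc 0 T) u₂ v₂ w₂) (hlow : ∀ t ∈ Icc 0 T, 2 * δ ≤ u₁ t)
    (hu : |u₁ 0 - u₂ 0| ≤ η) (hv : |v₁ 0 - v₂ 0| ≤ η) (hw : |w₁ 0 - w₂ 0| ≤ η)
    (hc : |c₁ - c₂| ≤ η) (hη : 2 * η * Real.exp (truncLip δ * T) < δ) :
    ∀ t ∈ Icc 0 T, |u₁ t - u₂ t| ≤ 2 * η * Real.exp (truncLip δ * T) ∧
      |v₁ t - v₂ t| ≤ 2 * η * Real.exp (truncLip δ * T) ∧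
      |w₁ t - w₂ t| ≤ 2 * η * Real.exp (truncLip δ * T) := by
  have hη0 : 0 ≤ η := (abs_nonneg _).trans hu
  have hexp : ∀ t, t ≤ T → 2 * η * Real.exp (truncLip δ * t) ≤ 2 * η * Real.exp (truncLip δ * T) := by
    intro t ht
    gcongr
  -- As long as u₂ stays above δ, both solutions satisfy the regularised equation.
  have key : ∀ S ∈ Icc 0 T, (∀ t ∈ Icc 0 S, δ ≤ u₂ t) →
      ∀ t ∈ Icc 0 S, |u₁ t - u₂ t| ≤ 2 * η * Real.exp (truncLip δ * T) ∧
      |v₁ t - v₂ t| ≤ 2 * η * Real.exp (truncLip δ * T) ∧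
      |w₁ t - w₂ t| ≤ 2 * η * Real.exp (truncLip δ * T) := by
    intro S hS hlow₂ t ht
    have := trunc_stability (T := S) hδ (c₁ := c₁) (c₂ := c₂) (u₁ := u₁) (v₁ := v₁) (w₁ := w₁)
      (u₂ := u₂) (v₂ := v₂) (w₂ := w₂)
      (fun t ht => by
        have ht' : t ∈ Icc 0 T := ⟨ht.1, ht.2.trans hS.2⟩
        obtain ⟨_, a1, a2, a3⟩ := h₁ t ht'
        rw [truncCube_of_le (by linarith [hlow t ht'])]
        exact ⟨a1, a2, a3⟩)
      (fun t ht => by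
        have ht' : t ∈ Icc 0 T := ⟨ht.1, ht.2.trans hS.2⟩
        obtain ⟨_, a1, a2, a3⟩ := h₂ t ht'
        rw [truncCube_of_le (hlow₂ t ht)]
        exact ⟨a1, a2, a3⟩) hu hv hw hc t ht
    have hle := hexp t (ht.2.trans hS.2)
    exact ⟨this.1.trans hle, this.2.1.trans hle, this.2.2.trans hle⟩
  intro t ht
  have hT : 0 ≤ T := ht.1.trans ht.2
  refine key T (right_mem_Icc.2 hT) ?_ t ht
  by_contra hcon
  push Not at hcon
  obtain ⟨s, hs, hsδ⟩ := hcon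
  have hcont : ContinuousOn u₂ (Icc 0 T) := fun t ht =>
    (h₂ t ht).2.1.continuousAt.continuousWithinAt
  -- At the first time S at which u₂ comes down to δ the estimate is still available, and it gives
  -- u₂ S > 2δ - δ.
  set A := Icc 0 T ∩ u₂ ⁻¹' Iic δ with hA
  have hAc : IsCompact A := (isCompact_Icc.of_isClosed_subset
    (hcont.preimage_isClosed_of_isClosed isClosed_Icc isClosed_Iic) inter_subset_left)
  obtain ⟨S, hS, hmin⟩ := hAc.exists_isLeast ⟨s, hs, le_of_lt hsδ⟩
  have hlow₂ : ∀ t ∈ Ico 0 S, δ ≤ u₂ t := by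
    intro t ht
    by_contra hlt
    push Not at hlt
    have : S ≤ t := hmin ⟨⟨ht.1, ht.2.le.trans hS.1.2⟩, hlt.le⟩
    linarith [ht.2]
  have hu0 : δ < u₂ 0 := by
    have h1 := hlow 0 (left_mem_Icc.2 hT)
    have h2 := (abs_le.1 hu).2
    have h3 : 1 ≤ Real.exp (truncLip δ * T) := Real.one_le_exp (by positivity)
    nlinarith
  have hS0 : 0 < S := by
    rcases eq_or_lt_of_le hS.1.1 with h | h
    · exfalso
      have := hS.2
      rw [← h] at this
      exact absurd this (not_le.2 hu0)
    · exact h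
  have hSδ : δ ≤ u₂ S := by
    have hcl : S ∈ closure (Ico 0 S) := by rw [closure_Ico hS0.ne]; exact right_mem_Icc.2 hS0.le
    have hcS : ContinuousWithinAt u₂ (Ico 0 S) S := (h₂ S hS.1).2.1.continuousAt.continuousWithinAt
    have him : u₂ '' Ico 0 S ⊆ Ici δ := by
      rintro _ ⟨t, ht, rfl⟩
      exact hlow₂ t ht
    exact (isClosed_Ici.closure_subset_iff.2 him) (hcS.mem_closure_image hcl)
  have hlow₃ : ∀ t ∈ Icc 0 S, δ ≤ u₂ t := by
    intro t ht
    rcases eq_or_lt_of_le ht.2 with h | h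
    · rw [h]; exact hSδ
    · exact hlow₂ t ⟨ht.1, h⟩
  have := (key S hS.1 hlow₃ S (right_mem_Icc.2 hS0.le)).1
  have h1 := hlow S hS.1
  have h2 : u₂ S ≤ δ := hS.2
  linarith [(abs_le.1 this).2]

/-! ### Descent along a nearly straight line -/

theorem hasDerivAt_inv_comp {u : ℝ → ℝ} {v t : ℝ} (h : HasDerivAt u v t) (hu : 0 < u t) :
    HasDerivAt (fun s => (u s)⁻¹) (-v * (u t ^ 2)⁻¹) t :=
  (h.fun_inv hu.ne').congr_deriv (by field_simp)

theorem hasDerivAt_inv_sq_comp {u : ℝ → ℝ} {v t : ℝ} (h : HasDerivAt u v t) (hu : 0 < u t) :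
    HasDerivAt (fun s => (u s ^ 2)⁻¹) (-2 * v * (u t ^ 3)⁻¹) t :=
  ((h.fun_pow 2).fun_inv (by positivity)).congr_deriv (by norm_num; field_simp)

/-- A solution starting at height `h` with slope `-K` and small second derivative descends to
the level `Y`, with slope close to `-K` all along. -/
theorem exists_descent_time {K Y h ω : ℝ} (hK : 0 < K) (hY : 16 ≤ K ^ 3 * Y) (hYh : Y < h)
    (hω : 0 ≤ ω) (hωh : ω * h ≤ K ^ 2 / 16) {u v w r : ℝ → ℝ}
    (hd : ∀ t, 0 ≤ t → HasDerivAt u (v t) t ∧ HasDerivAt v (w t) t ∧ HasDerivAt w (r t) t)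
    (hr : ∀ t, 0 ≤ t → Y ≤ u t → u t ≤ h → 0 ≤ r t ∧ r t ≤ (u t ^ 3)⁻¹)
    (hu0 : u 0 = h) (hv0 : v 0 = -K) (hw0 : |w 0| ≤ ω) :
    ∃ T, 0 < T ∧ u T = Y ∧ K / 2 * T ≤ h - Y ∧ ∀ t ∈ Icc 0 T,
      Y ≤ u t ∧ v t ≤ -K / 2 ∧ -K - ω * t ≤ v t ∧ v t ≤ -K + ω * t + 2 / K ^ 2 * (u t)⁻¹ ∧
      -ω ≤ w t ∧ w t ≤ ω + 1 / K * (u t ^ 2)⁻¹ := by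
  have hY0 : 0 < Y := by
    by_contra hn
    push Not at hn
    nlinarith [pow_pos hK 3]
  have hcu : ∀ t, 0 ≤ t → ContinuousAt u t := fun t ht => (hd t ht).1.continuousAt
  have hcv : ∀ t, 0 ≤ t → ContinuousAt v t := fun t ht => (hd t ht).2.1.continuousAt
  -- Bootstrap: T is the first time at which either the slope rises to -K/2 or the level Y is
  -- reached. The bounds obtained up to T then exclude the first alternative.
  set A : Set ℝ := {t | 0 ≤ t ∧ (-K / 2 ≤ v t ∨ u t ≤ Y)} with hA
  have hAcl : IsClosed A := by
    have h1 : IsClosed (Ici (0:ℝ) ∩ v ⁻¹' Ici (-K / 2)) :=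
      ContinuousOn.preimage_isClosed_of_isClosed
        (fun t ht => (hcv t ht).continuousWithinAt) isClosed_Ici isClosed_Ici
    have h2 : IsClosed (Ici (0:ℝ) ∩ u ⁻¹' Iic Y) :=
      ContinuousOn.preimage_isClosed_of_isClosed
        (fun t ht => (hcu t ht).continuousWithinAt) isClosed_Ici isClosed_Iic
    have : A = (Ici (0:ℝ) ∩ v ⁻¹' Ici (-K / 2)) ∪ (Ici (0:ℝ) ∩ u ⁻¹' Iic Y) := by
      ext t; simp only [hA, mem_ofPred_eq, mem_union, mem_inter_iff, mem_Ici, mem_preimage, mem_Iic]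
      tauto
    rw [this]
    exact h1.union h2
  have hbase : ∀ S, 0 ≤ S → (∀ t ∈ Ico 0 S, v t ≤ -K / 2) → u S ≤ h - K / 2 * S := by
    intro S hS hv
    have := sub_le_sub_of_deriv_le hS (fun t ht => (hd t ht.1).1)
      (fun t _ => hasDerivAt_affine 0 (-K / 2) 0 t) (fun t ht => hv t ⟨ht.1.le, ht.2⟩)
    rw [hu0] at this
    linarith
  have hAne : A.Nonempty := by
    by_contra hne
    rw [not_nonempty_iff_eq_empty] at hne
    have hno : ∀ t, 0 ≤ t → v t < -K / 2 ∧ Y < u t := by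
      intro t ht
      have : t ∉ A := by rw [hne]; exact notMem_empty t
      simp only [hA, mem_ofPred_eq, not_and, not_or, not_le] at this
      exact this ht
    have hS : 0 ≤ 2 * h / K := by have := hY0.trans hYh; positivity
    have := hbase (2 * h / K) hS (fun t ht => (hno t ht.1).1.le)
    have h2 := (hno _ hS).2
    have h3 : K / 2 * (2 * h / K) = h := by field_simp
    linarith
  have hbdd : BddBelow A := ⟨0, fun t ht => ht.1⟩
  have hT := hAcl.csInf_mem hAne hbdd
  set T := sInf A with hTdef
  have hlow : ∀ t, 0 ≤ t → t < T → v t < -K / 2 ∧ Y < u t := by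
    intro t h0 ht
    have : t ∉ A := fun hm => absurd (csInf_le hbdd hm) (not_le.2 ht)
    simp only [hA, mem_ofPred_eq, not_and, not_or, not_le] at this
    exact this h0
  have hT0 : 0 < T := by
    rcases eq_or_lt_of_le hT.1 with h0 | h0
    · exfalso
      rcases hT.2 with h1 | h1 <;> rw [← h0] at h1
      · rw [hv0] at h1; linarith
      · rw [hu0] at h1; linarith
    · exact h0
  have hclos : ∀ t ∈ Icc 0 T, v t ≤ -K / 2 ∧ Y ≤ u t := by
    intro t ht
    rcases eq_or_lt_of_le ht.2 with h1 | h1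
    · have hcl : T ∈ closure (Ico 0 T) := by
        rw [closure_Ico hT0.ne]; exact right_mem_Icc.2 hT0.le
      rw [h1]
      constructor
      · have him : v '' Ico 0 T ⊆ Iic (-K / 2) := by
          rintro _ ⟨s, hs, rfl⟩
          exact (hlow s hs.1 hs.2).1.le
        exact (isClosed_Iic.closure_subset_iff.2 him)
          ((hcv T hT0.le).continuousWithinAt.mem_closure_image hcl)
      · have him : u '' Ico 0 T ⊆ Ici Y := by
          rintro _ ⟨s, hs, rfl⟩
          exact (hlow s hs.1 hs.2).2.le
        exact (isClosed_Ici.closure_subset_iff.2 him)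
          ((hcu T hT0.le).continuousWithinAt.mem_closure_image hcl)
    · exact ⟨(hlow t ht.1 h1).1.le, (hlow t ht.1 h1).2.le⟩
  have huh : ∀ t ∈ Icc 0 T, u t ≤ h := by
    intro t ht
    have := hbase t ht.1 (fun s hs => (hclos s ⟨hs.1, hs.2.le.trans ht.2⟩).1)
    nlinarith [ht.1]
  have hupos : ∀ t ∈ Icc 0 T, 0 < u t := fun t ht => hY0.trans_le (hclos t ht).2
  have hTh : K / 2 * T ≤ h - Y := by
    have := hbase T hT0.le (fun s hs => (hclos s ⟨hs.1, hs.2.le⟩).1)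
    linarith [(hclos T (right_mem_Icc.2 hT0.le)).2]
  have hsub : ∀ t ∈ Icc 0 T, ∀ s ∈ Icc 0 t, s ∈ Icc 0 T := fun t ht s hs =>
    ⟨hs.1, hs.2.trans ht.2⟩
  have hwlow : ∀ t ∈ Icc 0 T, -ω ≤ w t := by
    intro t ht
    have := le_of_deriv_nonneg ht.1 (fun s hs => (hd s hs.1).2.2) (fun s hs =>
      have hs' := hsub t ht s (Ioo_subset_Icc_self hs)
      (hr s hs'.1 (hclos s hs').2 (huh s hs')).1)
    linarith [(abs_le.1 hw0).1]
  -- Because -v ≥ K/2, the derivative of u⁻²/K dominates u⁻³; the bound for v below uses 2u⁻¹/K² in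
  -- the same way.
  have hwup : ∀ t ∈ Icc 0 T, w t ≤ ω + 1 / K * (u t ^ 2)⁻¹ := by
    intro t ht
    have := sub_le_sub_of_deriv_le ht.1 (fun s hs => (hd s hs.1).2.2)
      (fun s hs => (hasDerivAt_inv_sq_comp (hd s hs.1).1
        (hupos s (hsub t ht s hs))).const_mul (1 / K)) (fun s hs => by
        have hs' := hsub t ht s (Ioo_subset_Icc_self hs)
        have h1 := (hr s hs'.1 (hclos s hs').2 (huh s hs')).2
        have h2 := (hclos s hs').1
        have h3 : 0 < (u s ^ 3)⁻¹ := inv_pos.2 (pow_pos (hupos s hs') 3)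
        have h4 : 1 / K * (-2 * v s * (u s ^ 3)⁻¹) = (-2 * v s / K) * (u s ^ 3)⁻¹ := by ring
        rw [h4]
        have h5 : 1 ≤ -2 * v s / K := by rw [le_div_iff₀ hK]; linarith
        nlinarith)
    have h0 : 0 ≤ 1 / K * (u 0 ^ 2)⁻¹ := by positivity
    linarith [(abs_le.1 hw0).2]
  have hvlow : ∀ t ∈ Icc 0 T, -K - ω * t ≤ v t := by
    intro t ht
    have := sub_le_sub_of_deriv_le ht.1 (fun s _ => hasDerivAt_affine 0 (-ω) 0 s)
      (fun s hs => (hd s hs.1).2.1) (fun s hs =>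
        hwlow s (hsub t ht s (Ioo_subset_Icc_self hs)))
    rw [hv0] at this
    linarith
  have hvup : ∀ t ∈ Icc 0 T, v t ≤ -K + ω * t + 2 / K ^ 2 * (u t)⁻¹ := by
    intro t ht
    have := sub_le_sub_of_deriv_le ht.1 (fun s hs => (hd s hs.1).2.1)
      (fun s hs => (hasDerivAt_affine 0 ω 0 s).fun_add ((hasDerivAt_inv_comp (hd s hs.1).1
        (hupos s (hsub t ht s hs))).const_mul (2 / K ^ 2))) (fun s hs => by
        have hs' := hsub t ht s (Ioo_subset_Icc_self hs)
        have h1 := hwup s hs'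
        have h2 := (hclos s hs').1
        have h3 : 0 < (u s ^ 2)⁻¹ := inv_pos.2 (pow_pos (hupos s hs') 2)
        have h4 : 2 / K ^ 2 * (-v s * (u s ^ 2)⁻¹) = 1 / K * (u s ^ 2)⁻¹ * (-2 * v s / K) := by
          field_simp
        rw [h4]
        have h5 : 1 ≤ -2 * v s / K := by rw [le_div_iff₀ hK]; linarith
        have h6 : 0 < 1 / K * (u s ^ 2)⁻¹ := by positivity
        nlinarith)
    have h0 : 0 ≤ 2 / K ^ 2 * (u 0)⁻¹ := by
      have := hupos 0 (left_mem_Icc.2 hT0.le); positivity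
    rw [hv0] at this
    linarith
  refine ⟨T, hT0, ?_, hTh, fun t ht => ⟨(hclos t ht).2, (hclos t ht).1, hvlow t ht, hvup t ht,
    hwlow t ht, hwup t ht⟩⟩
  have hTm := right_mem_Icc.2 hT0.le
  refine le_antisymm ?_ (hclos T hTm).2
  rcases hT.2 with h1 | h1
  -- Here 16 ≤ K³Y and ωh ≤ K²/16 make each correction at most K/8, so the slope is at most -3K/4
  -- and cannot have risen to -K/2.
  · exfalso
    have h2 := hvup T hTm
    have h3 : 2 / K ^ 2 * (u T)⁻¹ ≤ K / 8 := by
      have h4 : (u T)⁻¹ ≤ Y⁻¹ := inv_anti₀ hY0 (hclos T hTm).2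
      calc 2 / K ^ 2 * (u T)⁻¹ ≤ 2 / K ^ 2 * Y⁻¹ := by gcongr
        _ ≤ K / 8 := by
          rw [← div_eq_mul_inv, div_div, div_le_iff₀ (by positivity)]
          nlinarith
    have h5 : ω * T ≤ K / 8 := by
      have h6 : T ≤ 2 * h / K := by rw [le_div_iff₀ hK]; linarith
      calc ω * T ≤ ω * (2 * h / K) := by gcongr
        _ = 2 * (ω * h) / K := by ring
        _ ≤ 2 * (K ^ 2 / 16) / K := by gcongr
        _ = K / 8 := by field_simp; norm_num
    linarith
  · exact h1

/-! ### Comparison of solutions backwards in time -/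

/-- An absorption argument. With N = max |D'|, D(0) = 0 gives |D(s)| ≤ N|s| ≤ Nz/k for z = Y - ks,
so |D'''| ≤ 3Nz⁻³/k + ε. Two integrations from -S bound |D'| by the data at -S plus 3N/(2k³Y) ≤ N/2,
and the last term is absorbed. The dependence on S is polynomial, where Grönwall's inequality would
be exponential. -/
theorem backward_estimate {k Y S ε : ℝ} (hk : 0 < k) (hS : 0 ≤ S) (hε : 0 ≤ ε)
    (hY : 3 ≤ k ^ 3 * Y) {D D₁ D₂ D₃ : ℝ → ℝ}
    (hd : ∀ s ∈ Icc (-S) 0, HasDerivAt D (D₁ s) s ∧ HasDerivAt D₁ (D₂ s) s ∧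
      HasDerivAt D₂ (D₃ s) s)
    (h0 : D 0 = 0)
    (h3 : ∀ s ∈ Icc (-S) 0, |D₃ s| ≤ 3 * ((Y - k * s) ^ 4)⁻¹ * |D s| + ε) :
    (∀ s ∈ Icc (-S) 0, |D₁ s| ≤ 2 * (|D₁ (-S)| + S * |D₂ (-S)| + ε * S ^ 2)) ∧
    |D₂ 0| ≤ |D₂ (-S)| + ε * S +
      3 / (k ^ 2 * Y ^ 2) * (|D₁ (-S)| + S * |D₂ (-S)| + ε * S ^ 2) := by
  have hY0 : 0 < Y := by
    by_contra hn
    push Not at hn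
    nlinarith [pow_pos hk 3]
  have hne : (Icc (-S) 0).Nonempty := ⟨0, by constructor <;> linarith⟩
  have hcont : ContinuousOn (fun s => |D₁ s|) (Icc (-S) 0) := fun s hs =>
    (hd s hs).2.1.continuousAt.abs.continuousWithinAt
  obtain ⟨s₀, hs₀, hmax⟩ := isCompact_Icc.exists_isMaxOn hne hcont
  set N := |D₁ s₀| with hN
  have hN0 : 0 ≤ N := abs_nonneg _
  have hNle : ∀ s ∈ Icc (-S) 0, |D₁ s| ≤ N := fun s hs => hmax hs
  have hD : ∀ s ∈ Icc (-S) 0, |D s| ≤ N * (-s) := by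
    intro s hs
    have := abs_sub_le_sub_of_abs_deriv_le hs.2 (fun t ht => (hd t ⟨hs.1.trans ht.1, ht.2⟩).1)
      (fun t _ => hasDerivAt_affine 0 N 0 t)
      (fun t ht => hNle t ⟨hs.1.trans ht.1.le, ht.2.le⟩)
    rw [h0, zero_sub, abs_neg] at this
    linarith
  have hz : ∀ s ∈ Icc (-S) 0, 0 < Y - k * s := fun s hs => by nlinarith [hs.2]
  have hzd : ∀ s, HasDerivAt (fun s => Y - k * s) (-k) s := fun s => by
    simpa using ((hasDerivAt_id' s).const_mul k).const_sub Y
  have hD3 : ∀ s ∈ Icc (-S) 0, |D₃ s| ≤ 3 * N / k * ((Y - k * s) ^ 3)⁻¹ + ε := by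
    intro s hs
    refine (h3 s hs).trans ?_
    have h1 := hD s hs
    have h2 := hz s hs
    have h4 : -s ≤ (Y - k * s) / k := by rw [le_div_iff₀ hk]; linarith
    have h5 : |D s| ≤ N * ((Y - k * s) / k) := h1.trans (by gcongr)
    have h6 : 3 * ((Y - k * s) ^ 4)⁻¹ * |D s| ≤
        3 * ((Y - k * s) ^ 4)⁻¹ * (N * ((Y - k * s) / k)) := by gcongr
    have h7 : 3 * ((Y - k * s) ^ 4)⁻¹ * (N * ((Y - k * s) / k)) =
        3 * N / k * ((Y - k * s) ^ 3)⁻¹ := by field_simp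
    linarith
  have hD2 : ∀ s ∈ Icc (-S) 0,
      |D₂ s| ≤ |D₂ (-S)| + 3 * N / (2 * k ^ 2) * ((Y - k * s) ^ 2)⁻¹ + ε * S := by
    intro s hs
    have := abs_sub_le_sub_of_abs_deriv_le hs.1 (fun t ht => (hd t ⟨ht.1, ht.2.trans hs.2⟩).2.2)
      (fun t ht => ((hasDerivAt_inv_sq_comp (hzd t) (hz t ⟨ht.1, ht.2.trans hs.2⟩)).const_mul
        (3 * N / (2 * k ^ 2))).fun_add (hasDerivAt_affine 0 ε 0 t))
      (fun t ht => by
        refine (hD3 t ⟨ht.1.le, ht.2.le.trans hs.2⟩).trans (le_of_eq ?_)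
        field_simp)
    have h4 : |D₂ s| ≤ |D₂ (-S)| + |D₂ s - D₂ (-S)| := by
      have := abs_add_le (D₂ (-S)) (D₂ s - D₂ (-S)); rwa [add_sub_cancel] at this
    have h5 : 0 ≤ 3 * N / (2 * k ^ 2) * ((Y - k * (-S)) ^ 2)⁻¹ := by positivity
    have h6 : ε * (s - 0) - ε * (-S - 0) ≤ ε * S := by nlinarith [hs.2]
    linarith
  have hD1 : ∀ s ∈ Icc (-S) 0,
      |D₁ s| ≤ |D₁ (-S)| + S * |D₂ (-S)| + ε * S ^ 2 + N / 2 := by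
    intro s hs
    have := abs_sub_le_sub_of_abs_deriv_le hs.1 (fun t ht => (hd t ⟨ht.1, ht.2.trans hs.2⟩).2.1)
      (fun t ht => ((hasDerivAt_inv_comp (hzd t) (hz t ⟨ht.1, ht.2.trans hs.2⟩)).const_mul
        (3 * N / (2 * k ^ 3))).fun_add (hasDerivAt_affine 0 (|D₂ (-S)| + ε * S) 0 t))
      (fun t ht => by
        refine (hD2 t ⟨ht.1.le, ht.2.le.trans hs.2⟩).trans (le_of_eq ?_)
        field_simp
        ring)
    have h4 : |D₁ s| ≤ |D₁ (-S)| + |D₁ s - D₁ (-S)| := by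
      have := abs_add_le (D₁ (-S)) (D₁ s - D₁ (-S)); rwa [add_sub_cancel] at this
    have h5 : 0 ≤ 3 * N / (2 * k ^ 3) * (Y - k * (-S))⁻¹ := by
      have := hz (-S) ⟨le_rfl, by linarith⟩
      positivity
    have h6 : 3 * N / (2 * k ^ 3) * (Y - k * s)⁻¹ ≤ N / 2 := by
      have h7 : (Y - k * s)⁻¹ ≤ Y⁻¹ := inv_anti₀ hY0 (by nlinarith [hs.2])
      calc 3 * N / (2 * k ^ 3) * (Y - k * s)⁻¹ ≤ 3 * N / (2 * k ^ 3) * Y⁻¹ := by gcongr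
        _ ≤ N / 2 := by
          rw [← div_eq_mul_inv, div_div, div_le_iff₀ (by positivity)]
          nlinarith
    have h8 : 0 ≤ |D₂ (-S)| + ε * S := by positivity
    have h9 : (|D₂ (-S)| + ε * S) * (s - 0) - (|D₂ (-S)| + ε * S) * (-S - 0)
        ≤ (|D₂ (-S)| + ε * S) * S := by nlinarith [hs.2]
    have h10 : (|D₂ (-S)| + ε * S) * S = S * |D₂ (-S)| + ε * S ^ 2 := by ring
    linarith
  have hNfin : N ≤ 2 * (|D₁ (-S)| + S * |D₂ (-S)| + ε * S ^ 2) := by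
    have := hD1 s₀ hs₀
    linarith
  refine ⟨fun s hs => (hNle s hs).trans hNfin, ?_⟩
  have h4 := hD2 0 ⟨by linarith, le_rfl⟩
  have h5 : 3 * N / (2 * k ^ 2) * ((Y - k * 0) ^ 2)⁻¹ ≤
      3 / (k ^ 2 * Y ^ 2) * (|D₁ (-S)| + S * |D₂ (-S)| + ε * S ^ 2) := by
    calc 3 * N / (2 * k ^ 2) * ((Y - k * 0) ^ 2)⁻¹ = 3 / (k ^ 2 * Y ^ 2) * (N / 2) := by
          rw [mul_zero, sub_zero]; field_simp
      _ ≤ _ := by gcongr; linarith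
  linarith

/-- Two solutions of equal height at time 0, both above the line Y - ks, are controlled on the whole
interval by their slopes and second derivatives at -S. Above that line y⁻³ has Lipschitz constant
3(Y - ks)⁻⁴, the weight in `backward_estimate`. -/
theorem backward_comparison {k Y S c : ℝ} (hk : 0 < k) (hS : 0 ≤ S) (hY : 3 ≤ k ^ 3 * Y)
    {u v w φ φ₁ φ₂ : ℝ → ℝ} (hu : SolvesOn c (Icc (-S) 0) u v w)
    (hφ : SolvesOn 0 (Icc (-S) 0) φ φ₁ φ₂) (h0 : u 0 = φ 0)
    (hul : ∀ s ∈ Icc (-S) 0, Y - k * s ≤ u s) (hφl : ∀ s ∈ Icc (-S) 0, Y - k * s ≤ φ s) :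
    (∀ s ∈ Icc (-S) 0, |v s - φ₁ s| ≤
      2 * (|v (-S) - φ₁ (-S)| + S * |w (-S) - φ₂ (-S)| + |c| * S ^ 2)) ∧
    |w 0 - φ₂ 0| ≤ |w (-S) - φ₂ (-S)| + |c| * S +
      3 / (k ^ 2 * Y ^ 2) * (|v (-S) - φ₁ (-S)| + S * |w (-S) - φ₂ (-S)| + |c| * S ^ 2) := by
  have hY0 : 0 < Y := by
    by_contra hn
    push Not at hn
    nlinarith [pow_pos hk 3]
  refine backward_estimate (D := fun s => u s - φ s) (D₁ := fun s => v s - φ₁ s)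
    (D₂ := fun s => w s - φ₂ s) (D₃ := fun s => ((u s ^ 3)⁻¹ - c) - ((φ s ^ 3)⁻¹ - 0))
    hk hS (abs_nonneg c) hY (fun s hs => ?_) (by simp [h0]) (fun s hs => ?_)
  · obtain ⟨_, a1, a2, a3⟩ := hu s hs
    obtain ⟨_, b1, b2, b3⟩ := hφ s hs
    exact ⟨a1.sub b1, a2.sub b2, a3.sub b3⟩
  · have hz : 0 < Y - k * s := by nlinarith [hs.2]
    have := truncCube_sub_le hz (u s) (φ s)
    rw [truncCube_of_le (hul s hs), truncCube_of_le (hφl s hs)] at this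
    have h1 : (u s ^ 3)⁻¹ - c - ((φ s ^ 3)⁻¹ - 0) = ((u s ^ 3)⁻¹ - (φ s ^ 3)⁻¹) + (-c) := by ring
    rw [h1]
    refine (abs_add_le _ _).trans ?_
    rw [abs_neg]
    linarith

/-! ### Profiles -/

theorem isLittleO_pow_of_deriv {f f' : ℝ → ℝ} {n : ℕ} {T₀ : ℝ}
    (hf : ∀ t, T₀ ≤ t → HasDerivAt f (f' t) t)
    (h : f' =o[atTop] fun t : ℝ => t ^ n) : f =o[atTop] fun t : ℝ => t ^ (n + 1) := by
  rw [isLittleO_iff]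
  intro c hc
  obtain ⟨T₁, hT₁⟩ := eventually_atTop.1 (h.def (half_pos hc))
  set T := max (max T₀ T₁) 1
  have hT0 : T₀ ≤ T := (le_max_left _ _).trans (le_max_left _ _)
  have hT1 : T₁ ≤ T := (le_max_right _ _).trans (le_max_left _ _)
  have hT2 : 1 ≤ T := le_max_right _ _
  filter_upwards [eventually_ge_atTop T, eventually_ge_atTop (2 * |f T| / c)] with t ht ht2
  have ht0 : 0 < t := by linarith
  have h1 := abs_sub_le_sub_of_abs_deriv_le ht (fun s hs => hf s (hT0.trans hs.1))
    (fun s _ => hasDerivAt_affine 0 (c / 2 * t ^ n) 0 s) (fun s hs => by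
      have := hT₁ s (hT1.trans hs.1.le)
      have hs0 : 0 < s := by linarith [hs.1]
      rw [Real.norm_eq_abs, Real.norm_eq_abs, abs_of_pos (pow_pos hs0 n)] at this
      refine this.trans ?_
      have := pow_le_pow_left₀ hs0.le hs.2.le n
      gcongr)
  have h2 : |f T| ≤ c / 2 * t ^ (n + 1) := by
    have h3 : t ≤ t ^ (n + 1) := le_self_pow₀ (by linarith) (by omega)
    rw [div_le_iff₀ hc] at ht2
    nlinarith
  have h4 : |f t| ≤ |f t - f T| + |f T| := by
    have := abs_add_le (f t - f T) (f T); rwa [sub_add_cancel] at this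
  rw [Real.norm_eq_abs, Real.norm_eq_abs, abs_of_pos (pow_pos ht0 _)]
  have h5 : c / 2 * t ^ n * (t - 0) = c / 2 * t ^ (n + 1) := by ring
  have h6 : 0 ≤ c / 2 * t ^ n * (T - 0) := mul_nonneg (by positivity) (by linarith)
  linarith

theorem hasDerivAt_of_contDiffAt_three {f : ℝ → ℝ} {t : ℝ} (h : ContDiffAt ℝ 3 f t) :
    HasDerivAt f (deriv f t) t ∧ HasDerivAt (deriv f) (iteratedDeriv 2 f t) t ∧
      HasDerivAt (iteratedDeriv 2 f) (iteratedDeriv 3 f t) t := by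
  have h1 : ContDiffAt ℝ 2 (deriv f) t := h.derivWithin (by norm_num)
  have h2 : ContDiffAt ℝ 1 (deriv (deriv f)) t := h1.derivWithin (by norm_num)
  have e2 : iteratedDeriv 2 f = deriv (deriv f) := by
    rw [iteratedDeriv_succ, iteratedDeriv_one]
  have e3 : iteratedDeriv 3 f = deriv (iteratedDeriv 2 f) := iteratedDeriv_succ
  refine ⟨(h.differentiableAt (by norm_num)).hasDerivAt, ?_, ?_⟩
  · rw [e2]
    exact (h1.differentiableAt (by norm_num)).hasDerivAt
  · rw [e3, e2]
    exact (h2.differentiableAt (by norm_num)).hasDerivAt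

/-- A global solution of `φ''' = φ⁻³`, convex, with slope decreasing to `-K` at `-∞`; here `φ₁`
and `φ₂` are the first and second derivatives. -/
structure IsProfile (K : ℝ) (φ φ₁ φ₂ : ℝ → ℝ) : Prop where
  solves : SolvesOn 0 univ φ φ₁ φ₂
  slope : ∀ t, -K ≤ φ₁ t
  convex : ∀ t, 0 ≤ φ₂ t
  tendsto_slope : Tendsto φ₁ atBot (𝓝 (-K))

namespace IsProfile

variable {K : ℝ} {φ φ₁ φ₂ : ℝ → ℝ}

theorem pos (h : IsProfile K φ φ₁ φ₂) (t : ℝ) : 0 < φ t := (h.solves t (mem_univ t)).1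

theorem deriv_zero (h : IsProfile K φ φ₁ φ₂) (t : ℝ) : HasDerivAt φ (φ₁ t) t :=
  (h.solves t (mem_univ t)).2.1

theorem deriv_one (h : IsProfile K φ φ₁ φ₂) (t : ℝ) : HasDerivAt φ₁ (φ₂ t) t :=
  (h.solves t (mem_univ t)).2.2.1

theorem deriv_two (h : IsProfile K φ φ₁ φ₂) (t : ℝ) : HasDerivAt φ₂ ((φ t ^ 3)⁻¹) t := by
  simpa using (h.solves t (mem_univ t)).2.2.2

theorem slope_mono (h : IsProfile K φ φ₁ φ₂) {s t : ℝ} (hst : s ≤ t) : φ₁ s ≤ φ₁ t :=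
  le_of_deriv_nonneg hst (fun x _ => h.deriv_one x) (fun x _ => h.convex x)

theorem second_strictMono (h : IsProfile K φ φ₁ φ₂) : StrictMono φ₂ := fun _ _ hst =>
  lt_of_deriv_pos hst (fun x _ => h.deriv_two x) (fun x _ => inv_pos.2 (pow_pos (h.pos x) 3))

theorem second_pos (h : IsProfile K φ φ₁ φ₂) (t : ℝ) : 0 < φ₂ t :=
  (h.convex (t - 1)).trans_lt (h.second_strictMono (by linarith))

theorem comp_add (h : IsProfile K φ φ₁ φ₂) (c : ℝ) :
    IsProfile K (fun t => φ (t + c)) (fun t => φ₁ (t + c)) (fun t => φ₂ (t + c)) where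
  solves := h.solves.comp_add c fun _ _ => mem_univ _
  slope _ := h.slope _
  convex _ := h.convex _
  tendsto_slope := h.tendsto_slope.comp (tendsto_atBot_add_const_right _ c tendsto_id)

/-- As φ₂ is increasing, (S/2)φ₂(-S) is at most the increment of φ₁ over [-S, -S/2], which vanishes
in the limit because φ₁ converges. -/
theorem tendsto_mul_second (h : IsProfile K φ φ₁ φ₂) :
    Tendsto (fun S => S * φ₂ (-S)) atTop (𝓝 0) := by
  have h1 : Tendsto (fun S : ℝ => φ₁ (-S)) atTop (𝓝 (-K)) :=
    h.tendsto_slope.comp tendsto_neg_atTop_atBot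
  have h2 : Tendsto (fun S : ℝ => φ₁ (-(S / 2))) atTop (𝓝 (-K)) :=
    h1.comp (tendsto_id.atTop_div_const (by norm_num))
  have h3 : Tendsto (fun S : ℝ => 2 * (φ₁ (-(S / 2)) - φ₁ (-S))) atTop (𝓝 0) := by
    have := (h2.sub h1).const_mul 2
    simpa using this
  refine squeeze_zero' ?_ ?_ h3
  · filter_upwards [eventually_ge_atTop 0] with S hS
    exact mul_nonneg hS (h.convex _)
  · filter_upwards [eventually_ge_atTop 0] with S hS
    have := sub_le_sub_of_deriv_le (a := -S) (b := -(S / 2)) (by linarith)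
      (fun t _ => hasDerivAt_affine 0 (φ₂ (-S)) 0 t) (fun t _ => h.deriv_one t)
      (fun t ht => h.second_strictMono.monotone ht.1.le)
    linarith

/-- Permits translating a profile so that time 0 lies at a prescribed large height on the steep
descending branch. -/
theorem exists_level (h : IsProfile K φ φ₁ φ₂) (hK : 0 < K) :
    ∃ Y₁, ∀ Y, Y₁ ≤ Y → ∃ ζ, φ ζ = Y ∧ ∀ s, s ≤ ζ → φ₁ s ≤ -K / 2 := by
  obtain ⟨ζ₀, hζ₀⟩ := eventually_atBot.1
    (h.tendsto_slope.eventually (ge_mem_nhds (show -K < -K / 2 by linarith)))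
  refine ⟨φ ζ₀, fun Y hY => ?_⟩
  set t := ζ₀ - 2 / K * (Y - φ ζ₀) with ht
  have hle : t ≤ ζ₀ := by
    have : 0 ≤ 2 / K * (Y - φ ζ₀) := mul_nonneg (by positivity) (by linarith)
    linarith
  have h1 := sub_le_sub_of_deriv_le hle (fun s _ => h.deriv_zero s)
    (fun s _ => hasDerivAt_affine 0 (-K / 2) 0 s) (fun s hs => hζ₀ s hs.2.le)
  have h2 : Y ≤ φ t := by
    have : -K / 2 * (ζ₀ - 0) - -K / 2 * (t - 0) = -(Y - φ ζ₀) := by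
      rw [ht]; field_simp; ring
    linarith
  have hc : ContinuousOn φ (Icc t ζ₀) := fun s _ =>
    (h.deriv_zero s).continuousAt.continuousWithinAt
  obtain ⟨ζ, hζ, rfl⟩ := intermediate_value_Icc' hle hc ⟨hY, h2⟩
  exact ⟨ζ, rfl, fun s hs => hζ₀ s (hs.trans hζ.2)⟩

theorem lower_bound (h : IsProfile K φ φ₁ φ₂) (hs : ∀ s, s ≤ 0 → φ₁ s ≤ -K / 2) {s : ℝ}
    (hs0 : s ≤ 0) : φ 0 - K / 2 * s ≤ φ s := by
  have := sub_le_sub_of_deriv_le hs0 (fun t _ => h.deriv_zero t)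
    (fun t _ => hasDerivAt_affine 0 (-K / 2) 0 t) (fun t ht => hs t ht.2.le)
  linarith

/-- Both profiles have the same slope limit at -∞ and S·φ₂(-S) → 0, so all terms of
`backward_comparison` vanish as S → ∞; past time 0 forward uniqueness takes over. The constant 24 is
3·2³, since the comparison slope is k = K/2. -/
theorem eq_of_aligned {ψ ψ₁ ψ₂ : ℝ → ℝ} (h : IsProfile K φ φ₁ φ₂) (h' : IsProfile K ψ ψ₁ ψ₂)
    (hK : 0 < K) (h0 : ψ 0 = φ 0) (hY : 24 ≤ K ^ 3 * φ 0) (hs : ∀ s, s ≤ 0 → φ₁ s ≤ -K / 2)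
    (hs' : ∀ s, s ≤ 0 → ψ₁ s ≤ -K / 2) (t : ℝ) : ψ t = φ t := by
  have hcmp := fun (S : ℝ) (hS : 0 ≤ S) => backward_comparison (half_pos hK) hS
    (show 3 ≤ (K / 2) ^ 3 * φ 0 by linarith) (c := 0) (h'.solves.mono (subset_univ (Icc (-S) 0)))
    (h.solves.mono (subset_univ (Icc (-S) 0))) h0
    (fun s hsm => by rw [← h0]; exact h'.lower_bound hs' hsm.2)
    (fun s hsm => h.lower_bound hs hsm.2)
  have l1 : Tendsto (fun S : ℝ => |ψ₁ (-S) - φ₁ (-S)|) atTop (𝓝 0) := by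
    have := ((h'.tendsto_slope.comp tendsto_neg_atTop_atBot).sub
      (h.tendsto_slope.comp tendsto_neg_atTop_atBot)).abs
    simpa using this
  have l2 : Tendsto (fun S : ℝ => S * |ψ₂ (-S) - φ₂ (-S)|) atTop (𝓝 0) := by
    have := (h'.tendsto_mul_second.sub h.tendsto_mul_second).abs
    rw [sub_zero, abs_zero] at this
    refine this.congr' ?_
    filter_upwards [eventually_ge_atTop 0] with S hS
    rw [← mul_sub, abs_mul, abs_of_nonneg hS]
  have l3 : Tendsto (fun S : ℝ => |ψ₂ (-S) - φ₂ (-S)|) atTop (𝓝 0) := by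
    refine squeeze_zero' (Eventually.of_forall fun _ => abs_nonneg _) ?_ l2
    filter_upwards [eventually_ge_atTop 1] with S hS
    nlinarith [abs_nonneg (ψ₂ (-S) - φ₂ (-S))]
  have e1 : ∀ s, s ≤ 0 → ψ₁ s = φ₁ s := by
    intro s hs0
    have hle : |ψ₁ s - φ₁ s| ≤ 0 := by
      refine ge_of_tendsto (by simpa using (l1.add l2).const_mul 2) ?_
      filter_upwards [eventually_ge_atTop (-s)] with S hS
      have := (hcmp S (by linarith)).1 s ⟨by linarith, hs0⟩
      simpa using this
    exact sub_eq_zero.1 (abs_nonpos_iff.1 hle)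
  have e2 : ψ₂ 0 = φ₂ 0 := by
    have hle : |ψ₂ 0 - φ₂ 0| ≤ 0 := by
      refine ge_of_tendsto (by
        simpa using l3.add ((l1.add l2).const_mul (3 / ((K / 2) ^ 2 * (φ 0) ^ 2)))) ?_
      filter_upwards [eventually_ge_atTop 0] with S hS
      have := (hcmp S hS).2
      simpa using this
    exact sub_eq_zero.1 (abs_nonpos_iff.1 hle)
  rcases le_total t 0 with ht | ht
  · have := abs_sub_le_sub_of_abs_deriv_le ht
      (fun s _ => (h'.deriv_zero s).sub (h.deriv_zero s)) (fun s _ => hasDerivAt_const s (0:ℝ))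
      (fun s hs => by simp [e1 s hs.2.le])
    simp only [Pi.sub_apply, h0, sub_self, zero_sub, abs_neg] at this
    exact sub_eq_zero.1 (abs_nonpos_iff.1 this)
  · obtain ⟨s₀, _, hmin⟩ := isCompact_Icc.exists_isMinOn (nonempty_Icc.2 ht)
      (fun s _ => (h.deriv_zero s).continuousAt.continuousWithinAt : ContinuousOn φ (Icc 0 t))
    have := SolvesOn.stability (T := t) (η := 0) (half_pos (h.pos s₀)) (c₁ := 0) (c₂ := 0)
      (h.solves.mono (subset_univ _)) (h'.solves.mono (subset_univ _))
      (fun s hs => by have : φ s₀ ≤ φ s := hmin hs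
                      linarith) (by simp [h0]) (by simp [e1 0 le_rfl])
      (by simp [e2]) (by simp) (by simpa using h.pos s₀) t ⟨ht, le_rfl⟩
    have h3 := this.1
    simp only [mul_zero, zero_mul] at h3
    linarith [sub_eq_zero.1 (abs_nonpos_iff.1 h3)]

theorem unique_up_to_translation {ψ ψ₁ ψ₂ : ℝ → ℝ} (h : IsProfile K φ φ₁ φ₂)
    (h' : IsProfile K ψ ψ₁ ψ₂) (hK : 0 < K) : ∃ c, ∀ t, ψ t = φ (t + c) := by
  obtain ⟨Y₁, hY₁⟩ := h.exists_level hK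
  obtain ⟨Y₂, hY₂⟩ := h'.exists_level hK
  set Y := max (max Y₁ Y₂) (24 / K ^ 3)
  obtain ⟨a, ha, ha'⟩ := hY₁ Y ((le_max_left _ _).trans (le_max_left _ _))
  obtain ⟨b, hb, hb'⟩ := hY₂ Y ((le_max_right _ _).trans (le_max_left _ _))
  have hYK : 24 ≤ K ^ 3 * Y := by
    have : 24 / K ^ 3 ≤ Y := le_max_right _ _
    rw [div_le_iff₀ (by positivity)] at this
    linarith
  refine ⟨a - b, fun t => ?_⟩
  have := eq_of_aligned (h.comp_add a) (h'.comp_add b) hK (by simp [ha, hb]) (by simpa [ha])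
    (fun s hs => ha' _ (by linarith)) (fun s hs => hb' _ (by linarith)) (t - b)
  simp only [sub_add_cancel] at this
  rw [this]
  congr 1
  ring

theorem isEquivalent_atBot (h : IsProfile K φ φ₁ φ₂) (hK : 0 < K) :
    φ ~[atBot] fun ζ => -K * ζ := by
  have h1 : (fun t => -φ₁ (-t) - K) =o[atTop] fun t : ℝ => t ^ 0 := by
    simp only [pow_zero]
    rw [isLittleO_one_iff]
    have := ((h.tendsto_slope.comp tendsto_neg_atTop_atBot).neg).sub_const K
    simpa using this
  have h2 := isLittleO_pow_of_deriv (f := fun t => φ (-t) - K * t) (T₀ := 0) (fun t _ => by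
    have a1 := ((h.deriv_zero (-t)).scomp t (hasDerivAt_neg t)).sub
      ((hasDerivAt_id' t).const_mul K)
    exact a1.congr_deriv (by simp)) h1
  have h3 := h2.comp_tendsto tendsto_neg_atBot_atTop
  refine IsLittleO.trans_isBigO (g := fun ζ : ℝ => -ζ) ?_ ?_
  · refine h3.congr (fun ζ => ?_) (fun ζ => ?_)
    · simp
    · simp
  · refine IsBigO.of_bound K⁻¹ (Eventually.of_forall fun ζ => ?_)
    rw [norm_mul, norm_neg, norm_neg, Real.norm_of_nonneg hK.le]
    field_simp
    exact le_rfl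

/-- Monotonicity of φ₂ upgrades the asymptotics of φ to those of its slope. A negative value of φ₂
would persist backwards and drive φ below zero; by the resulting convexity, a slope below -K, or
slopes staying above -K + e, would contradict φ ~ -Kζ. -/
theorem of_isEquivalent (hK : 0 < K) (hs : SolvesOn 0 univ φ φ₁ φ₂)
    (he : φ ~[atBot] fun ζ => -K * ζ) : IsProfile K φ φ₁ φ₂ := by
  have d0 : ∀ t, HasDerivAt φ (φ₁ t) t := fun t => (hs t (mem_univ t)).2.1
  have d1 : ∀ t, HasDerivAt φ₁ (φ₂ t) t := fun t => (hs t (mem_univ t)).2.2.1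
  have d2 : ∀ t, HasDerivAt φ₂ ((φ t ^ 3)⁻¹) t := fun t => by
    simpa using (hs t (mem_univ t)).2.2.2
  have hp : ∀ t, 0 < φ t := fun t => (hs t (mem_univ t)).1
  have hbd : ∀ e, 0 < e → ∀ᶠ t in atBot, |φ t + K * t| ≤ e * (-t) := by
    intro e he0
    filter_upwards [he.isLittleO.def (c := e / K) (by positivity), eventually_lt_atBot 0]
      with t ht ht0
    have h1 : ‖-K * t‖ = K * (-t) := by
      rw [Real.norm_of_nonneg (by nlinarith)]; ring
    rw [h1] at ht
    have h2 : (φ - fun ζ => -K * ζ) t = φ t + K * t := by simp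
    rw [h2, Real.norm_eq_abs] at ht
    calc _ ≤ e / K * (K * -t) := ht
      _ = _ := by field_simp
  have m2 : ∀ s t, s ≤ t → φ₂ s ≤ φ₂ t := fun s t hst => le_of_deriv_nonneg hst
    (fun x _ => d2 x) (fun x _ => (inv_pos.2 (pow_pos (hp x) 3)).le)
  have conv : ∀ t, 0 ≤ φ₂ t := by
    intro t₀
    by_contra hneg
    push Not at hneg
    have h1 : ∀ t, t ≤ t₀ → φ₁ t₀ - φ₂ t₀ * (t₀ - t) ≤ φ₁ t := fun t ht => by
      have := sub_le_sub_of_deriv_le ht (fun s _ => d1 s)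
        (fun s _ => hasDerivAt_affine 0 (φ₂ t₀) 0 s) (fun s hs => m2 s t₀ hs.2.le)
      linarith
    set t₁ := t₀ - (1 + |φ₁ t₀|) / (-φ₂ t₀) with ht₁
    have hpos : 0 < (1 + |φ₁ t₀|) / (-φ₂ t₀) := by
      have := neg_pos.2 hneg
      positivity
    have h2 : ∀ t, t ≤ t₁ → 1 ≤ φ₁ t := by
      intro t ht
      have h3 := h1 t (by linarith)
      have h4 : (1 + |φ₁ t₀|) / (-φ₂ t₀) ≤ t₀ - t := by linarith
      rw [div_le_iff₀ (neg_pos.2 hneg)] at h4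
      linarith [neg_abs_le (φ₁ t₀)]
    have h5 := sub_le_sub_of_deriv_le (a := t₁ - φ t₁) (b := t₁) (by linarith [hp t₁])
      (fun s _ => hasDerivAt_affine 0 1 0 s) (fun s _ => d0 s) (fun s hs => h2 s hs.2.le)
    linarith [hp (t₁ - φ t₁)]
  have m1 : ∀ s t, s ≤ t → φ₁ s ≤ φ₁ t := fun s t hst => le_of_deriv_nonneg hst
    (fun x _ => d1 x) (fun x _ => conv x)
  have slope : ∀ t, -K ≤ φ₁ t := by
    intro t₀
    by_contra hlt
    push Not at hlt
    set e := (-K - φ₁ t₀) / 2 with hedef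
    have he0 : 0 < e := by rw [hedef]; linarith
    obtain ⟨t, ht1, ht2, ht3⟩ := ((hbd e he0).and ((eventually_le_atBot t₀).and
      (eventually_lt_atBot ((φ t₀ - φ₁ t₀ * t₀) / e)))).exists
    have := sub_le_sub_of_deriv_le ht2 (fun s _ => d0 s)
        (fun s _ => hasDerivAt_affine 0 (φ₁ t₀) 0 s) (fun s hs => m1 s t₀ hs.2.le)
    rw [lt_div_iff₀ he0] at ht3
    have h4 := (abs_le.1 ht1).2
    have h5 : φ₁ t₀ = -K - 2 * e := by rw [hedef]; ring
    rw [h5] at this ht3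
    linarith
  refine ⟨hs, slope, conv, ?_⟩
  rw [Metric.tendsto_nhds]
  intro e he0
  obtain ⟨t₀, ht₀⟩ : ∃ t, φ₁ t < -K + e := by
    by_contra hcon
    push Not at hcon
    obtain ⟨t, ht1, ht2, ht3⟩ := ((hbd (e / 2) (by positivity)).and ((eventually_le_atBot 0).and
      (eventually_lt_atBot (-φ 0 / (e / 2))))).exists
    have := sub_le_sub_of_deriv_le ht2 (fun s _ => hasDerivAt_affine 0 (-K + e) 0 s)
        (fun s _ => d0 s) (fun s hs => hcon s)
    rw [lt_div_iff₀ (by positivity)] at ht3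
    have h4 := (abs_le.1 ht1).1
    linarith
  filter_upwards [eventually_le_atBot t₀] with t ht
  rw [Real.dist_eq, abs_lt]
  constructor <;> linarith [slope t, m1 t t₀ ht]

end IsProfile

/-! ### Existence of the profile -/

/-- Grönwall's inequality for the time-reversed regularised system; the regularisation dispenses
with any lower bound on the solutions. -/
theorem trunc_backward_stability {δ η : ℝ} (hδ : 0 < δ) {u₁ v₁ w₁ u₂ v₂ w₂ : ℝ → ℝ}
    (h₁ : ∀ t, HasDerivAt u₁ (v₁ t) t ∧ HasDerivAt v₁ (w₁ t) t ∧
      HasDerivAt w₁ (truncCube δ (u₁ t)) t)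
    (h₂ : ∀ t, HasDerivAt u₂ (v₂ t) t ∧ HasDerivAt v₂ (w₂ t) t ∧
      HasDerivAt w₂ (truncCube δ (u₂ t)) t)
    (hu : |u₁ 0 - u₂ 0| ≤ η) (hv : |v₁ 0 - v₂ 0| ≤ η) (hw : |w₁ 0 - w₂ 0| ≤ η) {s : ℝ}
    (hs : s ≤ 0) : |u₁ s - u₂ s| ≤ η * Real.exp (truncLip δ * (-s)) ∧
      |v₁ s - v₂ s| ≤ η * Real.exp (truncLip δ * (-s)) ∧
      |w₁ s - w₂ s| ≤ η * Real.exp (truncLip δ * (-s)) := by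
  have hder : ∀ {u v w : ℝ → ℝ}, (∀ t, HasDerivAt u (v t) t ∧ HasDerivAt v (w t) t ∧
      HasDerivAt w (truncCube δ (u t)) t) → ∀ t, HasDerivAt (fun t => (u (-t), v (-t), w (-t)))
        (-truncField δ (u (-t), v (-t), w (-t))) t := by
    intro u v w h t
    have := ((h (-t)).1.prodMk ((h (-t)).2.1.prodMk (h (-t)).2.2)).scomp t (hasDerivAt_neg t)
    exact this.congr_deriv (by simp [truncField])
  have hG := dist_le_of_trajectories_ODE (v := fun _ x => -truncField δ x)
    (K := truncLip δ) (a := 0) (b := -s) (δ := η)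
    (f := fun t => (u₁ (-t), v₁ (-t), w₁ (-t))) (g := fun t => (u₂ (-t), v₂ (-t), w₂ (-t)))
    (fun _ => by
      apply LipschitzWith.of_dist_le_mul
      intro x y
      rw [dist_neg_neg]
      exact (lipschitzWith_truncField hδ).dist_le_mul x y)
    (fun t _ => (hder h₁ t).continuousAt.continuousWithinAt)
    (fun t _ => (hder h₁ t).hasDerivWithinAt)
    (fun t _ => (hder h₂ t).continuousAt.continuousWithinAt)
    (fun t _ => (hder h₂ t).hasDerivWithinAt)
    (by
      simp only [Prod.dist_eq, Real.dist_eq, neg_zero]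
      exact max_le hu (max_le hv hw)) (-s) ⟨by linarith, le_rfl⟩
  simp only [Prod.dist_eq, Real.dist_eq, max_le_iff, neg_neg, sub_zero] at hG
  exact hG

/-- Approximations to the profile: start at height n + 1 above the level 24/K³ with slope -K and
zero second derivative, then shift time so that this level is reached at 0. The descent lasts at
least n/K, and the bounds do not depend on n. -/
theorem exists_trunc_descent {K : ℝ} (hK : 0 < K) (n : ℕ) :
    ∃ (u v w : ℝ → ℝ), (∀ t, HasDerivAt u (v t) t ∧ HasDerivAt v (w t) t ∧
      HasDerivAt w (truncCube (1 / (4 * K ^ 3)) (u t)) t) ∧ u 0 = 24 / K ^ 3 ∧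
      ∀ s ∈ Icc (-(n / K)) 0, 24 / K ^ 3 - K / 2 * s ≤ u s ∧ -K ≤ v s ∧ v s ≤ -K / 2 ∧
        v s ≤ -K + 2 / K ^ 2 * (24 / K ^ 3 - K / 2 * s)⁻¹ ∧ 0 ≤ w s ∧
        w s ≤ 1 / K * ((24 / K ^ 3) ^ 2)⁻¹ := by
  have hδ : 0 < 1 / (4 * K ^ 3) := by positivity
  have hY : 0 < 24 / K ^ 3 := by positivity
  have hδY : 1 / (4 * K ^ 3) ≤ 24 / K ^ 3 := by
    rw [div_le_div_iff₀ (by positivity) (by positivity)]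
    nlinarith [pow_pos hK 3]
  obtain ⟨u, v, w, hu0, hv0, hw0, hd⟩ := exists_trunc_solution hδ (24 / K ^ 3 + (n + 1)) (-K) 0
  obtain ⟨T, hT, huT, hTle, hB⟩ := exists_descent_time (ω := 0) (Y := 24 / K ^ 3) hK
    (by rw [mul_div_cancel₀ _ (by positivity)]; norm_num)
    (show 24 / K ^ 3 < 24 / K ^ 3 + ((n : ℝ) + 1) by
      have : (0 : ℝ) ≤ n := n.cast_nonneg
      linarith) le_rfl (by rw [zero_mul]; positivity)
    (fun t _ => hd t) (fun t _ h1 _ => by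
      rw [truncCube_of_le (hδY.trans h1)]
      exact ⟨inv_nonneg.2 (pow_nonneg (hY.le.trans h1) 3), le_rfl⟩) hu0 hv0 (by simp [hw0])
  have hTn : n / K ≤ T := by
    have := sub_le_sub_of_deriv_le hT.le (fun t _ => hasDerivAt_affine 0 (-K) 0 t)
      (fun t _ => (hd t).1) (fun t ht => by
        have := (hB t (Ioo_subset_Icc_self ht)).2.2.1
        linarith)
    rw [huT, hu0] at this
    rw [div_le_iff₀ hK]
    linarith
  refine ⟨fun s => u (s + T), fun s => v (s + T), fun s => w (s + T), fun t =>
    ⟨(hd _).1.comp_add_const t T, (hd _).2.1.comp_add_const t T, (hd _).2.2.comp_add_const t T⟩,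
    by simp [huT], fun s hs => ?_⟩
  have hsT : s + T ∈ Icc 0 T := ⟨by linarith [hs.1], by linarith [hs.2]⟩
  obtain ⟨b1, b2, b3, b4, b5, b6⟩ := hB _ hsT
  have hlow : 24 / K ^ 3 - K / 2 * s ≤ u (s + T) := by
    have := sub_le_sub_of_deriv_le hsT.2 (fun t _ => (hd t).1)
      (fun t _ => hasDerivAt_affine 0 (-K / 2) 0 t)
      (fun t ht => (hB t ⟨hsT.1.trans ht.1.le, ht.2.le⟩).2.1)
    rw [huT] at this
    linarith
  have hz : 0 < 24 / K ^ 3 - K / 2 * s := by nlinarith [hs.2]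
  refine ⟨hlow, by linarith, b2, ?_, by linarith, ?_⟩
  · have : 2 / K ^ 2 * (u (s + T))⁻¹ ≤ 2 / K ^ 2 * (24 / K ^ 3 - K / 2 * s)⁻¹ := by gcongr
    linarith
  · have : 1 / K * (u (s + T) ^ 2)⁻¹ ≤ 1 / K * ((24 / K ^ 3) ^ 2)⁻¹ := by gcongr
    linarith

/-- The regularisation is never active. Slopes are at least -K, so integrating from -∞ gives φ₂ ≥
φ⁻²/(2K) and then φ₁ ≥ -K + φ⁻¹/(2K²). At height 1/(4K³) the slope would be at least K, whereas it
must be nonpositive when that level is first reached. -/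
theorem trunc_profile_lower_bound {K : ℝ} (hK : 0 < K) {φ φ₁ φ₂ : ℝ → ℝ}
    (hd : ∀ t, HasDerivAt φ (φ₁ t) t ∧ HasDerivAt φ₁ (φ₂ t) t ∧
      HasDerivAt φ₂ (truncCube (1 / (4 * K ^ 3)) (φ t)) t)
    (hlow : ∀ s, s ≤ 0 → 24 / K ^ 3 - K / 2 * s ≤ φ s)
    (hslope : ∀ s, s ≤ 0 → -K ≤ φ₁ s) (hconv : ∀ s, 0 ≤ φ₂ s) (t : ℝ) :
    1 / (4 * K ^ 3) < φ t := by
  set δ := 1 / (4 * K ^ 3) with hδdef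
  have hδ : 0 < δ := by positivity
  have hδY : δ < 24 / K ^ 3 := by
    rw [hδdef, div_lt_div_iff₀ (by positivity) (by positivity)]
    nlinarith [pow_pos hK 3]
  have hneg : ∀ s, s ≤ 0 → δ < φ s := fun s hs => by nlinarith [hlow s hs]
  have hmono : ∀ s t, s ≤ t → φ₁ s ≤ φ₁ t := fun s t hst =>
    le_of_deriv_nonneg hst (fun x _ => (hd x).2.1) (fun x _ => hconv x)
  have hslope' : ∀ s, -K ≤ φ₁ s := fun s => by
    rcases le_total s 0 with h | h
    · exact hslope s h
    · exact (hslope 0 le_rfl).trans (hmono 0 s h)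
  by_contra hcon
  push Not at hcon
  have ht0 : 0 ≤ t := by
    by_contra h
    push Not at h
    exact absurd (hneg t h.le) (not_lt.2 hcon)
  have hcφ : Continuous φ := continuous_iff_continuousAt.2 fun x => (hd x).1.continuousAt
  have hAc : IsCompact (Icc 0 t ∩ φ ⁻¹' Iic δ) :=
    isCompact_Icc.inter_right (isClosed_Iic.preimage hcφ)
  obtain ⟨t₁, ht₁, hmin⟩ := hAc.exists_isLeast ⟨t, ⟨ht0, le_rfl⟩, hcon⟩
  have hbefore : ∀ s, s < t₁ → δ < φ s := by
    intro s hs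
    rcases le_or_gt s 0 with h | h
    · exact hneg s h
    · by_contra hle
      push Not at hle
      exact absurd (hmin ⟨⟨h.le, hs.le.trans ht₁.1.2⟩, hle⟩) (not_le.2 hs)
  have hle : φ t₁ ≤ δ := ht₁.2
  have hge : δ ≤ φ t₁ := by
    have hcl : t₁ ∈ closure (Iio t₁) := by rw [closure_Iio]; exact self_mem_Iic
    have him : φ '' Iio t₁ ⊆ Ici δ := by
      rintro _ ⟨s, hs, rfl⟩
      exact (hbefore s hs).le
    exact (isClosed_Ici.closure_subset_iff.2 him)
      (hcφ.continuousWithinAt.mem_closure_image hcl)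
  have heq : φ t₁ = δ := le_antisymm hle hge
  have hv1 : φ₁ t₁ ≤ 0 := by
    by_contra hpos
    push Not at hpos
    have hcv : ContinuousAt φ₁ t₁ := (hd t₁).2.1.continuousAt
    obtain ⟨s, hs1, hs2⟩ := ((hcv.eventually (lt_mem_nhds hpos)).filter_mono nhdsWithin_le_nhds
      |>.and (self_mem_nhdsWithin (s := Iio t₁))).exists
    have := lt_of_deriv_pos (f := φ) (mem_Iio.1 hs2) (fun x _ => (hd x).1)
      (fun x hx => lt_of_lt_of_le hs1 (hmono s x hx.1.le))
    linarith [hbefore s hs2]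
  have hpos : ∀ s, s ≤ t₁ → 0 < φ s := fun s hs => by
    rcases eq_or_lt_of_le hs with h | h
    · rw [h, heq]; exact hδ
    · exact hδ.trans (hbefore s h)
  have hr : ∀ s, s ≤ t₁ → truncCube δ (φ s) = (φ s ^ 3)⁻¹ := fun s hs => by
    apply truncCube_of_le
    rcases eq_or_lt_of_le hs with h | h
    · rw [h, heq]
    · exact (hbefore s h).le
  have htop : Tendsto (fun s => 24 / K ^ 3 - K / 2 * s) atBot atTop := by
    have : Tendsto (fun s : ℝ => (24 / K ^ 3) + (-(K / 2)) * s) atBot atTop :=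
      tendsto_atTop_add_const_left _ _ (tendsto_id.const_mul_atBot_of_neg (by linarith))
    refine this.congr fun s => by ring
  have hφtop : Tendsto φ atBot atTop := tendsto_atTop_mono' _
    ((eventually_le_atBot 0).mono hlow) htop
  have hinv : Tendsto (fun s => (φ s)⁻¹) atBot (𝓝 0) := tendsto_inv_atTop_zero.comp hφtop
  have hw : ∀ s, s ≤ t₁ → 1 / (2 * K) * (φ s ^ 2)⁻¹ ≤ φ₂ s := by
    intro s hs
    have h1 : ∀ r, r ≤ s → 1 / (2 * K) * (φ s ^ 2)⁻¹ - 1 / (2 * K) * (φ r ^ 2)⁻¹ ≤ φ₂ s := by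
      intro r hrs
      have := sub_le_sub_of_deriv_le hrs
        (fun x hx => (hasDerivAt_inv_sq_comp (hd x).1 (hpos x (hx.2.trans hs))).const_mul
          (1 / (2 * K))) (fun x _ => (hd x).2.2) (fun x hx => by
          rw [hr x (hx.2.le.trans hs)]
          have h3 : 0 < (φ x ^ 3)⁻¹ := inv_pos.2 (pow_pos (hpos x (hx.2.le.trans hs)) 3)
          have h4 : 1 / (2 * K) * (-2 * φ₁ x * (φ x ^ 3)⁻¹) = (-φ₁ x / K) * (φ x ^ 3)⁻¹ := by
            field_simp
          rw [h4]
          have h5 : -φ₁ x / K ≤ 1 := by rw [div_le_iff₀ hK]; linarith [hslope' x]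
          nlinarith)
      linarith [hconv r]
    have h2 : Tendsto (fun r => 1 / (2 * K) * (φ s ^ 2)⁻¹ - 1 / (2 * K) * (φ r ^ 2)⁻¹) atBot
        (𝓝 (1 / (2 * K) * (φ s ^ 2)⁻¹)) := by
      have := ((hinv.pow 2).const_mul (1 / (2 * K))).const_sub (1 / (2 * K) * (φ s ^ 2)⁻¹)
      simpa using this
    exact le_of_tendsto h2 ((eventually_le_atBot s).mono h1)
  have hv : -K + 1 / (2 * K ^ 2) * (φ t₁)⁻¹ ≤ φ₁ t₁ := by
    have h1 : ∀ r, r ≤ t₁ →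
        -K + (1 / (2 * K ^ 2) * (φ t₁)⁻¹ - 1 / (2 * K ^ 2) * (φ r)⁻¹) ≤ φ₁ t₁ := by
      intro r hrs
      have := sub_le_sub_of_deriv_le hrs
        (fun x hx => (hasDerivAt_inv_comp (hd x).1 (hpos x hx.2)).const_mul
          (1 / (2 * K ^ 2))) (fun x _ => (hd x).2.1) (fun x hx => by
          refine le_trans ?_ (hw x hx.2.le)
          have h3 : 0 < (φ x ^ 2)⁻¹ := inv_pos.2 (pow_pos (hpos x hx.2.le) 2)
          have h4 : 1 / (2 * K ^ 2) * (-φ₁ x * (φ x ^ 2)⁻¹) =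
              1 / (2 * K) * ((-φ₁ x / K) * (φ x ^ 2)⁻¹) := by
            field_simp
          rw [h4]
          have h5 : -φ₁ x / K ≤ 1 := by rw [div_le_iff₀ hK]; linarith [hslope' x]
          have h6 : -φ₁ x / K * (φ x ^ 2)⁻¹ ≤ 1 * (φ x ^ 2)⁻¹ := by gcongr
          rw [one_mul] at h6
          gcongr)
      linarith [hslope' r]
    have h2 : Tendsto (fun r => -K + (1 / (2 * K ^ 2) * (φ t₁)⁻¹ - 1 / (2 * K ^ 2) * (φ r)⁻¹))
        atBot (𝓝 (-K + 1 / (2 * K ^ 2) * (φ t₁)⁻¹)) := by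
      have := ((hinv.const_mul (1 / (2 * K ^ 2))).const_sub
        (1 / (2 * K ^ 2) * (φ t₁)⁻¹)).const_add (-K)
      simpa using this
    exact le_of_tendsto h2 ((eventually_le_atBot t₁).mono h1)
  have hfin : 1 / (2 * K ^ 2) * (φ t₁)⁻¹ = 2 * K := by
    rw [heq, hδdef]
    field_simp
    norm_num
  linarith

/-- Compactness: the slope and second derivative of the descents at time 0 lie in a fixed rectangle,
and continuous dependence passes the bounds on the past to the solution issuing from a limit point.
-/
theorem exists_isProfile {K : ℝ} (hK : 0 < K) : ∃ φ φ₁ φ₂, IsProfile K φ φ₁ φ₂ := by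
  choose u v w hd hu0 hB using exists_trunc_descent hK
  have hδ : 0 < 1 / (4 * K ^ 3) := by positivity
  have hY : 0 < 24 / K ^ 3 := by positivity
  have hmem : ∀ n, (v n 0, w n 0) ∈ Icc (-K) (-K / 2) ×ˢ
      Icc 0 (1 / K * ((24 / K ^ 3) ^ 2)⁻¹) := by
    intro n
    obtain ⟨_, b2, b3, _, b5, b6⟩ := hB n 0 ⟨by
      have : 0 ≤ (n : ℝ) / K := by positivity
      linarith, le_rfl⟩
    exact ⟨⟨b2, b3⟩, ⟨b5, b6⟩⟩
  obtain ⟨⟨p, q⟩, _, σ, hσ, hlim⟩ := (isCompact_Icc.prod isCompact_Icc).tendsto_subseq hmem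
  obtain ⟨φ, φ₁, φ₂, h0, h1, h2, hφ⟩ := exists_trunc_solution hδ (24 / K ^ 3) p q
  have hp : Tendsto (fun n => v (σ n) 0) atTop (𝓝 p) :=
    (continuous_fst.tendsto _).comp hlim
  have hq : Tendsto (fun n => w (σ n) 0) atTop (𝓝 q) :=
    (continuous_snd.tendsto _).comp hlim
  have hη : Tendsto (fun n => |v (σ n) 0 - p| + |w (σ n) 0 - q|) atTop (𝓝 0) := by
    have := (hp.sub_const p).abs.add (hq.sub_const q).abs
    simpa using this
  have hconv : ∀ s, s ≤ 0 → Tendsto (fun n => u (σ n) s) atTop (𝓝 (φ s)) ∧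
      Tendsto (fun n => v (σ n) s) atTop (𝓝 (φ₁ s)) ∧
      Tendsto (fun n => w (σ n) s) atTop (𝓝 (φ₂ s)) := by
    intro s hs
    have hst := fun n => trunc_backward_stability hδ (hd (σ n)) hφ
      (η := |v (σ n) 0 - p| + |w (σ n) 0 - q|)
      (by rw [hu0, h0, sub_self, abs_zero]; positivity)
      (by rw [h1]; linarith [abs_nonneg (w (σ n) 0 - q)])
      (by rw [h2]; linarith [abs_nonneg (v (σ n) 0 - p)]) hs
    have hz : Tendsto (fun n => (|v (σ n) 0 - p| + |w (σ n) 0 - q|) *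
        Real.exp (truncLip (1 / (4 * K ^ 3)) * (-s))) atTop (𝓝 0) := by
      have := hη.mul_const (Real.exp (truncLip (1 / (4 * K ^ 3)) * (-s)))
      rwa [zero_mul] at this
    refine ⟨?_, ?_, ?_⟩
    · rw [tendsto_iff_dist_tendsto_zero]
      simp only [Real.dist_eq]
      exact squeeze_zero (fun _ => abs_nonneg _) (fun n => (hst n).1) hz
    · rw [tendsto_iff_dist_tendsto_zero]
      simp only [Real.dist_eq]
      exact squeeze_zero (fun _ => abs_nonneg _) (fun n => (hst n).2.1) hz
    · rw [tendsto_iff_dist_tendsto_zero]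
      simp only [Real.dist_eq]
      exact squeeze_zero (fun _ => abs_nonneg _) (fun n => (hst n).2.2) hz
  have hev : ∀ s, s ≤ 0 → ∀ᶠ n in atTop, s ∈ Icc (-((σ n : ℝ) / K)) 0 := by
    intro s hs
    have : Tendsto (fun n => (σ n : ℝ) / K) atTop atTop :=
      (tendsto_natCast_atTop_atTop.comp hσ.tendsto_atTop).atTop_div_const hK
    filter_upwards [this.eventually_ge_atTop (-s)] with n hn
    exact ⟨by linarith, hs⟩
  have c0 : ∀ s, s ≤ 0 → 24 / K ^ 3 - K / 2 * s ≤ φ s := fun s hs =>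
    ge_of_tendsto (hconv s hs).1 ((hev s hs).mono fun n hn => (hB _ s hn).1)
  have c1 : ∀ s, s ≤ 0 → -K ≤ φ₁ s := fun s hs =>
    ge_of_tendsto (hconv s hs).2.1 ((hev s hs).mono fun n hn => (hB _ s hn).2.1)
  have c2 : ∀ s, s ≤ 0 → φ₁ s ≤ -K + 2 / K ^ 2 * (24 / K ^ 3 - K / 2 * s)⁻¹ := fun s hs =>
    le_of_tendsto (hconv s hs).2.1 ((hev s hs).mono fun n hn => (hB _ s hn).2.2.2.1)
  have c3 : ∀ s, s ≤ 0 → 0 ≤ φ₂ s := fun s hs =>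
    ge_of_tendsto (hconv s hs).2.2 ((hev s hs).mono fun n hn => (hB _ s hn).2.2.2.2.1)
  have c4 : ∀ s, 0 ≤ φ₂ s := fun s => by
    rcases le_total s 0 with h | h
    · exact c3 s h
    · exact (c3 0 le_rfl).trans (le_of_deriv_nonneg h (fun x _ => (hφ x).2.2)
        (fun x _ => truncCube_nonneg hδ _))
  have hlow := trunc_profile_lower_bound hK hφ c0 c1 c4
  refine ⟨φ, φ₁, φ₂, fun t _ => ⟨hδ.trans (hlow t), (hφ t).1, (hφ t).2.1, ?_⟩, fun t => ?_, c4, ?_⟩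
  · have := (hφ t).2.2
    rwa [truncCube_of_le (hlow t).le, ← sub_zero ((φ t ^ 3)⁻¹)] at this
  · rcases le_total t 0 with h | h
    · exact c1 t h
    · exact (c1 0 le_rfl).trans (le_of_deriv_nonneg h (fun x _ => (hφ x).2.1) (fun x _ => c4 x))
  · have htop : Tendsto (fun s => 24 / K ^ 3 - K / 2 * s) atBot atTop := by
      have : Tendsto (fun s : ℝ => (24 / K ^ 3) + (-(K / 2)) * s) atBot atTop :=
        tendsto_atTop_add_const_left _ _ (tendsto_id.const_mul_atBot_of_neg (by linarith))
      refine this.congr fun s => by ring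
    have hup : Tendsto (fun s => -K + 2 / K ^ 2 * (24 / K ^ 3 - K / 2 * s)⁻¹) atBot (𝓝 (-K)) := by
      have := ((tendsto_inv_atTop_zero.comp htop).const_mul (2 / K ^ 2)).const_add (-K)
      simpa using this
    exact tendsto_of_tendsto_of_tendsto_of_le_of_le' tendsto_const_nhds hup
      ((eventually_le_atBot 0).mono c1) ((eventually_le_atBot 0).mono c2)

/-! ### Growth and minimum of the profile -/

/-- The derivative of w + ct is u⁻³, which is at most the derivative of -u⁻²/(2p) while the slope is
at least p. -/
theorem SolvesOn.second_sub_le {c p a b : ℝ} (hp : 0 < p) (hab : a ≤ b) {u v w : ℝ → ℝ}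
    (h : SolvesOn c (Icc a b) u v w) (hv : ∀ t ∈ Ioo a b, p ≤ v t) :
    w b + c * (b - a) - w a ≤ 1 / (2 * p) * (u a ^ 2)⁻¹ := by
  have := sub_le_sub_of_deriv_le hab
    (fun t ht => (h t ht).2.2.2.fun_add (hasDerivAt_affine 0 c a t))
    (fun t ht => (hasDerivAt_inv_sq_comp (h t ht).2.1 (h t ht).1).const_mul (-(1 / (2 * p))))
    (fun t ht => by
      have h3 : 0 < (u t ^ 3)⁻¹ := inv_pos.2 (pow_pos (h t (Ioo_subset_Icc_self ht)).1 3)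
      have h4 : -(1 / (2 * p)) * (-2 * v t * (u t ^ 3)⁻¹) = v t / p * (u t ^ 3)⁻¹ := by
        field_simp
      rw [h4]
      have h5 : 1 ≤ v t / p := by rw [le_div_iff₀ hp]; linarith [hv t ht]
      nlinarith)
  have h0 : 0 ≤ 1 / (2 * p) * (u b ^ 2)⁻¹ := by positivity
  linarith

namespace IsProfile

variable {K : ℝ} {φ φ₁ φ₂ : ℝ → ℝ}

theorem exists_slope_pos (h : IsProfile K φ φ₁ φ₂) : ∃ t, 0 < φ₁ t := by
  refine ⟨(1 + |φ₁ 0|) / φ₂ 0, ?_⟩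
  have h2 := h.second_pos 0
  have h0 : 0 ≤ (1 + |φ₁ 0|) / φ₂ 0 := by positivity
  have := sub_le_sub_of_deriv_le h0 (fun t _ => hasDerivAt_affine 0 (φ₂ 0) 0 t)
    (fun t _ => h.deriv_one t) (fun t ht => h.second_strictMono.monotone ht.1.le)
  have h3 : φ₂ 0 * ((1 + |φ₁ 0|) / φ₂ 0 - 0) = 1 + |φ₁ 0| := by field_simp; ring
  rw [zero_add, zero_add, sub_self, mul_zero, sub_zero, h3] at this
  linarith [neg_abs_le (φ₁ 0)]

theorem exists_tendsto_second (h : IsProfile K φ φ₁ φ₂) :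
    ∃ ℓ, 0 < ℓ ∧ Tendsto φ₂ atTop (𝓝 ℓ) := by
  obtain ⟨t₀, ht₀⟩ := h.exists_slope_pos
  have hb : BddAbove (range φ₂) := by
    refine ⟨φ₂ t₀ + 1 / (2 * φ₁ t₀) * (φ t₀ ^ 2)⁻¹, ?_⟩
    rintro _ ⟨t, rfl⟩
    have h0 : 0 ≤ 1 / (2 * φ₁ t₀) * (φ t₀ ^ 2)⁻¹ := by positivity
    rcases le_total t t₀ with ht | ht
    · linarith [h.second_strictMono.monotone ht]
    · have := SolvesOn.second_sub_le ht₀ ht (h.solves.mono (subset_univ _))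
        (fun s hs => h.slope_mono hs.1.le)
      linarith
  exact ⟨_, (h.second_pos 0).trans_le (le_ciSup hb 0),
    tendsto_atTop_ciSup h.second_strictMono.monotone hb⟩

theorem isEquivalent_atTop (h : IsProfile K φ φ₁ φ₂) {ℓ : ℝ} (hℓ : 0 < ℓ)
    (hl : Tendsto φ₂ atTop (𝓝 ℓ)) : φ ~[atTop] fun ζ => ℓ / 2 * ζ ^ 2 := by
  have h1 : (fun t => φ₂ t - ℓ) =o[atTop] fun t : ℝ => t ^ 0 := by
    simp only [pow_zero]
    rw [isLittleO_one_iff]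
    simpa using hl.sub_const ℓ
  have h2 := isLittleO_pow_of_deriv (f := fun t => φ₁ t - ℓ * t) (T₀ := 0) (fun t _ =>
    ((h.deriv_one t).fun_sub ((hasDerivAt_id' t).const_mul ℓ)).congr_deriv (by simp)) h1
  rw [zero_add] at h2
  have h3 := isLittleO_pow_of_deriv (f := fun t => φ t - ℓ / 2 * t ^ 2) (T₀ := 0) (fun t _ =>
    ((h.deriv_zero t).fun_sub (((hasDerivAt_id' t).fun_pow 2).const_mul (ℓ / 2))).congr_deriv
      (by norm_num; ring)) h2
  refine IsLittleO.trans_isBigO (g := fun ζ : ℝ => ζ ^ 2) h3 ?_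
  refine IsBigO.of_bound (2 / ℓ) (Eventually.of_forall fun ζ => ?_)
  rw [norm_mul, Real.norm_of_nonneg (by positivity : 0 ≤ ℓ / 2)]
  apply le_of_eq
  field_simp

theorem exists_isLeast (h : IsProfile K φ φ₁ φ₂) (hK : 0 < K) :
    ∃ s, φ₁ s = 0 ∧ ∀ t, φ s ≤ φ t := by
  obtain ⟨b, hb⟩ := h.exists_slope_pos
  obtain ⟨a, ha⟩ := (h.tendsto_slope.eventually (gt_mem_nhds (show -K < 0 by linarith))).exists
  have hab : a ≤ b := by
    by_contra hlt
    push Not at hlt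
    linarith [h.slope_mono hlt.le]
  obtain ⟨s, _, hs⟩ := intermediate_value_Icc hab
    (fun s _ => (h.deriv_one s).continuousAt.continuousWithinAt : ContinuousOn φ₁ (Icc a b))
    ⟨ha.le, hb.le⟩
  refine ⟨s, hs, fun t => ?_⟩
  rcases le_total t s with ht | ht
  · exact le_of_deriv_nonpos ht (fun x _ => h.deriv_zero x)
      (fun x hx => hs ▸ h.slope_mono hx.2.le)
  · exact le_of_deriv_nonneg ht (fun x _ => h.deriv_zero x)
      (fun x hx => hs ▸ h.slope_mono hx.1.le)

end IsProfile

/-! ### The ascent from a neighbourhood of the minimum to the next maximum -/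

theorem exists_isLeast_zero {f : ℝ → ℝ} {a b : ℝ} (hab : a ≤ b) (hc : ContinuousOn f (Icc a b))
    (ha : 0 < f a) (hb : f b ≤ 0) :
    ∃ t, a < t ∧ t ≤ b ∧ f t = 0 ∧ ∀ s ∈ Ico a t, 0 < f s := by
  have hA : IsCompact (Icc a b ∩ f ⁻¹' Iic 0) := isCompact_Icc.of_isClosed_subset
    (hc.preimage_isClosed_of_isClosed isClosed_Icc isClosed_Iic) inter_subset_left
  obtain ⟨t, ht, hmin⟩ := hA.exists_isLeast ⟨b, ⟨hab, le_rfl⟩, hb⟩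
  have hpos : ∀ s ∈ Ico a t, 0 < f s := by
    intro s hs
    by_contra hle
    push Not at hle
    exact absurd (hmin ⟨⟨hs.1, hs.2.le.trans ht.1.2⟩, hle⟩) (not_le.2 hs.2)
  have hat : a < t := by
    rcases eq_or_lt_of_le ht.1.1 with h | h
    · exact absurd ha (not_lt.2 (h ▸ ht.2))
    · exact h
  refine ⟨t, hat, ht.1.2, le_antisymm ht.2 ?_, hpos⟩
  have hcl : t ∈ closure (Ico a t) := by rw [closure_Ico hat.ne]; exact right_mem_Icc.2 hat.le
  have him : f '' Ico a t ⊆ Ici 0 := by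
    rintro _ ⟨s, hs, rfl⟩
    exact (hpos s hs).le
  exact (isClosed_Ici.closure_subset_iff.2 him)
    (((hc t ht.1).mono (fun s hs => ⟨hs.1, hs.2.le.trans ht.1.2⟩)).mem_closure_image hcl)

section Ascent

variable {c a b : ℝ} {u v w : ℝ → ℝ}

theorem SolvesOn.remainder_mono (h : SolvesOn c (Icc a b) u v w) {s t : ℝ} (has : a ≤ s)
    (hst : s ≤ t) (htb : t ≤ b) : w s + c * s ≤ w t + c * t := by
  have := le_of_deriv_nonneg hst
    (fun x hx => (h x ⟨has.trans hx.1, hx.2.trans htb⟩).2.2.2.fun_add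
      ((hasDerivAt_id' x).const_mul c))
    (fun x hx => by
      have h1 := (h x ⟨has.trans hx.1.le, hx.2.le.trans htb⟩).1
      have : 0 < (u x ^ 3)⁻¹ := by positivity
      linarith)
  simpa using this

/-- While the solution rises from `a` to its next maximum `b`, the second derivative differs
from an affine function by a small remainder. -/
theorem SolvesOn.ascent_remainder (h : SolvesOn c (Icc a b) u v w) (hab : a < b) (hc : 0 < c)
    (hw : 0 < w a) (hv : ∀ t ∈ Ico a b, 0 < v t) (hvb : v b = 0) {M : ℝ} (hM : 0 ≤ M)
    (hsmall : 54 * c ^ 5 ≤ w a ^ 9)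
    (hMle : 4 * (c * v a + (w a + 1 / (2 * v a) * (u a ^ 2)⁻¹) ^ 2) ≤ M ^ 2) :
    w b + c * (b - a) - w a ≤ 1 / (2 * v a) * (u a ^ 2)⁻¹ + 27 * c ^ 5 * M / w a ^ 9 := by
  set p := v a with hp
  set ω₀ := w a with hω₀
  set e := 1 / (2 * p) * (u a ^ 2)⁻¹ with he
  have hp0 : 0 < p := hv a ⟨le_rfl, hab⟩
  have he0 : 0 ≤ e := by positivity
  have hwb : w b ≤ 0 := by
    by_contra hpos
    push Not at hpos
    have hcw : ContinuousAt w b := (h b (right_mem_Icc.2 hab.le)).2.2.2.continuousAt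
    obtain ⟨s, ⟨hs0, hs1⟩, hs2⟩ : ∃ s, (s < b ∧ a ≤ s) ∧ ∀ x ∈ Icc s b, 0 < w x := by
      obtain ⟨d, hd, hd'⟩ := Metric.eventually_nhds_iff.1 (hcw.eventually (lt_mem_nhds hpos))
      refine ⟨max a (b - d / 2), ⟨max_lt hab (by linarith), le_max_left _ _⟩, fun x hx => ?_⟩
      apply hd'
      rw [Real.dist_eq, abs_lt]
      have := (le_max_right a (b - d / 2)).trans hx.1
      constructor <;> linarith [hx.2]
    have := lt_of_deriv_pos hs0 (fun x hx => (h x ⟨hs1.trans hx.1, hx.2⟩).2.2.1)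
      (fun x hx => hs2 x (Ioo_subset_Icc_self hx))
    linarith [hv s ⟨hs1, hs0⟩]
  -- The ascent is split where w first vanishes. Before t the slope stays above its initial value p;
  -- after t the height is already so large that u⁻³ is negligible against c.
  obtain ⟨t, hat, htb, hwt, hwpos⟩ := exists_isLeast_zero hab.le
    (fun s hs => (h s hs).2.2.2.continuousAt.continuousWithinAt) hw hwb
  have hsub : ∀ s ∈ Icc a t, s ∈ Icc a b := fun s hs => ⟨hs.1, hs.2.trans htb⟩
  have hvp : ∀ s ∈ Icc a t, p ≤ v s := fun s hs =>
    le_of_deriv_nonneg hs.1 (fun x hx => (h x ⟨hx.1, hx.2.trans (hs.2.trans htb)⟩).2.2.1)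
      (fun x hx => (hwpos x ⟨hx.1.le, hx.2.trans_le hs.2⟩).le)
  have hR1 := SolvesOn.second_sub_le hp0 hat.le (h.mono hsub)
    (fun s hs => hvp s (Ioo_subset_Icc_self hs))
  have hwlow : ∀ s ∈ Icc a b, ω₀ - c * (s - a) ≤ w s := fun s hs => by
    have := h.remainder_mono le_rfl hs.1 hs.2
    linarith
  have hx1 : ω₀ ≤ c * (t - a) := by
    have := hwlow t ⟨hat.le, htb⟩
    linarith
  have hx2 : c * (t - a) ≤ ω₀ + e := by linarith
  -- the height reached when the second derivative vanishes
  have hU : ω₀ ^ 3 / (3 * c ^ 2) ≤ u t := by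
    -- The zero of the affine lower bound ω₀ - c(s - a) for w; integrating that bound twice up to τ
    -- yields the height ω₀³/(3c²).
    set τ := a + ω₀ / c with hτ
    have hτt : τ ≤ t := by
      rw [hτ]
      have : ω₀ / c ≤ t - a := by rw [div_le_iff₀ hc]; linarith
      linarith
    have haτ : a ≤ τ := by rw [hτ]; have : 0 < ω₀ / c := by positivity
                           linarith
    have hsubτ : ∀ s ∈ Icc a τ, s ∈ Icc a b := fun s hs => ⟨hs.1, hs.2.trans (hτt.trans htb)⟩
    have hv1 : ∀ s ∈ Icc a τ, 0 + ω₀ * (s - a) + (-c) * (s - a) ^ 2 / 2 ≤ v s := by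
      intro s hs
      have := sub_le_sub_of_deriv_le hs.1 (fun x _ => hasDerivAt_quadratic 0 ω₀ (-c) a x)
        (fun x hx => (h x (hsubτ x ⟨hx.1, hx.2.trans hs.2⟩)).2.2.1)
        (fun x hx => by
          have := hwlow x (hsubτ x ⟨hx.1.le, hx.2.le.trans hs.2⟩)
          linarith)
      simp only [sub_self] at this
      linarith
    have hu1 := sub_le_sub_of_deriv_le haτ (fun x _ => hasDerivAt_cubic 0 0 ω₀ (-c) a x)
        (fun x hx => (h x (hsubτ x hx)).2.1)
        (fun x hx => hv1 x (Ioo_subset_Icc_self hx))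
    have hu2 : u τ ≤ u t := le_of_deriv_nonneg hτt
      (fun x hx => (h x ⟨haτ.trans hx.1, hx.2.trans htb⟩).2.1)
      (fun x hx => hp0.le.trans (hvp x ⟨haτ.trans hx.1.le, hx.2.le⟩))
    have hua := (h a (left_mem_Icc.2 hab.le)).1
    have hval : ω₀ * (τ - a) ^ 2 / 2 + -c * (τ - a) ^ 3 / 6 = ω₀ ^ 3 / (3 * c ^ 2) := by
      rw [hτ, add_sub_cancel_left]
      field_simp
      ring
    simp only [sub_self] at hu1
    linarith
  -- The cube of the inverse of the height just found; `hsmall` says exactly θ ≤ c/2.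
  set θ := 27 * c ^ 6 / ω₀ ^ 9 with hθ
  have hθ0 : 0 ≤ θ := by positivity
  have hθc : θ ≤ c / 2 := by
    rw [hθ, div_le_div_iff₀ (by positivity) (by norm_num)]
    nlinarith
  have hθu : ∀ s ∈ Icc t b, (u s ^ 3)⁻¹ ≤ θ := by
    intro s hs
    have h1 : u t ≤ u s := le_of_deriv_nonneg hs.1
      (fun x hx => (h x ⟨hat.le.trans hx.1, hx.2.trans hs.2⟩).2.1)
      (fun x hx => (hv x ⟨hat.le.trans hx.1.le, hx.2.trans_le hs.2⟩).le)
    have h2 : 0 < ω₀ ^ 3 / (3 * c ^ 2) := by positivity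
    calc (u s ^ 3)⁻¹ ≤ ((ω₀ ^ 3 / (3 * c ^ 2)) ^ 3)⁻¹ := by
          have := hU.trans h1
          gcongr
      _ = θ := by rw [hθ]; field_simp; norm_num
  have hsubb : ∀ s ∈ Icc t b, s ∈ Icc a b := fun s hs => ⟨hat.le.trans hs.1, hs.2⟩
  -- duration of the last phase
  have hr : c * (b - t) ≤ M := by
    have hwup : ∀ s ∈ Icc t b, w s ≤ -(c / 2) * (s - t) := by
      intro s hs
      have := sub_le_sub_of_deriv_le hs.1
        (fun x hx => (h x (hsubb x ⟨hx.1, hx.2.trans hs.2⟩)).2.2.2)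
        (fun x _ => hasDerivAt_affine 0 (-(c / 2)) t x) (fun x hx => by
          have := hθu x ⟨hx.1.le, hx.2.le.trans hs.2⟩
          linarith)
      rw [hwt] at this
      linarith
    have h1 := sub_le_sub_of_deriv_le htb (fun x hx => (h x (hsubb x hx)).2.2.1)
      (fun x _ => hasDerivAt_quadratic 0 0 (-(c / 2)) t x) (fun x hx => by
        have := hwup x (Ioo_subset_Icc_self hx)
        linarith)
    simp only [sub_self, hvb] at h1
    have hvt : v t ≤ p + (ω₀ + e) * (t - a) := by
      have := sub_le_sub_of_deriv_le hat.le (fun x hx => (h x (hsub x hx)).2.2.1)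
        (fun x _ => hasDerivAt_affine 0 (ω₀ + e) a x) (fun x hx => by
          have h2 := h.remainder_mono hx.1.le hx.2.le htb
          have h3 : 0 ≤ c * (x - a) := mul_nonneg hc.le (by linarith [hx.1])
          rw [hwt] at h2
          linarith)
      simp only [sub_self] at this
      linarith
    -- From w ≤ -(c/2)(s - t) and v b = 0 one gets v t ≥ c(b - t)²/4, while v t ≤ p + (ω₀ + e)(t -
    -- a) with c(t - a) ≤ ω₀ + e.
    have h4 : (c * (b - t)) ^ 2 ≤ M ^ 2 := by
      have h5 : (c * (b - t)) ^ 2 ≤ 4 * c * v t := by nlinarith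
      have h6 : c * v t ≤ c * p + (ω₀ + e) * (c * (t - a)) := by nlinarith
      have h7 : (ω₀ + e) * (c * (t - a)) ≤ (ω₀ + e) * (ω₀ + e) := by gcongr
      nlinarith
    exact abs_le_of_sq_le_sq' h4 hM |>.2
  have hlast := sub_le_sub_of_deriv_le htb
    (fun x hx => (h x (hsubb x hx)).2.2.2.fun_add (hasDerivAt_affine 0 c a x))
    (fun x _ => hasDerivAt_affine 0 θ 0 x) (fun x hx => by
      have := hθu x (Ioo_subset_Icc_self hx)
      linarith)
  have hθr : θ * (b - t) ≤ 27 * c ^ 5 * M / ω₀ ^ 9 := by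
    have h1 : θ * (b - t) = 27 * c ^ 5 * (c * (b - t)) / ω₀ ^ 9 := by rw [hθ]; ring
    rw [h1]
    gcongr
  linarith

/-- Values at the maximum `b` in terms of the data at `a`. -/
theorem SolvesOn.ascent_bounds (h : SolvesOn c (Icc a b) u v w) (hab : a < b)
    (hw : 0 < w a) (hv : 0 < v a) (hvb : v b = 0) {ε : ℝ} (hε : w b + c * (b - a) - w a ≤ ε) :
    2 * w a ≤ c * (b - a) ∧ c * (b - a) ≤ 2 * (w a + ε) + c * v a / w a ∧
    w a - c * (b - a) ≤ w b ∧
    u a + v a * (b - a) + w a * (b - a) ^ 2 / 2 - c * (b - a) ^ 3 / 6 ≤ u b ∧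
    u b ≤ u a + v a * (b - a) + (w a + ε) * (b - a) ^ 2 / 2 - c * (b - a) ^ 3 / 6 := by
  have hwl : ∀ s ∈ Icc a b, w a + -c * (s - a) ≤ w s := fun s hs => by
    have := h.remainder_mono le_rfl hs.1 hs.2
    linarith
  have hwu : ∀ s ∈ Icc a b, w s ≤ w a + ε + -c * (s - a) := fun s hs => by
    have := h.remainder_mono hs.1 hs.2 le_rfl
    linarith
  have hvl : ∀ s ∈ Icc a b, v a + w a * (s - a) + -c * (s - a) ^ 2 / 2 ≤ v s := fun s hs => by
    have := sub_le_sub_of_deriv_le hs.1 (fun x _ => hasDerivAt_quadratic (v a) (w a) (-c) a x)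
      (fun x hx => (h x ⟨hx.1, hx.2.trans hs.2⟩).2.2.1)
      (fun x hx => hwl x ⟨hx.1.le, hx.2.le.trans hs.2⟩)
    simp only [sub_self] at this
    linarith
  have hvu : ∀ s ∈ Icc a b, v s ≤ v a + (w a + ε) * (s - a) + -c * (s - a) ^ 2 / 2 :=
    fun s hs => by
    have := sub_le_sub_of_deriv_le hs.1 (fun x hx => (h x ⟨hx.1, hx.2.trans hs.2⟩).2.2.1)
      (fun x _ => hasDerivAt_quadratic (v a) (w a + ε) (-c) a x)
      (fun x hx => hwu x ⟨hx.1.le, hx.2.le.trans hs.2⟩)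
    simp only [sub_self] at this
    linarith
  have hul := sub_le_sub_of_deriv_le hab.le
    (fun x _ => hasDerivAt_cubic (u a) (v a) (w a) (-c) a x) (fun x hx => (h x hx).2.1)
    (fun x hx => hvl x (Ioo_subset_Icc_self hx))
  have huu := sub_le_sub_of_deriv_le hab.le (fun x hx => (h x hx).2.1)
    (fun x _ => hasDerivAt_cubic (u a) (v a) (w a + ε) (-c) a x)
    (fun x hx => hvu x (Ioo_subset_Icc_self hx))
  have hbm := right_mem_Icc.2 hab.le
  have hx : 0 < b - a := by linarith
  have v1 := hvl b hbm
  have v2 := hvu b hbm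
  rw [hvb] at v1 v2
  have k1 : 2 * w a ≤ c * (b - a) := by
    have : (2 * w a - c * (b - a)) * (b - a) ≤ 0 := by nlinarith
    nlinarith
  simp only [sub_self] at hul huu
  refine ⟨k1, ?_, by linarith [hwl b hbm], by linarith, by linarith⟩
  have k2 : c * (b - a) * (b - a) ≤ 2 * (w a + ε) * (b - a) + 2 * v a := by nlinarith
  have k3 : 2 * v a ≤ c * v a / w a * (b - a) := by
    rw [div_mul_eq_mul_div, le_div_iff₀ hw]
    nlinarith
  have k4 : c * (b - a) * (b - a) ≤ (2 * (w a + ε) + c * v a / w a) * (b - a) := by linarith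
  exact le_of_mul_le_mul_right k4 hx

end Ascent

/-- In the limit the ascent is the cubic arc with initial second derivative ℓ and third derivative
-c: its slope vanishes again after time 2ℓ/c, at height 2ℓ³/c² - 4ℓ³/(3c²). The hypotheses make the
initial slope, the initial height and the remainder negligible on these scales. -/
theorem ascent_limits {c a b : ℕ → ℝ} {u v w : ℕ → ℝ → ℝ} {ℓ : ℝ} (hℓ : 0 < ℓ)
    (hc : ∀ n, 0 < c n) (hc0 : Tendsto c atTop (𝓝 0))
    (h : ∀ᶠ n in atTop, SolvesOn (c n) (Icc (a n) (b n)) (u n) (v n) (w n) ∧ a n < b n ∧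
      (∀ t ∈ Ico (a n) (b n), 0 < v n t) ∧ v n (b n) = 0)
    (hw : Tendsto (fun n => w n (a n)) atTop (𝓝 ℓ))
    (hv : Tendsto (fun n => c n * v n (a n)) atTop (𝓝 0))
    (hu : Tendsto (fun n => c n ^ 2 * u n (a n)) atTop (𝓝 0))
    (he : Tendsto (fun n => 1 / (2 * v n (a n)) * (u n (a n) ^ 2)⁻¹) atTop (𝓝 0)) :
    Tendsto (fun n => c n * (b n - a n)) atTop (𝓝 (2 * ℓ)) ∧
    Tendsto (fun n => w n (b n)) atTop (𝓝 (-ℓ)) ∧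
    Tendsto (fun n => c n ^ 2 * u n (b n)) atTop (𝓝 (2 / 3 * ℓ ^ 3)) := by
  -- Any fixed M with M² > 4ℓ² serves, 4ℓ² being the limit of the quantity that M² has to dominate.
  set M := 4 * (ℓ + 1) with hM
  have hM0 : 0 < M := by positivity
  set ε : ℕ → ℝ := fun n => 1 / (2 * v n (a n)) * (u n (a n) ^ 2)⁻¹ +
    27 * c n ^ 5 * M / w n (a n) ^ 9 with hεdef
  have hε : Tendsto ε atTop (𝓝 0) := by
    rw [show (0 : ℝ) = 0 + 27 * 0 ^ 5 * M / ℓ ^ 9 by simp]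
    exact he.add ((((hc0.pow 5).const_mul 27).mul_const M).div (hw.pow 9) (by positivity))
  have hMlim : Tendsto (fun n => 4 * (c n * v n (a n) +
      (w n (a n) + 1 / (2 * v n (a n)) * (u n (a n) ^ 2)⁻¹) ^ 2)) atTop (𝓝 (4 * ℓ ^ 2)) := by
    have := (hv.add ((hw.add he).pow 2)).const_mul 4
    simpa using this
  have h54 : Tendsto (fun n => 54 * c n ^ 5 - w n (a n) ^ 9) atTop (𝓝 (-ℓ ^ 9)) := by
    have := ((hc0.pow 5).const_mul 54).sub (hw.pow 9)
    simpa using this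
  have key : ∀ᶠ n in atTop, 0 < w n (a n) ∧ w n (b n) + c n * (b n - a n) - w n (a n) ≤ ε n ∧
      2 * w n (a n) ≤ c n * (b n - a n) ∧
      c n * (b n - a n) ≤ 2 * (w n (a n) + ε n) + c n * v n (a n) / w n (a n) ∧
      w n (a n) - c n * (b n - a n) ≤ w n (b n) ∧
      u n (a n) + v n (a n) * (b n - a n) + w n (a n) * (b n - a n) ^ 2 / 2 -
        c n * (b n - a n) ^ 3 / 6 ≤ u n (b n) ∧
      u n (b n) ≤ u n (a n) + v n (a n) * (b n - a n) + (w n (a n) + ε n) * (b n - a n) ^ 2 / 2 -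
        c n * (b n - a n) ^ 3 / 6 := by
    filter_upwards [h, hw.eventually (lt_mem_nhds hℓ),
      hMlim.eventually (gt_mem_nhds (show 4 * ℓ ^ 2 < M ^ 2 by rw [hM]; nlinarith)),
      h54.eventually (gt_mem_nhds (show -ℓ ^ 9 < 0 by have := pow_pos hℓ 9; linarith))]
      with n hn hwn hMn h54n
    obtain ⟨hs, hab, hvp, hvb⟩ := hn
    have hε' := hs.ascent_remainder hab (hc n) hwn hvp hvb hM0.le (by linarith) hMn.le
    exact ⟨hwn, hε', hs.ascent_bounds hab hwn (hvp _ ⟨le_rfl, hab⟩) hvb hε'⟩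
  have hX : Tendsto (fun n => c n * (b n - a n)) atTop (𝓝 (2 * ℓ)) := by
    have l1 : Tendsto (fun n => 2 * w n (a n)) atTop (𝓝 (2 * ℓ)) := hw.const_mul 2
    have l2 : Tendsto (fun n => 2 * (w n (a n) + ε n) + c n * v n (a n) / w n (a n)) atTop
        (𝓝 (2 * ℓ)) := by
      have := ((hw.add hε).const_mul 2).add (hv.div hw hℓ.ne')
      simpa using this
    exact tendsto_of_tendsto_of_tendsto_of_le_of_le' l1 l2 (key.mono fun n hn => hn.2.2.1)
      (key.mono fun n hn => hn.2.2.2.1)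
  refine ⟨hX, ?_, ?_⟩
  · have l1 : Tendsto (fun n => w n (a n) - c n * (b n - a n)) atTop (𝓝 (-ℓ)) := by
      have := hw.sub hX
      rwa [show ℓ - 2 * ℓ = -ℓ by ring] at this
    have l2 : Tendsto (fun n => ε n + (w n (a n) - c n * (b n - a n))) atTop (𝓝 (-ℓ)) := by
      simpa using hε.add l1
    exact tendsto_of_tendsto_of_tendsto_of_le_of_le' l1 l2 (key.mono fun n hn => hn.2.2.2.2.1)
      (key.mono fun n hn => by linarith [hn.2.1])
  · have hlim : ∀ e : ℕ → ℝ, Tendsto e atTop (𝓝 0) → Tendsto (fun n => c n ^ 2 * u n (a n) +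
        c n * v n (a n) * (c n * (b n - a n)) + (w n (a n) + e n) * (c n * (b n - a n)) ^ 2 / 2 -
        (c n * (b n - a n)) ^ 3 / 6) atTop (𝓝 (2 / 3 * ℓ ^ 3)) := by
      intro e he'
      have := ((hu.add (hv.mul hX)).add (((hw.add he').mul (hX.pow 2)).div_const 2)).sub
        ((hX.pow 3).div_const 6)
      convert this using 2
      ring
    refine tendsto_of_tendsto_of_tendsto_of_le_of_le' (hlim (fun _ => 0) tendsto_const_nhds)
      (hlim ε hε) (key.mono fun n hn => ?_) (key.mono fun n hn => ?_)
    · have := mul_le_mul_of_nonneg_left hn.2.2.2.2.2.1 (sq_nonneg (c n))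
      refine le_trans (le_of_eq ?_) this
      ring
    · have := mul_le_mul_of_nonneg_left hn.2.2.2.2.2.2 (sq_nonneg (c n))
      refine this.trans (le_of_eq ?_)
      ring

/-! ### Passage through the minimum -/

/-- Used to choose a matching time that tends to infinity slowly enough for approximations on
bounded intervals to remain valid. -/
theorem exists_tendsto_diagonal {P : ℕ → ℕ → Prop} (h : ∀ k, ∀ᶠ n in atTop, P k n) :
    ∃ κ : ℕ → ℕ, Tendsto κ atTop atTop ∧ ∀ᶠ n in atTop, P (κ n) n := by
  choose N hN using fun k => eventually_atTop.1 (h k)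
  refine ⟨fun n => Nat.findGreatest (fun k => N k ≤ n) n, ?_, ?_⟩
  · rw [tendsto_atTop]
    intro k
    filter_upwards [eventually_ge_atTop (max k (N k))] with n hn
    exact Nat.le_findGreatest ((le_max_left _ _).trans hn) ((le_max_right _ _).trans hn)
  · filter_upwards [eventually_ge_atTop (N 0)] with n hn
    apply hN
    exact Nat.findGreatest_spec (P := fun k => N k ≤ n) (Nat.zero_le n) hn

section Passage

variable {K : ℝ} {φ φ₁ φ₂ : ℝ → ℝ} {c : ℕ → ℝ} {u v w : ℕ → ℝ → ℝ}

theorem IsProfile.uniform_approx (hφ : IsProfile K φ φ₁ φ₂) (hK : 0 < K)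
    (hc0 : Tendsto c atTop (𝓝 0))
    (hs : ∀ᶠ n in atTop, SolvesOn (c n) (Ici 0) (u n) (v n) (w n))
    (hu0 : Tendsto (fun n => u n 0) atTop (𝓝 (φ 0)))
    (hv0 : Tendsto (fun n => v n 0) atTop (𝓝 (φ₁ 0)))
    (hw0 : Tendsto (fun n => w n 0) atTop (𝓝 (φ₂ 0))) (T : ℝ) {e : ℝ} (he : 0 < e) :
    ∀ᶠ n in atTop, ∀ t ∈ Icc 0 T, |φ t - u n t| ≤ e ∧ |φ₁ t - v n t| ≤ e ∧
      |φ₂ t - w n t| ≤ e := by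
  obtain ⟨s₀, _, hmin⟩ := hφ.exists_isLeast hK
  have hδ : 0 < φ s₀ / 2 := half_pos (hφ.pos s₀)
  set η : ℕ → ℝ := fun n => |φ 0 - u n 0| + |φ₁ 0 - v n 0| + |φ₂ 0 - w n 0| + |0 - c n| with hη
  have hη0 : Tendsto η atTop (𝓝 0) := by
    rw [show (0 : ℝ) = |φ 0 - φ 0| + |φ₁ 0 - φ₁ 0| + |φ₂ 0 - φ₂ 0| + |(0:ℝ) - 0| by simp]
    exact (((hu0.const_sub _).abs.add (hv0.const_sub _).abs).add (hw0.const_sub _).abs).add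
      (hc0.const_sub 0).abs
  have hE : Tendsto (fun n => 2 * η n * Real.exp (truncLip (φ s₀ / 2) * T)) atTop (𝓝 0) := by
    have := (hη0.const_mul 2).mul_const (Real.exp (truncLip (φ s₀ / 2) * T))
    rwa [mul_zero, zero_mul] at this
  filter_upwards [hs, hE.eventually (gt_mem_nhds (lt_min hδ he))] with n hn hEn t ht
  have hle := SolvesOn.stability (T := T) (η := η n) hδ (c₁ := 0)
    (hφ.solves.mono (subset_univ _)) (hn.mono Icc_subset_Ici_self)
    (fun s _ => by linarith [hmin s])
    (by simp only [hη]; linarith [abs_nonneg (φ₁ 0 - v n 0), abs_nonneg (φ₂ 0 - w n 0),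
          abs_nonneg (0 - c n)])
    (by simp only [hη]; linarith [abs_nonneg (φ 0 - u n 0), abs_nonneg (φ₂ 0 - w n 0),
          abs_nonneg (0 - c n)])
    (by simp only [hη]; linarith [abs_nonneg (φ 0 - u n 0), abs_nonneg (φ₁ 0 - v n 0),
          abs_nonneg (0 - c n)])
    (by simp only [hη]; linarith [abs_nonneg (φ 0 - u n 0), abs_nonneg (φ₁ 0 - v n 0),
          abs_nonneg (φ₂ 0 - w n 0)])
    (hEn.trans_le (min_le_left _ _)) t ht
  have hEe := hEn.le.trans (min_le_right _ _)
  exact ⟨hle.1.trans hEe, hle.2.1.trans hEe, hle.2.2.trans hEe⟩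

variable {sm sp : ℕ → ℝ}

/-- Near the profile v n is positive at T, so the first zero comes before T. Also w n > 0 on [0, T],
so v n strictly increases after that zero and cannot vanish again by time T. -/
theorem IsProfile.zeros_separated (hφ : IsProfile K φ φ₁ φ₂) (hK : 0 < K)
    (hc0 : Tendsto c atTop (𝓝 0))
    (hs : ∀ᶠ n in atTop, SolvesOn (c n) (Ici 0) (u n) (v n) (w n))
    (hu0 : Tendsto (fun n => u n 0) atTop (𝓝 (φ 0)))
    (hv0 : Tendsto (fun n => v n 0) atTop (𝓝 (φ₁ 0)))
    (hw0 : Tendsto (fun n => w n 0) atTop (𝓝 (φ₂ 0)))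
    (hz : ∀ᶠ n in atTop, 0 < sm n ∧ sm n < sp n ∧ (∀ t ∈ Ico 0 (sm n), v n t < 0) ∧
      v n (sm n) = 0 ∧ (∀ t ∈ Ioo (sm n) (sp n), 0 < v n t) ∧ v n (sp n) = 0)
    {T : ℝ} (hT : 0 ≤ T) (hvT : 0 < φ₁ T) : ∀ᶠ n in atTop, sm n < T ∧ T < sp n := by
  filter_upwards [hs, hz, hφ.uniform_approx hK hc0 hs hu0 hv0 hw0 T
    (e := min (φ₁ T) (φ₂ 0) / 2) (half_pos (lt_min hvT (hφ.second_pos 0)))] with n hn hzn happ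
  obtain ⟨h1, h2, h3, h4, h5, h6⟩ := hzn
  have hm1 := min_le_left (φ₁ T) (φ₂ 0)
  have hm2 := min_le_right (φ₁ T) (φ₂ 0)
  have hm3 : 0 < min (φ₁ T) (φ₂ 0) := lt_min hvT (hφ.second_pos 0)
  have hvn : 0 < v n T := by linarith [(abs_le.1 (happ T ⟨hT, le_rfl⟩).2.1).2]
  have hwn : ∀ t ∈ Icc 0 T, 0 < w n t := fun t ht => by
    have k1 := (abs_le.1 (happ t ht).2.2).2
    have k2 := hφ.second_strictMono.monotone ht.1
    linarith
  have hmT : sm n < T := by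
    by_contra hle
    push Not at hle
    rcases eq_or_lt_of_le hle with h | h
    · rw [h, h4] at hvn; exact lt_irrefl _ hvn
    · linarith [h3 T ⟨hT, h⟩]
  refine ⟨hmT, ?_⟩
  by_contra hle
  push Not at hle
  have := lt_of_deriv_pos h2 (fun x hx => (hn x (h1.le.trans hx.1)).2.2.1)
    (fun x hx => hwn x ⟨h1.le.trans hx.1.le, hx.2.le.trans hle⟩)
  linarith

theorem IsProfile.passage_min (hφ : IsProfile K φ φ₁ φ₂) (hK : 0 < K)
    (hc0 : Tendsto c atTop (𝓝 0))
    (hs : ∀ᶠ n in atTop, SolvesOn (c n) (Ici 0) (u n) (v n) (w n))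
    (hu0 : Tendsto (fun n => u n 0) atTop (𝓝 (φ 0)))
    (hv0 : Tendsto (fun n => v n 0) atTop (𝓝 (φ₁ 0)))
    (hw0 : Tendsto (fun n => w n 0) atTop (𝓝 (φ₂ 0)))
    (hneg : φ₁ 0 < 0)
    (hz : ∀ᶠ n in atTop, 0 < sm n ∧ sm n < sp n ∧ (∀ t ∈ Ico 0 (sm n), v n t < 0) ∧
      v n (sm n) = 0 ∧ (∀ t ∈ Ioo (sm n) (sp n), 0 < v n t) ∧ v n (sp n) = 0)
    {s₀ : ℝ} (hs₀ : φ₁ s₀ = 0) (hmin : ∀ t, φ s₀ ≤ φ t) :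
    Tendsto (fun n => u n (sm n)) atTop (𝓝 (φ s₀)) ∧ ∃ T, ∀ᶠ n in atTop, sm n ≤ T := by
  obtain ⟨T, hT⟩ := hφ.exists_slope_pos
  have h0T : 0 < T := by
    by_contra hle
    push Not at hle
    linarith [hφ.slope_mono hle]
  have h0s : 0 < s₀ := by
    by_contra hle
    push Not at hle
    linarith [hφ.slope_mono hle]
  have hsT : s₀ < T := by
    by_contra hle
    push Not at hle
    linarith [hφ.slope_mono hle]
  have hsep := hφ.zeros_separated hK hc0 hs hu0 hv0 hw0 hz h0T.le hT
  refine ⟨?_, T, hsep.mono fun n hn => hn.1.le⟩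
  rw [Metric.tendsto_nhds]
  intro e he
  filter_upwards [hs, hz, hsep, hφ.uniform_approx hK hc0 hs hu0 hv0 hw0 T (half_pos he)]
    with n hn hzn hsepn happ
  obtain ⟨h1, h2, h3, h4, h5, h6⟩ := hzn
  -- The slope is negative before `sm n` and positive from there to `sp n`, an interval reaching
  -- past s₀; hence `sm n` minimises u n there. It remains to compare the two minima through the
  -- uniform approximation.
  have hle : u n (sm n) ≤ u n s₀ := by
    rcases le_total s₀ (sm n) with h | h
    · exact le_of_deriv_nonpos h (fun x hx => (hn x (h0s.le.trans hx.1)).2.1)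
        (fun x hx => (h3 x ⟨h0s.le.trans hx.1.le, hx.2⟩).le)
    · exact le_of_deriv_nonneg h (fun x hx => (hn x (h1.le.trans hx.1)).2.1)
        (fun x hx => (h5 x ⟨hx.1, hx.2.trans (hsT.trans hsepn.2)⟩).le)
  have k1 := (abs_le.1 (happ s₀ ⟨h0s.le, hsT.le⟩).1).1
  have k2 := (abs_le.1 (happ (sm n) ⟨h1.le, hsepn.1.le⟩).1).2
  have k3 := hmin (sm n)
  rw [Real.dist_eq, abs_lt]
  constructor <;> linarith

theorem IsProfile.tendsto_slope_atTop (hφ : IsProfile K φ φ₁ φ₂) : Tendsto φ₁ atTop atTop := by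
  have h2 := hφ.second_pos 0
  refine tendsto_atTop_mono' _ (f₁ := fun t => φ₁ 0 + φ₂ 0 * t) ?_
    (tendsto_atTop_add_const_left _ _ (tendsto_id.const_mul_atTop h2))
  filter_upwards [eventually_ge_atTop 0] with t ht
  have := sub_le_sub_of_deriv_le ht (fun t _ => hasDerivAt_affine 0 (φ₂ 0) 0 t)
    (fun t _ => hφ.deriv_one t) (fun t ht => hφ.second_strictMono.monotone ht.1.le)
  linarith

theorem IsProfile.tendsto_atTop (hφ : IsProfile K φ φ₁ φ₂) : Tendsto φ atTop atTop := by
  obtain ⟨T, hT⟩ := hφ.exists_slope_pos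
  refine tendsto_atTop_mono' _ (f₁ := fun t => (φ T - φ₁ T * T) + φ₁ T * t) ?_
    (tendsto_atTop_add_const_left _ _ (tendsto_id.const_mul_atTop hT))
  filter_upwards [eventually_ge_atTop T] with t ht
  have := sub_le_sub_of_deriv_le ht (fun t _ => hasDerivAt_affine 0 (φ₁ T) 0 t)
    (fun t _ => hφ.deriv_zero t) (fun t ht => hφ.slope_mono ht.1.le)
  linarith

/-- Matching: at a time a n → ∞ that grows slowly, the solution still follows the profile, so its
second derivative is close to ℓ, and `ascent_limits` applies from there on. -/
theorem IsProfile.passage_max (hφ : IsProfile K φ φ₁ φ₂) (hK : 0 < K) {ℓ : ℝ} (hℓ : 0 < ℓ)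
    (hl : Tendsto φ₂ atTop (𝓝 ℓ)) (hc : ∀ n, 0 < c n)
    (hc0 : Tendsto c atTop (𝓝 0))
    (hs : ∀ᶠ n in atTop, SolvesOn (c n) (Ici 0) (u n) (v n) (w n))
    (hu0 : Tendsto (fun n => u n 0) atTop (𝓝 (φ 0)))
    (hv0 : Tendsto (fun n => v n 0) atTop (𝓝 (φ₁ 0)))
    (hw0 : Tendsto (fun n => w n 0) atTop (𝓝 (φ₂ 0)))
    (hz : ∀ᶠ n in atTop, 0 < sm n ∧ sm n < sp n ∧ (∀ t ∈ Ico 0 (sm n), v n t < 0) ∧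
      v n (sm n) = 0 ∧ (∀ t ∈ Ioo (sm n) (sp n), 0 < v n t) ∧ v n (sp n) = 0) :
    Tendsto (fun n => c n * sp n) atTop (𝓝 (2 * ℓ)) ∧
    Tendsto (fun n => w n (sp n)) atTop (𝓝 (-ℓ)) ∧
    Tendsto (fun n => c n ^ 2 * u n (sp n)) atTop (𝓝 (2 / 3 * ℓ ^ 3)) := by
  obtain ⟨T₀, hT₀⟩ := eventually_atTop.1 ((hφ.tendsto_slope_atTop.eventually_ge_atTop 2).and
    (eventually_ge_atTop 0))
  have hT₀0 : 0 ≤ T₀ := (hT₀ T₀ le_rfl).2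
  have hone : ∀ k : ℕ, (0 : ℝ) < 1 / ((k : ℝ) + 1) := fun k => by positivity
  -- A common bound for height, slope and elapsed time at the matching point, 2 leaving room for the
  -- approximation errors. Requiring c·B → 0 makes all three negligible.
  set B : ℕ → ℝ := fun k => φ (T₀ + k) + φ₁ (T₀ + k) + (T₀ + k) + 2 with hB
  obtain ⟨κ, hκ, hP⟩ := exists_tendsto_diagonal (P := fun k n =>
      (∀ t ∈ Icc 0 (T₀ + k), |φ t - u n t| ≤ 1 / ((k : ℝ) + 1) ∧ |φ₁ t - v n t| ≤ 1 / ((k : ℝ) + 1) ∧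
      |φ₂ t - w n t| ≤ 1 / ((k : ℝ) + 1)) ∧ (sm n < T₀ + k ∧ T₀ + k < sp n) ∧
      c n * B k ≤ 1 / ((k : ℝ) + 1)) (fun k => by
    have hk : (0:ℝ) ≤ k := k.cast_nonneg
    refine (hφ.uniform_approx hK hc0 hs hu0 hv0 hw0 (T₀ + k) (hone k)).and
      ((hφ.zeros_separated hK hc0 hs hu0 hv0 hw0 hz (by linarith)
        (by linarith [(hT₀ (T₀ + k) (by linarith)).1])).and ?_)
    have : Tendsto (fun n => c n * B k) atTop (𝓝 0) := by simpa using hc0.mul_const (B k)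
    filter_upwards [this.eventually (gt_mem_nhds (hone k))] with n hn using hn.le)
  set a : ℕ → ℝ := fun n => T₀ + κ n with ha
  have hκr : Tendsto (fun n => (κ n : ℝ)) atTop atTop := tendsto_natCast_atTop_atTop.comp hκ
  have hatop : Tendsto a atTop atTop := tendsto_atTop_add_const_left _ _ hκr
  have ha0 : ∀ n, T₀ ≤ a n := fun n => by
    have : (0:ℝ) ≤ κ n := (κ n).cast_nonneg
    simp only [ha]; linarith
  have he0 : Tendsto (fun n => 1 / ((κ n : ℝ) + 1)) atTop (𝓝 0) := by
    have := tendsto_inv_atTop_zero.comp (tendsto_atTop_add_const_right _ 1 hκr)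
    simpa [Function.comp_def] using this
  have he1 : ∀ n, 1 / ((κ n : ℝ) + 1) ≤ 1 := fun n => by
    rw [div_le_one (by positivity)]
    linarith [(κ n).cast_nonneg (α := ℝ)]
  have hfacts : ∀ᶠ n in atTop, |φ (a n) - u n (a n)| ≤ 1 / ((κ n : ℝ) + 1) ∧
      |φ₁ (a n) - v n (a n)| ≤ 1 / ((κ n : ℝ) + 1) ∧
      |φ₂ (a n) - w n (a n)| ≤ 1 / ((κ n : ℝ) + 1) ∧ sm n < a n ∧ a n < sp n ∧
      c n * B (κ n) ≤ 1 / ((κ n : ℝ) + 1) := by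
    filter_upwards [hP] with n hn
    obtain ⟨p1, p2, p3⟩ := hn
    obtain ⟨q1, q2, q3⟩ := p1 (a n) ⟨hT₀0.trans (ha0 n), le_rfl⟩
    exact ⟨q1, q2, q3, p2.1, p2.2, p3⟩
  have hbig : ∀ᶠ n in atTop, 1 ≤ v n (a n) ∧ φ (a n) - 1 ≤ u n (a n) := by
    filter_upwards [hfacts] with n hn
    have k1 := (abs_le.1 hn.1).2
    have k2 := (abs_le.1 hn.2.1).2
    have k3 := (hT₀ (a n) (ha0 n)).1
    exact ⟨by linarith [he1 n], by linarith [he1 n]⟩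
  have hcsmall : ∀ᶠ n in atTop, c n ≤ 1 :=
    (hc0.eventually (gt_mem_nhds one_pos)).mono fun n hn => hn.le
  have hwlim : Tendsto (fun n => w n (a n)) atTop (𝓝 ℓ) := by
    have h1 : Tendsto (fun n => φ₂ (a n)) atTop (𝓝 ℓ) := hl.comp hatop
    have h2 : Tendsto (fun n => φ₂ (a n) - w n (a n)) atTop (𝓝 0) :=
      squeeze_zero_norm' (hfacts.mono fun n hn => hn.2.2.1) he0
    simpa using h1.sub h2
  have hBge : ∀ n, 0 < φ (a n) ∧ 2 ≤ φ₁ (a n) ∧ 0 ≤ a n := fun n =>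
    ⟨hφ.pos _, (hT₀ _ (ha0 n)).1, hT₀0.trans (ha0 n)⟩
  have hBval : ∀ n, B (κ n) = φ (a n) + φ₁ (a n) + a n + 2 := fun n => rfl
  have hcv : Tendsto (fun n => c n * v n (a n)) atTop (𝓝 0) := by
    refine squeeze_zero' (hbig.mono fun n hn => mul_nonneg (hc n).le (by linarith [hn.1])) ?_ he0
    filter_upwards [hfacts] with n hn
    obtain ⟨b1, b2, b3⟩ := hBge n
    refine le_trans (mul_le_mul_of_nonneg_left ?_ (hc n).le) hn.2.2.2.2.2
    rw [hBval]
    linarith [(abs_le.1 hn.2.1).1, he1 n]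
  have hcu : Tendsto (fun n => c n ^ 2 * u n (a n)) atTop (𝓝 0) := by
    refine squeeze_zero' (g := fun n => 1 / ((κ n : ℝ) + 1)) ?_ ?_ he0
    · filter_upwards [hs] with n hn
      have := (hn (a n) (hT₀0.trans (ha0 n))).1
      positivity
    · filter_upwards [hfacts, hcsmall] with n hn hcn
      obtain ⟨b1, b2, b3⟩ := hBge n
      have h1 : c n * u n (a n) ≤ 1 / ((κ n : ℝ) + 1) := by
        refine le_trans (mul_le_mul_of_nonneg_left ?_ (hc n).le) hn.2.2.2.2.2
        rw [hBval]
        linarith [(abs_le.1 hn.1).1, he1 n]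
      have h2 : 0 ≤ 1 / ((κ n : ℝ) + 1) := by positivity
      have := hc n
      nlinarith
  have hca : Tendsto (fun n => c n * a n) atTop (𝓝 0) := by
    refine squeeze_zero' (Eventually.of_forall fun n => mul_nonneg (hc n).le (hBge n).2.2) ?_ he0
    filter_upwards [hfacts] with n hn
    obtain ⟨b1, b2, b3⟩ := hBge n
    refine le_trans (mul_le_mul_of_nonneg_left ?_ (hc n).le) hn.2.2.2.2.2
    rw [hBval]
    linarith
  have hutop : Tendsto (fun n => u n (a n)) atTop atTop := by
    refine tendsto_atTop_mono' _ (hbig.mono fun n hn => hn.2) ?_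
    exact tendsto_atTop_add_const_right _ (-1) (hφ.tendsto_atTop.comp hatop)
  have hrem : Tendsto (fun n => 1 / (2 * v n (a n)) * (u n (a n) ^ 2)⁻¹) atTop (𝓝 0) := by
    have h1 : Tendsto (fun n => (u n (a n) ^ 2)⁻¹) atTop (𝓝 0) :=
      tendsto_inv_atTop_zero.comp ((tendsto_pow_atTop two_ne_zero).comp hutop)
    refine squeeze_zero' ?_ ?_ h1
    · filter_upwards [hbig] with n hn
      have : 0 < v n (a n) := by linarith [hn.1]
      positivity
    · filter_upwards [hbig] with n hn
      have h2 : 1 / (2 * v n (a n)) ≤ 1 := by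
        rw [div_le_one (by linarith [hn.1])]; linarith [hn.1]
      have h3 : 0 ≤ (u n (a n) ^ 2)⁻¹ := by positivity
      nlinarith
  have hmain := ascent_limits (a := a) (b := sp) hℓ hc hc0 (by
    filter_upwards [hs, hz, hfacts] with n hn hzn hfn
    obtain ⟨h1, h2, h3, h4, h5, h6⟩ := hzn
    exact ⟨hn.mono fun t ht => (hT₀0.trans (ha0 n)).trans ht.1, hfn.2.2.2.2.1,
      fun t ht => h5 t ⟨hfn.2.2.2.1.trans_le ht.1, ht.2⟩, h6⟩) hwlim hcv hcu hrem
  refine ⟨?_, hmain.2⟩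
  have := hmain.1.add hca
  simp only [← mul_add, sub_add_cancel, add_zero] at this
  exact this

/-- A solution arriving from a great height with slope `-K` and small second derivative
approaches the profile. -/
theorem IsProfile.arrival (hφ : IsProfile K φ φ₁ φ₂) (hK : 0 < K) (hY : 24 ≤ K ^ 3 * φ 0)
    (hφs : ∀ s, s ≤ 0 → φ₁ s ≤ -K / 2) {h : ℕ → ℝ} (hh : Tendsto h atTop atTop)
    (hc : ∀ n, c n = (h n ^ 3)⁻¹) (hs : ∀ᶠ n in atTop, SolvesOn (c n) (Ici 0) (u n) (v n) (w n))
    (hu0 : ∀ n, u n 0 = h n) (hv0 : ∀ᶠ n in atTop, v n 0 = -K)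
    (hw0 : Tendsto (fun n => h n * w n 0) atTop (𝓝 0)) :
    ∃ T : ℕ → ℝ, (∀ᶠ n in atTop, 0 < T n ∧ K / 2 * T n ≤ h n ∧ u n (T n) = φ 0 ∧
      ∀ t ∈ Icc 0 (T n), v n t ≤ -K / 2) ∧
      Tendsto (fun n => v n (T n)) atTop (𝓝 (φ₁ 0)) ∧
      Tendsto (fun n => w n (T n)) atTop (𝓝 (φ₂ 0)) := by
  have hY0 := hφ.pos 0
  have hex : ∀ᶠ n in atTop, ∃ T, 0 < T ∧ u n T = φ 0 ∧ K / 2 * T ≤ h n - φ 0 ∧ ∀ t ∈ Icc 0 T,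
      v n t ≤ -K / 2 ∧ -K - |w n 0| * t ≤ v n t := by
    have hw0' : Tendsto (fun n => |h n * w n 0|) atTop (𝓝 0) := by simpa using hw0.abs
    filter_upwards [hs, hv0, hh.eventually_gt_atTop (φ 0),
      hw0'.eventually (gt_mem_nhds (show 0 < K ^ 2 / 16 by positivity))] with n hn hvn hhn hwn
    have hpos : 0 < h n := hY0.trans hhn
    obtain ⟨T, hT, huT, hTle, hB⟩ := exists_descent_time (ω := |w n 0|) (Y := φ 0) hK
      (by linarith) hhn (abs_nonneg _)
      (by rw [abs_mul, abs_of_pos hpos] at hwn; linarith)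
      (fun t ht => (hn t ht).2) (fun t ht h1 h2 => by
        have hut := (hn t ht).1
        rw [hc n]
        have h3 : (h n ^ 3)⁻¹ ≤ (u n t ^ 3)⁻¹ := by gcongr
        have h4 : 0 ≤ (h n ^ 3)⁻¹ := by positivity
        exact ⟨by linarith, by linarith⟩) (hu0 n) hvn le_rfl
    exact ⟨T, hT, huT, hTle, fun t ht => ⟨(hB t ht).2.1, (hB t ht).2.2.1⟩⟩
  obtain ⟨N, hN⟩ := eventually_atTop.1 hex
  choose! T hT using hN
  have hT' : ∀ᶠ n in atTop, 0 < T n ∧ u n (T n) = φ 0 ∧ K / 2 * T n ≤ h n - φ 0 ∧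
      ∀ t ∈ Icc 0 (T n), v n t ≤ -K / 2 ∧ -K - |w n 0| * t ≤ v n t :=
    eventually_atTop.2 ⟨N, hT⟩
  have hhpos : ∀ᶠ n in atTop, 0 < h n := hh.eventually_gt_atTop 0
  have hhinv : Tendsto (fun n => (h n)⁻¹) atTop (𝓝 0) := tendsto_inv_atTop_zero.comp hh
  have hThle : ∀ᶠ n in atTop, T n ≤ 2 / K * h n := by
    filter_upwards [hT'] with n hn
    rw [div_mul_eq_mul_div, le_div_iff₀ hK]
    linarith [hn.2.2.1]
  have hhw : Tendsto (fun n => h n * |w n 0|) atTop (𝓝 0) := by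
    have : Tendsto (fun n => |h n * w n 0|) atTop (𝓝 0) := by simpa using hw0.abs
    refine this.congr' ?_
    filter_upwards [hhpos] with n hn
    rw [abs_mul, abs_of_pos hn]
  have hTw : Tendsto (fun n => T n * |w n 0|) atTop (𝓝 0) := by
    refine squeeze_zero' (hT'.mono fun n hn => mul_nonneg hn.1.le (abs_nonneg _)) ?_
      (by simpa using hhw.const_mul (2 / K))
    filter_upwards [hThle] with n hn
    calc T n * |w n 0| ≤ 2 / K * h n * |w n 0| := by gcongr
      _ = 2 / K * (h n * |w n 0|) := by ring
  -- The descent has slope at least -(K + 1), so it is long; the profile may therefore be compared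
  -- at -T n, where its slope is near -K and its second derivative is o(1/T n).
  have hTtop : Tendsto T atTop atTop := by
    refine tendsto_atTop_mono' _ (f₁ := fun n => (h n + (-φ 0)) / (K + 1)) ?_
      ((tendsto_atTop_add_const_right _ _ hh).atTop_div_const (by linarith))
    filter_upwards [hT', hs, hTw.eventually (gt_mem_nhds one_pos)] with n hn hsn hTn
    obtain ⟨h1, h2, h3, h4⟩ := hn
    have := sub_le_sub_of_deriv_le h1.le (fun t _ => hasDerivAt_affine 0 (-(K + 1)) 0 t)
      (fun t ht => (hsn t ht.1).2.1) (fun t ht => by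
        have h5 := (h4 t (Ioo_subset_Icc_self ht)).2
        have h6 : |w n 0| * t ≤ T n * |w n 0| := by nlinarith [abs_nonneg (w n 0), ht.2]
        linarith)
    rw [h2, hu0] at this
    rw [div_le_iff₀ (by linarith)]
    linarith
  have hcn : ∀ᶠ n in atTop, |c n| = (h n ^ 3)⁻¹ := hhpos.mono fun n hn => by
    rw [hc n, abs_of_pos (by positivity)]
  have hcT2 : Tendsto (fun n => |c n| * T n ^ 2) atTop (𝓝 0) := by
    refine squeeze_zero' (Eventually.of_forall fun n => by positivity) ?_
      (by simpa using hhinv.const_mul (4 / K ^ 2))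
    filter_upwards [hcn, hhpos, hThle, hT'] with n h1 h2 h3 h4
    rw [h1]
    calc (h n ^ 3)⁻¹ * T n ^ 2 ≤ (h n ^ 3)⁻¹ * (2 / K * h n) ^ 2 := by
          have := h4.1
          gcongr
      _ = 4 / K ^ 2 * (h n)⁻¹ := by field_simp; norm_num
  have hT1 : ∀ᶠ n in atTop, 1 ≤ T n := hTtop.eventually_ge_atTop 1
  have hcT : Tendsto (fun n => |c n| * T n) atTop (𝓝 0) := by
    refine squeeze_zero' (hT1.mono fun n hn => mul_nonneg (abs_nonneg _) (by linarith)) ?_ hcT2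
    filter_upwards [hT1] with n hn
    have := abs_nonneg (c n)
    have h2 : T n ≤ T n ^ 2 := by nlinarith
    gcongr
  have hA : Tendsto (fun n => |-K - φ₁ (-T n)|) atTop (𝓝 0) := by
    have := ((hφ.tendsto_slope.comp (tendsto_neg_atTop_atBot.comp hTtop)).const_sub (-K)).abs
    simpa using this
  have hTD : Tendsto (fun n => T n * |w n 0 - φ₂ (-T n)|) atTop (𝓝 0) := by
    have h2 := hφ.tendsto_mul_second.comp hTtop
    refine squeeze_zero' (hT1.mono fun n hn => mul_nonneg (by linarith) (abs_nonneg _)) ?_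
      (by simpa using hTw.add h2)
    filter_upwards [hT1] with n hn
    have h3 : |w n 0 - φ₂ (-T n)| ≤ |w n 0| + φ₂ (-T n) := by
      have := abs_sub (w n 0) (φ₂ (-T n))
      rwa [abs_of_nonneg (hφ.convex _)] at this
    rw [← mul_add]
    gcongr
  have hD : Tendsto (fun n => |w n 0 - φ₂ (-T n)|) atTop (𝓝 0) := by
    refine squeeze_zero' (Eventually.of_forall fun n => abs_nonneg _) ?_ hTD
    filter_upwards [hT1] with n hn
    nlinarith [abs_nonneg (w n 0 - φ₂ (-T n))]
  -- The error of `backward_comparison`. The forcing is harmless because T n ≤ 2h/K and c n = h⁻³,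
  -- so c n·T n² = O(1/h).
  have hE : Tendsto (fun n => |-K - φ₁ (-T n)| + T n * |w n 0 - φ₂ (-T n)| + |c n| * T n ^ 2)
      atTop (𝓝 0) := by simpa using (hA.add hTD).add hcT2
  have hcmp : ∀ᶠ n in atTop, |v n (T n) - φ₁ 0| ≤
        2 * (|-K - φ₁ (-T n)| + T n * |w n 0 - φ₂ (-T n)| + |c n| * T n ^ 2) ∧
      |w n (T n) - φ₂ 0| ≤ |w n 0 - φ₂ (-T n)| + |c n| * T n + 3 / ((K / 2) ^ 2 * φ 0 ^ 2) *
        (|-K - φ₁ (-T n)| + T n * |w n 0 - φ₂ (-T n)| + |c n| * T n ^ 2) := by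
    filter_upwards [hT', hs, hv0] with n hn hsn hvn
    obtain ⟨h1, h2, h3, h4⟩ := hn
    have hsol := hsn.comp_add (J := Icc (-T n) 0) (T n) (fun t ht => by
      have := ht.1
      exact mem_Ici.2 (by linarith))
    have := backward_comparison (half_pos hK) h1.le (Y := φ 0) (by linarith) hsol
      (hφ.solves.mono (subset_univ _)) (by simp [h2]) (fun s hsm => by
        have := sub_le_sub_of_deriv_le (a := s + T n) (b := T n) (by linarith [hsm.2])
          (fun t ht => (hsn t (mem_Ici.2 (by linarith [hsm.1, ht.1]))).2.1)
          (fun t _ => hasDerivAt_affine 0 (-K / 2) 0 t)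
          (fun t ht => (h4 t ⟨by linarith [hsm.1, ht.1], ht.2.le⟩).1)
        rw [h2] at this
        linarith) (fun s hsm => hφ.lower_bound hφs hsm.2)
    have h5 := this.1 0 ⟨by linarith, le_rfl⟩
    have h6 := this.2
    simp only [neg_add_cancel, zero_add, hvn] at h5 h6
    exact ⟨h5, h6⟩
  refine ⟨T, ?_, ?_, ?_⟩
  · filter_upwards [hT'] with n hn
    exact ⟨hn.1, by linarith [hn.2.2.1], hn.2.1, fun t ht => (hn.2.2.2 t ht).1⟩
  · rw [tendsto_iff_dist_tendsto_zero]
    simp only [Real.dist_eq]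
    exact squeeze_zero' (Eventually.of_forall fun n => abs_nonneg _)
      (hcmp.mono fun n hn => hn.1) (by simpa using hE.const_mul 2)
  · rw [tendsto_iff_dist_tendsto_zero]
    simp only [Real.dist_eq]
    refine squeeze_zero' (Eventually.of_forall fun n => abs_nonneg _)
      (hcmp.mono fun n hn => hn.2) ?_
    have := (hD.add hcT).add (hE.const_mul (3 / ((K / 2) ^ 2 * φ 0 ^ 2)))
    rwa [mul_zero, add_zero, add_zero] at this

end Passage

/-! ### Oscillation of film solutions -/

theorem tendsto_atTop_of_le_deriv {f f' : ℝ → ℝ} {T c : ℝ} (hc : 0 < c)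
    (hf : ∀ t, T ≤ t → HasDerivAt f (f' t) t) (h : ∀ t, T ≤ t → c ≤ f' t) :
    Tendsto f atTop atTop := by
  refine tendsto_atTop_mono' _ (f₁ := fun t => (f T - c * T) + c * t) ?_
    (tendsto_atTop_add_const_left _ _ (tendsto_id.const_mul_atTop hc))
  filter_upwards [eventually_ge_atTop T] with t ht
  have := sub_le_sub_of_deriv_le ht (fun t _ => hasDerivAt_affine 0 c 0 t)
    (fun t ht => hf t ht.1) (fun t ht => h t ht.1.le)
  linarith

theorem tendsto_atTop_of_le_deriv_two {f f' f'' : ℝ → ℝ} {T c : ℝ} (hc : 0 < c)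
    (hf : ∀ t, T ≤ t → HasDerivAt f (f' t) t) (hf' : ∀ t, T ≤ t → HasDerivAt f' (f'' t) t)
    (h : ∀ t, T ≤ t → c ≤ f'' t) : Tendsto f atTop atTop := by
  obtain ⟨T₁, hT₁⟩ := eventually_atTop.1
    ((tendsto_atTop_of_le_deriv hc hf' h).eventually_ge_atTop 1)
  exact tendsto_atTop_of_le_deriv (T := max T T₁) one_pos
    (fun t ht => hf t ((le_max_left _ _).trans ht))
    (fun t ht => hT₁ t ((le_max_right _ _).trans ht))

/-- A bounded increasing function with nonnegative third derivative has derivatives tending to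
zero. -/
theorem tendsto_derivs_zero {x v w r : ℝ → ℝ} {T B : ℝ}
    (hx : ∀ t, T ≤ t → HasDerivAt x (v t) t) (hv : ∀ t, T ≤ t → HasDerivAt v (w t) t)
    (hw : ∀ t, T ≤ t → HasDerivAt w (r t) t) (hvpos : ∀ t, T ≤ t → 0 < v t)
    (hr : ∀ t, T ≤ t → 0 ≤ r t) (hB : ∀ t, T ≤ t → x t ≤ B) :
    Tendsto v atTop (𝓝 0) ∧ Tendsto w atTop (𝓝 0) := by
  have hnot : ¬ Tendsto x atTop atTop := fun h => by
    obtain ⟨t, ht1, ht2⟩ := ((h.eventually_gt_atTop B).and (eventually_ge_atTop T)).exists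
    linarith [hB t ht2]
  have wmono : ∀ s t, T ≤ s → s ≤ t → w s ≤ w t := fun s t hs hst =>
    le_of_deriv_nonneg hst (fun y hy => hw y (hs.trans hy.1)) (fun y hy => hr y (hs.trans hy.1.le))
  have wneg : ∀ t, T ≤ t → w t ≤ 0 := fun t ht => by
    by_contra hpos
    push Not at hpos
    exact hnot (tendsto_atTop_of_le_deriv_two hpos (fun s hs => hx s (ht.trans hs))
      (fun s hs => hv s (ht.trans hs)) (fun s hs => wmono t s ht hs))
  have vanti : ∀ s t, T ≤ s → s ≤ t → v t ≤ v s := fun s t hs hst =>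
    le_of_deriv_nonpos hst (fun y hy => hv y (hs.trans hy.1))
      (fun y hy => wneg y (hs.trans hy.1.le))
  constructor
  · rw [Metric.tendsto_nhds]
    intro e he
    obtain ⟨t, ht, hte⟩ : ∃ t, T ≤ t ∧ v t < e := by
      by_contra hcon
      push Not at hcon
      exact hnot (tendsto_atTop_of_le_deriv he hx hcon)
    filter_upwards [eventually_ge_atTop t] with s hs
    rw [Real.dist_eq, sub_zero, abs_of_pos (hvpos s (ht.trans hs))]
    exact (vanti t s ht hs).trans_lt hte
  · rw [Metric.tendsto_nhds]
    intro e he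
    obtain ⟨t, ht, hte⟩ : ∃ t, T ≤ t ∧ -e < w t := by
      by_contra hcon
      push Not at hcon
      have := tendsto_atTop_of_le_deriv (f := fun t => -v t) he (fun t ht => (hv t ht).neg)
        (fun t ht => by linarith [hcon t ht])
      obtain ⟨t, ht1, ht2⟩ := ((this.eventually_gt_atTop 0).and (eventually_ge_atTop T)).exists
      linarith [hvpos t ht2]
    filter_upwards [eventually_ge_atTop t] with s hs
    rw [Real.dist_eq, sub_zero, abs_lt]
    constructor <;> linarith [wmono t s ht hs, wneg s (ht.trans hs)]

theorem eventually_pos_right {f : ℝ → ℝ} {d t : ℝ} (h : HasDerivAt f d t) (hd : 0 < d)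
    (h0 : f t = 0) : ∀ᶠ s in 𝓝[>] t, 0 < f s := by
  have h1 := (hasDerivAt_iff_tendsto_slope.1 h).mono_left
    (nhdsWithin_mono t (fun s (hs : t < s) => hs.ne'))
  filter_upwards [h1.eventually (lt_mem_nhds hd), self_mem_nhdsWithin] with s hs hst
  rw [slope_def_field, h0, sub_zero] at hs
  have hst' : 0 < s - t := sub_pos.2 hst
  exact (div_pos_iff_of_pos_right hst').1 hs

theorem eventually_neg_left {f : ℝ → ℝ} {d t : ℝ} (h : HasDerivAt f d t) (hd : 0 < d)
    (h0 : f t = 0) : ∀ᶠ s in 𝓝[<] t, f s < 0 := by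
  have h1 := (hasDerivAt_iff_tendsto_slope.1 h).mono_left
    (nhdsWithin_mono t (fun s (hs : s < t) => hs.ne))
  filter_upwards [h1.eventually (lt_mem_nhds hd), self_mem_nhdsWithin] with s hs hst
  rw [slope_def_field, h0, sub_zero] at hs
  have hst' : s - t < 0 := sub_neg.2 hst
  by_contra hle
  push Not at hle
  exact absurd hs (not_lt.2 (div_nonpos_of_nonneg_of_nonpos hle hst'.le))

theorem exists_next_zero {f f' : ℝ → ℝ} {t : ℝ} (hf : ∀ s, t ≤ s → HasDerivAt f (f' s) s)
    (h0 : f t = 0) (h' : 0 < f' t) (hz : ∃ z, t < z ∧ f z = 0) :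
    ∃ t', t < t' ∧ f t' = 0 ∧ (∀ s ∈ Ioo t t', 0 < f s) ∧ f' t' ≤ 0 := by
  obtain ⟨z, hz, hfz⟩ := hz
  obtain ⟨t₁, ht₁, hpos⟩ := mem_nhdsGT_iff_exists_Ioo_subset.1
    (eventually_pos_right (hf t le_rfl) h' h0)
  have ht₁' : t < t₁ := ht₁
  set m := (t + min t₁ z) / 2 with hm
  have hmin : t < min t₁ z := lt_min ht₁' hz
  have htm : t < m := by rw [hm]; linarith
  have hmt₁ : m < t₁ := by rw [hm]; linarith [min_le_left t₁ z]
  have hmz : m < z := by rw [hm]; linarith [min_le_right t₁ z]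
  obtain ⟨t', hmt', _, hft', hpos'⟩ := exists_isLeast_zero hmz.le
    (fun s hs => (hf s (htm.le.trans hs.1)).continuousAt.continuousWithinAt)
    (hpos ⟨htm, hmt₁⟩) hfz.le
  have hposall : ∀ s ∈ Ioo t t', 0 < f s := fun s hs => by
    rcases lt_or_ge s m with h | h
    · exact hpos ⟨hs.1, h.trans hmt₁⟩
    · exact hpos' s ⟨h, hs.2⟩
  refine ⟨t', htm.trans hmt', hft', hposall, ?_⟩
  by_contra hlt
  push Not at hlt
  have h1 := eventually_neg_left (hf t' (htm.trans hmt').le) hlt hft'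
  have h2 : ∀ᶠ s in 𝓝[<] t', s ∈ Ioo t t' := Ioo_mem_nhdsLT (htm.trans hmt')
  obtain ⟨s, hs1, hs2⟩ := (h1.and h2).exists
  linarith [hposall s hs2]

/-- Backward persistence of the sign of the first derivative. -/
theorem deriv_pos_of_backward {x v w r : ℝ → ℝ} {a t : ℝ}
    (hx : ∀ s ∈ Icc a t, HasDerivAt x (v s) s) (hv : ∀ s ∈ Icc a t, HasDerivAt v (w s) s)
    (hw : ∀ s ∈ Icc a t, HasDerivAt w (r s) s) (hr : ∀ s ∈ Icc a t, x s < 0 → 0 < r s)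
    (hvt : v t = 0) (hxt : x t ≤ 0) (hwt : w t ≤ 0) (hne : x t < 0 ∨ w t < 0) :
    ∀ s ∈ Ico a t, 0 < v s := by
  intro s hs
  by_contra hle
  push Not at hle
  have htm : t ∈ Icc a t := ⟨hs.1.trans hs.2.le, le_rfl⟩
  obtain ⟨t₂, ht₂, hnear⟩ : ∃ t₂ ∈ Ico s t, ∀ y ∈ Ico t₂ t, 0 < v y := by
    have hlast : ∀ p : ℝ → Prop, (∀ᶠ y in 𝓝[<] t, p y) → ∃ t₂ ∈ Ico s t, ∀ y ∈ Ico t₂ t, p y := by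
      intro p hp
      obtain ⟨l, hl, hsub⟩ := mem_nhdsLT_iff_exists_Ioo_subset.1 hp
      have hl' : l < t := hl
      refine ⟨max s ((l + t) / 2), ⟨le_max_left _ _, max_lt hs.2 (by linarith)⟩, fun y hy => ?_⟩
      exact hsub ⟨by have := (le_max_right s ((l + t) / 2)).trans hy.1
                     linarith, hy.2⟩
    rcases lt_or_eq_of_le hwt with hw0 | hw0
    · apply hlast
      have := eventually_neg_left (f := fun y => -v y) (hv t htm).neg (by linarith) (by simp [hvt])
      filter_upwards [this] with y hy
      linarith
    · have hx0 : x t < 0 := hne.resolve_right (by rw [hw0]; exact lt_irrefl _)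
      obtain ⟨t₂, ht₂, hwn⟩ := hlast _ (eventually_neg_left (hw t htm) (hr t htm hx0) hw0)
      refine ⟨t₂, ht₂, fun y hy => ?_⟩
      have hya : a ≤ y := hs.1.trans (ht₂.1.trans hy.1)
      have := lt_of_deriv_neg hy.2 (fun z hz => hv z ⟨hya.trans hz.1, hz.2⟩)
        (fun z hz => hwn z ⟨hy.1.trans hz.1.le, hz.2⟩)
      linarith
  have hcv : ContinuousOn v (Icc s t₂) := fun y hy =>
    (hv y ⟨hs.1.trans hy.1, hy.2.trans ht₂.2.le⟩).continuousAt.continuousWithinAt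
  have hA : IsCompact (Icc s t₂ ∩ v ⁻¹' Iic 0) := isCompact_Icc.of_isClosed_subset
    (hcv.preimage_isClosed_of_isClosed isClosed_Icc isClosed_Iic) inter_subset_left
  obtain ⟨m, hm, hmax⟩ := hA.exists_isGreatest ⟨s, ⟨le_rfl, ht₂.1⟩, hle⟩
  have hmt : m < t := hm.1.2.trans_lt ht₂.2
  have ham : a ≤ m := hs.1.trans hm.1.1
  have hvpos : ∀ y ∈ Ioo m t, 0 < v y := fun y hy => by
    rcases lt_or_ge y t₂ with h | h
    · by_contra hn
      push Not at hn
      exact absurd (hmax ⟨⟨hm.1.1.trans hy.1.le, h.le⟩, hn⟩) (not_le.2 hy.1)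
    · exact hnear y ⟨h, hy.2⟩
  have hxneg : ∀ y ∈ Ioo m t, x y < 0 := fun y hy => by
    have := lt_of_deriv_pos hy.2 (fun z hz => hx z ⟨ham.trans (hy.1.le.trans hz.1), hz.2⟩)
      (fun z hz => hvpos z ⟨hy.1.trans hz.1, hz.2⟩)
    linarith
  have hwneg : ∀ y ∈ Ioo m t, w y < 0 := fun y hy => by
    have := lt_of_deriv_pos hy.2 (fun z hz => hw z ⟨ham.trans (hy.1.le.trans hz.1), hz.2⟩)
      (fun z hz => hr z ⟨ham.trans (hy.1.trans hz.1).le, hz.2.le⟩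
        (hxneg z ⟨hy.1.trans hz.1, hz.2⟩))
    linarith
  have := lt_of_deriv_neg hmt (fun z hz => hv z ⟨ham.trans hz.1, hz.2⟩) hwneg
  have hvm : v m ≤ 0 := hm.2
  linarith

/-! ### Alternation of maxima and minima for solutions off the stable manifold -/

section Film

variable {τ₀ : ℝ} {u v w : ℝ → ℝ}

/-- Once above 1, an increasing u would have u''' bounded above by a negative constant, forcing u' <
0. Hence u ≤ 1 and u''' ≥ 0, so u' and u'' vanish at infinity; a limit below 1 would keep u''' away
from zero. -/
theorem film_tendsto_of_deriv_pos (h : SolvesOn 1 (Ioi τ₀) u v w) {T : ℝ} (hT : τ₀ < T)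
    (hv : ∀ t, T ≤ t → 0 < v t) :
    Tendsto (fun t => (u t, v t, w t)) atTop (𝓝 ((1 : ℝ), (0 : ℝ), (0 : ℝ))) := by
  have hs : ∀ t, T ≤ t → 0 < u t ∧ HasDerivAt u (v t) t ∧ HasDerivAt v (w t) t ∧
    HasDerivAt w ((u t ^ 3)⁻¹ - 1) t := fun t ht => h t (hT.trans_le ht)
  have umono : ∀ s t, T ≤ s → s ≤ t → u s ≤ u t := fun s t hs' hst =>
    le_of_deriv_nonneg hst (fun y hy => (hs y (hs'.trans hy.1)).2.1)
      (fun y hy => (hv y (hs'.trans hy.1.le)).le)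
  have hu1 : ∀ t, T ≤ t → u t ≤ 1 := fun t ht => by
    by_contra hgt
    push Not at hgt
    have hc : 0 < 1 - (u t ^ 3)⁻¹ := by
      have : (u t ^ 3)⁻¹ < 1 := inv_lt_one_of_one_lt₀ (one_lt_pow₀ hgt (by norm_num))
      linarith
    have := tendsto_atTop_of_le_deriv_two (f := fun s => -v s) (T := t) hc
      (fun s hs' => (hs s (ht.trans hs')).2.2.1.neg) (fun s hs' => (hs s (ht.trans hs')).2.2.2.neg)
      (fun s hs' => by
        have h1 := umono t s ht hs'
        have h2 := (hs t ht).1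
        have : (u s ^ 3)⁻¹ ≤ (u t ^ 3)⁻¹ := by gcongr
        linarith)
    obtain ⟨s, hs1, hs2⟩ := ((this.eventually_gt_atTop 0).and (eventually_ge_atTop T)).exists
    linarith [hv s hs2]
  have hr : ∀ t, T ≤ t → 0 ≤ (u t ^ 3)⁻¹ - 1 := fun t ht => by
    have h1 := (hs t ht).1
    have : 1 ≤ (u t ^ 3)⁻¹ := (one_le_inv₀ (by positivity)).2 (pow_le_one₀ h1.le (hu1 t ht))
    linarith
  obtain ⟨v0, w0⟩ := tendsto_derivs_zero (fun t ht => (hs t ht).2.1) (fun t ht => (hs t ht).2.2.1)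
    (fun t ht => (hs t ht).2.2.2) hv hr hu1
  refine Tendsto.prodMk_nhds ?_ (v0.prodMk_nhds w0)
  rw [Metric.tendsto_nhds]
  intro e he
  obtain ⟨t, ht, hte⟩ : ∃ t, T ≤ t ∧ 1 - e < u t := by
    by_contra hcon
    push Not at hcon
    have he1 : 0 < 1 - e := (hs T le_rfl).1.trans_le (hcon T le_rfl)
    have hc : 0 < ((1 - e) ^ 3)⁻¹ - 1 := by
      have : 1 < ((1 - e) ^ 3)⁻¹ := (one_lt_inv₀ (by positivity)).2
        (pow_lt_one₀ he1.le (by linarith) (by norm_num))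
      linarith
    have := tendsto_atTop_of_le_deriv hc (fun t ht => (hs t ht).2.2.2) (fun t ht => by
      have h1 := (hs t ht).1
      have h2 := hcon t ht
      gcongr)
    obtain ⟨s, hs1, hs2⟩ := ((this.eventually_gt_atTop 1).and
      (w0.eventually (gt_mem_nhds one_pos))).exists
    linarith
  filter_upwards [eventually_ge_atTop t] with s hs'
  rw [Real.dist_eq, abs_lt]
  constructor <;> linarith [umono t s ht hs', hu1 s (ht.trans hs')]

theorem film_tendsto_of_deriv_neg (h : SolvesOn 1 (Ioi τ₀) u v w) {T : ℝ} (hT : τ₀ < T)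
    (hv : ∀ t, T ≤ t → v t < 0) :
    Tendsto (fun t => (u t, v t, w t)) atTop (𝓝 ((1 : ℝ), (0 : ℝ), (0 : ℝ))) := by
  have hs : ∀ t, T ≤ t → 0 < u t ∧ HasDerivAt u (v t) t ∧ HasDerivAt v (w t) t ∧
    HasDerivAt w ((u t ^ 3)⁻¹ - 1) t := fun t ht => h t (hT.trans_le ht)
  have uanti : ∀ s t, T ≤ s → s ≤ t → u t ≤ u s := fun s t hs' hst =>
    le_of_deriv_nonpos hst (fun y hy => (hs y (hs'.trans hy.1)).2.1)
      (fun y hy => (hv y (hs'.trans hy.1.le)).le)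
  have hu1 : ∀ t, T ≤ t → 1 ≤ u t := fun t ht => by
    by_contra hlt
    push Not at hlt
    have hut := (hs t ht).1
    have hc : 0 < (u t ^ 3)⁻¹ - 1 := by
      have : 1 < (u t ^ 3)⁻¹ := (one_lt_inv₀ (by positivity)).2
        (pow_lt_one₀ hut.le hlt (by norm_num))
      linarith
    have := tendsto_atTop_of_le_deriv_two (T := t) hc
      (fun s hs' => (hs s (ht.trans hs')).2.2.1) (fun s hs' => (hs s (ht.trans hs')).2.2.2)
      (fun s hs' => by
        have h1 := uanti t s ht hs'
        have h2 := (hs s (ht.trans hs')).1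
        gcongr)
    obtain ⟨s, hs1, hs2⟩ := ((this.eventually_gt_atTop 0).and (eventually_ge_atTop T)).exists
    linarith [hv s hs2]
  have hr : ∀ t, T ≤ t → 0 ≤ -((u t ^ 3)⁻¹ - 1) := fun t ht => by
    have : (u t ^ 3)⁻¹ ≤ 1 := inv_le_one_of_one_le₀ (one_le_pow₀ (hu1 t ht))
    linarith
  obtain ⟨v0, w0⟩ := tendsto_derivs_zero (x := fun t => -u t) (B := 0)
    (fun t ht => (hs t ht).2.1.neg) (fun t ht => (hs t ht).2.2.1.neg)
    (fun t ht => (hs t ht).2.2.2.neg) (fun t ht => neg_pos.2 (hv t ht)) hr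
    (fun t ht => by linarith [(hs t ht).1])
  have v0' : Tendsto v atTop (𝓝 0) := by simpa using v0.neg
  have w0' : Tendsto w atTop (𝓝 0) := by simpa using w0.neg
  refine Tendsto.prodMk_nhds ?_ (v0'.prodMk_nhds w0')
  rw [Metric.tendsto_nhds]
  intro e he
  obtain ⟨t, ht, hte⟩ : ∃ t, T ≤ t ∧ u t < 1 + e := by
    by_contra hcon
    push Not at hcon
    have hc : 0 < 1 - ((1 + e) ^ 3)⁻¹ := by
      have : ((1 + e) ^ 3)⁻¹ < 1 := inv_lt_one_of_one_lt₀ (one_lt_pow₀ (by linarith) (by norm_num))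
      linarith
    have := tendsto_atTop_of_le_deriv (f := fun t => -w t) hc (fun t ht => (hs t ht).2.2.2.neg)
      (fun t ht => by
      have h1 := (hs t ht).1
      have h2 := hcon t ht
      have : (u t ^ 3)⁻¹ ≤ ((1 + e) ^ 3)⁻¹ := by gcongr
      linarith)
    obtain ⟨s, hs1, hs2⟩ := ((this.eventually_gt_atTop 1).and
      (w0.eventually (gt_mem_nhds one_pos))).exists
    linarith
  filter_upwards [eventually_ge_atTop t] with s hs'
  rw [Real.dist_eq, abs_lt]
  constructor <;> linarith [uanti t s ht hs', hu1 s (ht.trans hs')]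

theorem film_exists_zero (h : SolvesOn 1 (Ioi τ₀) u v w)
    (hns : ¬ Tendsto (fun t => (u t, v t, w t)) atTop (𝓝 ((1 : ℝ), (0 : ℝ), (0 : ℝ)))) {T : ℝ}
    (hT : τ₀ < T) : ∃ t, T < t ∧ v t = 0 := by
  by_contra hcon
  push Not at hcon
  have hc : ∀ t, T < t → ContinuousOn v (Icc (T + 1) t) := fun t _ s hs =>
    (h s (by have := hs.1
             exact mem_Ioi.2 (by linarith))).2.2.1.continuousAt.continuousWithinAt
  have hne := hcon (T + 1) (by linarith)
  rcases lt_or_gt_of_ne hne with h0 | h0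
  · refine hns (film_tendsto_of_deriv_neg h (T := T + 1) (by linarith) fun t ht => ?_)
    by_contra hle
    push Not at hle
    obtain ⟨s, hs, hvs⟩ := intermediate_value_Icc ht (hc t (by linarith)) ⟨h0.le, hle⟩
    exact hcon s (by linarith [hs.1]) hvs
  · refine hns (film_tendsto_of_deriv_pos h (T := T + 1) (by linarith) fun t ht => ?_)
    by_contra hle
    push Not at hle
    obtain ⟨s, hs, hvs⟩ := intermediate_value_Icc' ht (hc t (by linarith)) ⟨hle, h0.le⟩
    exact hcon s (by linarith [hs.1]) hvs

theorem film_tendsto_of_equilibrium (h : SolvesOn 1 (Ioi τ₀) u v w) {t : ℝ} (ht : τ₀ < t)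
    (hu : u t = 1) (hv : v t = 0) (hw : w t = 0) :
    Tendsto (fun t => (u t, v t, w t)) atTop (𝓝 ((1 : ℝ), (0 : ℝ), (0 : ℝ))) := by
  have hconst : ∀ T, SolvesOn 1 (Icc 0 T) (fun _ => 1) (fun _ => 0) (fun _ => 0) := fun T s _ =>
    ⟨one_pos, hasDerivAt_const s 1, hasDerivAt_const s 0, by simpa using hasDerivAt_const s (0:ℝ)⟩
  refine Tendsto.congr' ?_ tendsto_const_nhds
  filter_upwards [eventually_ge_atTop t] with s hs
  have := SolvesOn.stability (T := s - t) (η := 0) (δ := 1 / 2) (by norm_num) (hconst (s - t))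
    (h.comp_add (J := Icc 0 (s - t)) t (fun y hy => by
      have := hy.1
      exact mem_Ioi.2 (by linarith))) (fun _ _ => by norm_num) (by simp [hu]) (by simp [hv])
    (by simp [hw]) (by simp) (by norm_num) (s - t) ⟨by linarith, le_rfl⟩
  simp only [mul_zero, zero_mul, sub_add_cancel, zero_sub, abs_neg, abs_nonpos_iff] at this
  obtain ⟨h1, h2, h3⟩ := this
  rw [h2, h3, ← sub_eq_zero.1 h1]

/-- If w and u - 1 did not have opposite strict signs at t, then by `deriv_pos_of_backward`, applied
to u - 1 or to its negative, v would keep a strict sign at all earlier times, against the zero t₀.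
The remaining case is the equilibrium itself. -/
theorem film_zero_nondegenerate (h : SolvesOn 1 (Ioi τ₀) u v w)
    (hns : ¬ Tendsto (fun t => (u t, v t, w t)) atTop (𝓝 ((1 : ℝ), (0 : ℝ), (0 : ℝ))))
    {t₀ t : ℝ} (ht₀ : τ₀ < t₀) (ht : t₀ < t) (hv₀ : v t₀ = 0) (hv : v t = 0) :
    (0 < w t ∧ u t < 1) ∨ (w t < 0 ∧ 1 < u t) := by
  have hs : ∀ s ∈ Icc t₀ t, 0 < u s ∧ HasDerivAt u (v s) s ∧ HasDerivAt v (w s) s ∧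
    HasDerivAt w ((u s ^ 3)⁻¹ - 1) s := fun s hs => h s (ht₀.trans_le hs.1)
  have hA : u t ≤ 1 → w t ≤ 0 → (u t < 1 ∨ w t < 0) → False := by
    intro h1 h2 h3
    have := deriv_pos_of_backward (x := fun s => u s - 1)
      (fun s hs' => (hs s hs').2.1.sub_const 1)
      (fun s hs' => (hs s hs').2.2.1) (fun s hs' => (hs s hs').2.2.2) (fun s hs' hx => by
        have hus := (hs s hs').1
        have : 1 < (u s ^ 3)⁻¹ := (one_lt_inv₀ (by positivity)).2
          (pow_lt_one₀ hus.le (by linarith) (by norm_num))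
        linarith) hv (by linarith) h2 (h3.imp (fun h => by linarith) id) t₀ ⟨le_rfl, ht⟩
    linarith
  have hB : 1 ≤ u t → 0 ≤ w t → (1 < u t ∨ 0 < w t) → False := by
    intro h1 h2 h3
    have := deriv_pos_of_backward (x := fun s => -(u s - 1)) (v := fun s => -v s)
      (w := fun s => -w s) (r := fun s => -((u s ^ 3)⁻¹ - 1))
      (fun s hs' => ((hs s hs').2.1.sub_const 1).neg)
      (fun s hs' => (hs s hs').2.2.1.neg) (fun s hs' => (hs s hs').2.2.2.neg) (fun s hs' hx => by
        have : (u s ^ 3)⁻¹ < 1 := inv_lt_one_of_one_lt₀ (one_lt_pow₀ (by linarith) (by norm_num))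
        linarith) (by simp [hv]) (by linarith) (by linarith)
        (h3.imp (fun h => by linarith) (fun h => by linarith)) t₀ ⟨le_rfl, ht⟩
    linarith
  rcases lt_trichotomy (u t) 1 with hu | hu | hu
  · left
    refine ⟨?_, hu⟩
    by_contra hle
    push Not at hle
    exact hA hu.le hle (Or.inl hu)
  · exfalso
    rcases lt_trichotomy (w t) 0 with hw | hw | hw
    · exact hA hu.le hw.le (Or.inr hw)
    · exact hns (film_tendsto_of_equilibrium h (ht₀.trans ht) hu hv hw)
    · exact hB hu.ge hw.le (Or.inr hw)
  · right
    refine ⟨?_, hu⟩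
    by_contra hle
    push Not at hle
    exact hB hu.le hle (Or.inl hu)

/-- Consecutive local maxima `τp n` and minima `τm n` of an oscillating film solution. -/
structure FilmOscillation (τ₀ : ℝ) (u v w : ℝ → ℝ) (τp τm : ℕ → ℝ) : Prop where
  lower : ∀ n, τ₀ < τp n
  lt_min : ∀ n, τp n < τm n
  lt_max : ∀ n, τm n < τp (n + 1)
  deriv_max : ∀ n, v (τp n) = 0
  deriv_min : ∀ n, v (τm n) = 0
  second_max : ∀ n, w (τp n) < 0
  second_min : ∀ n, 0 < w (τm n)
  max_gt : ∀ n, 1 < u (τp n)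
  min_lt : ∀ n, u (τm n) < 1
  decreasing : ∀ n, ∀ t ∈ Ioo (τp n) (τm n), v t < 0
  increasing : ∀ n, ∀ t ∈ Ioo (τm n) (τp (n + 1)), 0 < v t
  tendsto : Tendsto τp atTop atTop

/-- Beyond one zero of v all zeros are nondegenerate, so the next zero after a maximum is a minimum
and conversely. The maxima cannot accumulate: at a finite limit v would vanish and w would be both
nonpositive and nonnegative. -/
theorem exists_filmOscillation (h : SolvesOn 1 (Ioi τ₀) u v w)
    (hns : ¬ Tendsto (fun t => (u t, v t, w t)) atTop (𝓝 ((1 : ℝ), (0 : ℝ), (0 : ℝ)))) :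
    ∃ τp τm, FilmOscillation τ₀ u v w τp τm := by
  obtain ⟨t₀, ht₀, hv₀⟩ := film_exists_zero h hns (T := τ₀ + 1) (by linarith)
  have hτt₀ : τ₀ < t₀ := by linarith
  have hdv : ∀ t, t₀ < t → ∀ s, t ≤ s → HasDerivAt v (w s) s := fun t ht s hs =>
    (h s (hτt₀.trans (ht.trans_le hs))).2.2.1
  have hup : ∀ t, t₀ < t → v t = 0 → 0 < w t → ∃ b, t < b ∧ v b = 0 ∧
      (∀ s ∈ Ioo t b, 0 < v s) ∧ w b < 0 ∧ 1 < u b := by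
    intro t ht hvt hwt
    obtain ⟨b, htb, hvb, hpos, hwb⟩ := exists_next_zero (hdv t ht) hvt hwt
      (film_exists_zero h hns (hτt₀.trans ht))
    rcases film_zero_nondegenerate h hns hτt₀ (ht.trans htb) hv₀ hvb with hc | hc
    · linarith [hc.1]
    · exact ⟨b, htb, hvb, hpos, hc⟩
  have hdown : ∀ t, t₀ < t → v t = 0 → w t < 0 → ∃ a, t < a ∧ v a = 0 ∧
      (∀ s ∈ Ioo t a, v s < 0) ∧ 0 < w a ∧ u a < 1 := by
    intro t ht hvt hwt
    obtain ⟨z, hz, hvz⟩ := film_exists_zero h hns (hτt₀.trans ht)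
    obtain ⟨a, hta, hva, hpos, hwa⟩ := exists_next_zero (f := fun s => -v s) (f' := fun s => -w s)
      (fun s hs => (hdv t ht s hs).neg) (by simp [hvt]) (by linarith) ⟨z, hz, by simp [hvz]⟩
    have hva' : v a = 0 := by simpa using hva
    rcases film_zero_nondegenerate h hns hτt₀ (ht.trans hta) hv₀ hva' with hc | hc
    · exact ⟨a, hta, hva', fun s hs => by linarith [hpos s hs], hc⟩
    · linarith [hc.1]
  obtain ⟨t₁, ht₁, hv₁, hw₁, hu₁⟩ : ∃ t, t₀ < t ∧ v t = 0 ∧ w t < 0 ∧ 1 < u t := by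
    obtain ⟨z, hz, hvz⟩ := film_exists_zero h hns hτt₀
    rcases film_zero_nondegenerate h hns hτt₀ hz hv₀ hvz with hc | hc
    · obtain ⟨b, hzb, hvb, _, hwb, hub⟩ := hup z hz hvz hc.1
      exact ⟨b, hz.trans hzb, hvb, hwb, hub⟩
    · exact ⟨z, hz, hvz, hc⟩
  have hstep : ∀ t : {t // t₀ < t ∧ v t = 0 ∧ w t < 0 ∧ 1 < u t},
      ∃ (a : ℝ) (b : {t // t₀ < t ∧ v t = 0 ∧ w t < 0 ∧ 1 < u t}), t.1 < a ∧ a < b.1 ∧ v a = 0 ∧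
        0 < w a ∧ u a < 1 ∧ (∀ s ∈ Ioo t.1 a, v s < 0) ∧ ∀ s ∈ Ioo a b.1, 0 < v s := by
    rintro ⟨t, ht, hvt, hwt, hut⟩
    obtain ⟨a, hta, hva, hneg, hwa, hua⟩ := hdown t ht hvt hwt
    obtain ⟨b, hab, hvb, hpos, hwb, hub⟩ := hup a (ht.trans hta) hva hwa
    exact ⟨a, ⟨b, ht.trans (hta.trans hab), hvb, hwb, hub⟩, hta, hab, hva, hwa, hua, hneg, hpos⟩
  choose A F hAF using hstep
  set X : ℕ → {t // t₀ < t ∧ v t = 0 ∧ w t < 0 ∧ 1 < u t} :=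
    fun n => F^[n] ⟨t₁, ht₁, hv₁, hw₁, hu₁⟩ with hX
  have hXs : ∀ n, X (n + 1) = F (X n) := fun n => Function.iterate_succ_apply' F n _
  have hlt1 : ∀ n, (X n).1 < A (X n) := fun n => (hAF (X n)).1
  have hlt2 : ∀ n, A (X n) < (X (n + 1)).1 := fun n => by rw [hXs]; exact (hAF (X n)).2.1
  refine ⟨fun n => (X n).1, fun n => A (X n), fun n => hτt₀.trans (X n).2.1, hlt1, hlt2,
    fun n => (X n).2.2.1, fun n => (hAF (X n)).2.2.1, fun n => (X n).2.2.2.1,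
    fun n => (hAF (X n)).2.2.2.1, fun n => (X n).2.2.2.2, fun n => (hAF (X n)).2.2.2.2.1,
    fun n => (hAF (X n)).2.2.2.2.2.1, fun n => by
      rw [hXs]; exact (hAF (X n)).2.2.2.2.2.2, ?_⟩
  have hmono : StrictMono fun n => (X n).1 := strictMono_nat_of_lt_succ fun n =>
    (hlt1 n).trans (hlt2 n)
  rcases tendsto_atTop_of_monotone hmono.monotone with hl | ⟨l, hl⟩
  · exact hl
  · exfalso
    have hge : ∀ n, (X n).1 ≤ l := fun n => hmono.monotone.ge_of_tendsto hl n
    have htl : t₀ < l := (X 0).2.1.trans_le (hge 0)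
    have hlA : Tendsto (fun n => A (X n)) atTop (𝓝 l) :=
      tendsto_of_tendsto_of_tendsto_of_le_of_le hl (hl.comp (tendsto_add_atTop_nat 1))
        (fun n => (hlt1 n).le) (fun n => (hlt2 n).le)
    obtain ⟨_, _, hvl, hwl⟩ := h l (hτt₀.trans htl)
    have e1 : v l = 0 := by
      have := hvl.continuousAt.tendsto.comp hl
      refine tendsto_nhds_unique this (tendsto_const_nhds.congr fun n => ?_)
      exact ((X n).2.2.1).symm
    have e2 : w l ≤ 0 := le_of_tendsto (hwl.continuousAt.tendsto.comp hl)
      (Eventually.of_forall fun n => (X n).2.2.2.1.le)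
    have e3 : 0 ≤ w l := ge_of_tendsto (hwl.continuousAt.tendsto.comp hlA)
      (Eventually.of_forall fun n => (hAF (X n)).2.2.2.1.le)
    rcases film_zero_nondegenerate h hns hτt₀ htl hv₀ e1 with hc | hc
    · linarith [hc.1]
    · linarith [hc.1]

end Film

/-! ### Energy and unbounded growth -/

section Energy

variable {τ₀ : ℝ} {u v w : ℝ → ℝ} {τp τm : ℕ → ℝ}

theorem film_energy_deriv (h : SolvesOn 1 (Ioi τ₀) u v w) {t : ℝ} (ht : τ₀ < t) :
    HasDerivAt (fun t => w t * v t + u t + 1 / 2 * (u t ^ 2)⁻¹) (w t ^ 2) t := by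
  obtain ⟨h0, h1, h2, h3⟩ := h t ht
  exact (((h3.mul h2).add h1).add ((hasDerivAt_inv_sq_comp h1 h0).const_mul (1 / 2))).congr_deriv
    (by ring)

theorem film_energy_mono (h : SolvesOn 1 (Ioi τ₀) u v w) {s t : ℝ} (hs : τ₀ < s) (hst : s ≤ t) :
    w s * v s + u s + 1 / 2 * (u s ^ 2)⁻¹ ≤ w t * v t + u t + 1 / 2 * (u t ^ 2)⁻¹ :=
  le_of_deriv_nonneg hst (fun _ hy => film_energy_deriv h (hs.trans_le hy.1))
    (fun _ _ => sq_nonneg _)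

theorem potential_lt {a b : ℝ} (ha : 1 ≤ a) (hab : a < b) :
    a + 1 / 2 * (a ^ 2)⁻¹ < b + 1 / 2 * (b ^ 2)⁻¹ := by
  have h := lt_of_deriv_pos (f := fun y => y + 1 / 2 * (y ^ 2)⁻¹)
    (f' := fun y => 1 + 1 / 2 * (-2 * 1 * (y ^ 3)⁻¹)) hab
    (fun y hy => (hasDerivAt_id' y).fun_add
      ((hasDerivAt_inv_sq_comp (hasDerivAt_id' y) (by linarith [hy.1])).const_mul (1 / 2)))
    (fun y hy => by
      have : (y ^ 3)⁻¹ < 1 :=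
        inv_lt_one_of_one_lt₀ (one_lt_pow₀ (ha.trans_lt hy.1) (by norm_num))
      linarith)
  exact h

namespace FilmOscillation

theorem strictMono_max (o : FilmOscillation τ₀ u v w τp τm) : StrictMono τp :=
  strictMono_nat_of_lt_succ fun n => (o.lt_min n).trans (o.lt_max n)

theorem strictMono_min (o : FilmOscillation τ₀ u v w τp τm) : StrictMono τm :=
  strictMono_nat_of_lt_succ fun n => (o.lt_max n).trans (o.lt_min (n + 1))

theorem max_height_mono (o : FilmOscillation τ₀ u v w τp τm) (h : SolvesOn 1 (Ioi τ₀) u v w) :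
    Monotone fun n => u (τp n) := by
  apply monotone_nat_of_le_succ
  intro n
  by_contra hlt
  push Not at hlt
  have h1 := potential_lt (o.max_gt (n + 1)).le hlt
  have h2 := film_energy_mono h (o.lower n) ((o.lt_min n).trans (o.lt_max n)).le
  rw [o.deriv_max, o.deriv_max] at h2
  linarith

theorem exists_index (o : FilmOscillation τ₀ u v w τp τm) {t : ℝ} (ht : τp 0 ≤ t) :
    ∃ n, τp n ≤ t ∧ t < τp (n + 1) := by
  classical
  have hex : ∃ n, t < τp n := (o.tendsto.eventually_gt_atTop t).exists
  have hspec := Nat.find_spec hex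
  have hne : Nat.find hex ≠ 0 := fun h0 => by
    rw [h0] at hspec
    linarith
  obtain ⟨n, hn⟩ := Nat.exists_eq_succ_of_ne_zero hne
  refine ⟨n, ?_, by rw [hn] at hspec; exact hspec⟩
  have := Nat.find_min hex (m := n) (by omega)
  exact not_lt.1 this

theorem height_le (o : FilmOscillation τ₀ u v w τp τm) (h : SolvesOn 1 (Ioi τ₀) u v w) (n : ℕ)
    {t : ℝ} (ht : τp n ≤ t) (ht' : t ≤ τp (n + 1)) :
    u (τm n) ≤ u t ∧ u t ≤ u (τp (n + 1)) := by
  have hd : ∀ s, τp n ≤ s → HasDerivAt u (v s) s := fun s hs =>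
    (h s ((o.lower n).trans_le hs)).2.1
  rcases le_total t (τm n) with hle | hle
  · constructor
    · exact le_of_deriv_nonpos hle (fun y hy => hd y (ht.trans hy.1))
        (fun y hy => (o.decreasing n y ⟨ht.trans_lt hy.1, hy.2⟩).le)
    · exact (le_of_deriv_nonpos ht (fun y hy => hd y hy.1)
        (fun y hy => (o.decreasing n y ⟨hy.1, hy.2.trans_le hle⟩).le)).trans
        (o.max_height_mono h n.le_succ)
  · constructor
    · exact le_of_deriv_nonneg hle (fun y hy => hd y ((o.lt_min n).le.trans hy.1))
        (fun y hy => (o.increasing n y ⟨hy.1, hy.2.trans_le ht'⟩).le)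
    · exact le_of_deriv_nonneg ht' (fun y hy => hd y (ht.trans hy.1))
        (fun y hy => (o.increasing n y ⟨hle.trans_lt hy.1, hy.2⟩).le)

/-- If the maxima were bounded, the energy would be bounded, u bounded above and away from zero, and
u'' → 0 with u' bounded. At a late crossing of height 1 the energy would be nearly 3/2, the minimum
of the potential, although it never falls below its larger value at the first maximum. -/
theorem tendsto_max_height (o : FilmOscillation τ₀ u v w τp τm)
    (h : SolvesOn 1 (Ioi τ₀) u v w) : Tendsto (fun n => u (τp n)) atTop atTop := by
  rcases tendsto_atTop_of_monotone (o.max_height_mono h) with hl | ⟨B, hl⟩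
  · exact hl
  exfalso
  have hLB : ∀ n, u (τp n) ≤ B := fun n => (o.max_height_mono h).ge_of_tendsto hl n
  have hB1 : 1 < B := (o.max_gt 0).trans_le (hLB 0)
  set E : ℝ → ℝ := fun t => w t * v t + u t + 1 / 2 * (u t ^ 2)⁻¹ with hE
  have hEmono : ∀ s t, τ₀ < s → s ≤ t → E s ≤ E t := fun s t hs hst => film_energy_mono h hs hst
  have hEmax : ∀ n, E (τp n) = u (τp n) + 1 / 2 * (u (τp n) ^ 2)⁻¹ := fun n => by
    simp only [hE, o.deriv_max, mul_zero, zero_add]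
  have hEmin : ∀ n, E (τm n) = u (τm n) + 1 / 2 * (u (τm n) ^ 2)⁻¹ := fun n => by
    simp only [hE, o.deriv_min, mul_zero, zero_add]
  have hEmaxle : ∀ n, E (τp n) ≤ B + 1 / 2 := fun n => by
    have : (u (τp n) ^ 2)⁻¹ ≤ 1 := inv_le_one_of_one_le₀ (one_le_pow₀ (o.max_gt n).le)
    rw [hEmax]
    linarith [hLB n]
  have hτ : ∀ t, τp 0 ≤ t → τ₀ < t := fun t ht => (o.lower 0).trans_le ht
  have hEle : ∀ t, τp 0 ≤ t → E t ≤ B + 1 / 2 := fun t ht => by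
    obtain ⟨n, _, hn⟩ := o.exists_index ht
    exact (hEmono t _ (hτ t ht) hn.le).trans (hEmaxle _)
  -- At a minimum the energy bound reads u⁻² ≤ 2B + 1; as u < 1 there, u ≥ u² ≥ μ.
  set μ := 1 / (2 * B + 1) with hμ
  have hμ0 : 0 < μ := by positivity
  have hlow : ∀ t, τp 0 ≤ t → μ ≤ u t := fun t ht => by
    obtain ⟨n, hn1, hn2⟩ := o.exists_index ht
    refine le_trans ?_ (o.height_le h n hn1 hn2.le).1
    have hpos := (h (τm n) ((o.lower n).trans (o.lt_min n))).1
    have h1 := (hEmono (τm n) _ ((o.lower n).trans (o.lt_min n)) (o.lt_max n).le).trans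
      (hEmaxle (n + 1))
    rw [hEmin] at h1
    have h2 : (u (τm n) ^ 2)⁻¹ ≤ 2 * B + 1 := by linarith
    have h3 : 1 ≤ (2 * B + 1) * u (τm n) ^ 2 := by
      rwa [inv_le_iff_one_le_mul₀ (by positivity)] at h2
    rw [hμ, div_le_iff₀ (by linarith)]
    have := o.min_lt n
    nlinarith
  have hup : ∀ t, τp 0 ≤ t → u t ≤ B := fun t ht => by
    obtain ⟨n, hn1, hn2⟩ := o.exists_index ht
    exact (o.height_le h n hn1 hn2.le).2.trans (hLB _)
  set C := (μ ^ 3)⁻¹ + 1 with hC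
  have hC0 : 0 < C := by positivity
  have hrC : ∀ t, τp 0 ≤ t → |(u t ^ 3)⁻¹ - 1| ≤ C := fun t ht => by
    have hpos := (h t (hτ t ht)).1
    have h1 : (u t ^ 3)⁻¹ ≤ (μ ^ 3)⁻¹ := by
      have := hlow t ht
      gcongr
    have h2 : 0 < (u t ^ 3)⁻¹ := by positivity
    rw [abs_le]
    constructor <;> linarith
  -- the second derivative tends to zero
  have hw0 : ∀ e, 0 < e → ∃ T, τp 0 ≤ T ∧ ∀ t, T ≤ t → |w t| ≤ e := by
    intro e he
    -- Since |w'| ≤ C, a value |w| > e keeps |w| ≥ e/2 during time d, and the energy gains at least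
    -- d(e/2)². Close to its supremum this is impossible.
    set d := e / (2 * C) with hd
    have hd0 : 0 < d := by positivity
    have hgain : 0 < d * (e / 2) ^ 2 := by positivity
    have hne : (E '' Ici (τp 0)).Nonempty := ⟨_, mem_image_of_mem _ self_mem_Ici⟩
    have hbd : BddAbove (E '' Ici (τp 0)) := ⟨B + 1 / 2, by
      rintro _ ⟨t, ht, rfl⟩
      exact hEle t ht⟩
    obtain ⟨_, ⟨T, hT, rfl⟩, hTlt⟩ := exists_lt_of_lt_csSup hne
      (show sSup (E '' Ici (τp 0)) - d * (e / 2) ^ 2 < sSup (E '' Ici (τp 0)) by linarith)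
    have hT' : τp 0 ≤ T := hT
    refine ⟨T, hT', fun t ht => ?_⟩
    by_contra hgt
    push Not at hgt
    have htp : τp 0 ≤ t := hT'.trans ht
    have hwbig : ∀ s ∈ Icc t (t + d), e / 2 ≤ |w s| := fun s hs => by
      have h1 := abs_sub_le_sub_of_abs_deriv_le hs.1
        (fun y hy => (h y (hτ y (htp.trans hy.1))).2.2.2)
        (fun y _ => hasDerivAt_affine 0 C 0 y) (fun y hy => hrC y (htp.trans hy.1.le))
      have h2 : C * (s - t) ≤ e / 2 := by
        have h3 : C * (s - t) ≤ C * d := by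
          have := hs.2
          gcongr
          linarith
        have h4 : C * d = e / 2 := by rw [hd]; field_simp
        linarith
      have h5 : |w t| ≤ |w s| + |w s - w t| := by
        have := abs_sub_abs_le_abs_sub (w t) (w s)
        rw [abs_sub_comm] at this
        linarith
      linarith
    have h6 := sub_le_sub_of_deriv_le (a := t) (b := t + d) (by linarith)
      (fun y _ => hasDerivAt_affine 0 ((e / 2) ^ 2) 0 y)
      (fun y hy => film_energy_deriv h (hτ y (htp.trans hy.1)))
      (fun y hy => by
        rw [← sq_abs (w y)]
        have := hwbig y (Ioo_subset_Icc_self hy)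
        gcongr)
    have h7 : E (t + d) ≤ sSup (E '' Ici (τp 0)) :=
      le_csSup hbd (mem_image_of_mem _ (mem_Ici.2 (by linarith)))
    have h8 := hEmono T t (hτ T hT') ht
    simp only [hE] at h7 h8 hTlt
    linarith
  have hg : 0 < E (τp 0) - 3 / 2 := by
    have := potential_lt le_rfl (o.max_gt 0)
    rw [hEmax]
    norm_num at this
    norm_num
    linarith
  set g := E (τp 0) - 3 / 2 with hgdef
  set e := min 1 (g / (2 * (B + 1))) with he
  have he0 : 0 < e := by positivity
  have he1 : e ≤ 1 := min_le_left _ _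
  have he2 : e * (B + 1) < g := by
    have h1 : e ≤ g / (2 * (B + 1)) := min_le_right _ _
    rw [le_div_iff₀ (by positivity)] at h1
    nlinarith
  obtain ⟨T, hT, hwT⟩ := hw0 e he0
  -- Over a unit of time v changes by at most e ≤ 1 while u changes by at most B.
  have hvT : ∀ t, T ≤ t → |v t| ≤ B + 1 := fun t ht => by
    have htp : τp 0 ≤ t := hT.trans ht
    have hvs : ∀ s ∈ Icc t (t + 1), |v s - v t| ≤ e := fun s hs => by
      have h1 := abs_sub_le_sub_of_abs_deriv_le hs.1
        (fun y hy => (h y (hτ y (htp.trans hy.1))).2.2.1)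
        (fun y _ => hasDerivAt_affine 0 e 0 y) (fun y hy => hwT y (ht.trans hy.1.le))
      have := hs.2
      nlinarith
    have h2 := sub_le_sub_of_deriv_le (a := t) (b := t + 1) (by linarith)
      (fun y _ => hasDerivAt_affine 0 (v t - e) 0 y)
      (fun y hy => (h y (hτ y (htp.trans hy.1))).2.1)
      (fun y hy => by linarith [(abs_le.1 (hvs y (Ioo_subset_Icc_self hy))).1])
    have h3 := sub_le_sub_of_deriv_le (a := t) (b := t + 1) (by linarith)
      (fun y hy => (h y (hτ y (htp.trans hy.1))).2.1)
      (fun y _ => hasDerivAt_affine 0 (v t + e) 0 y)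
      (fun y hy => by linarith [(abs_le.1 (hvs y (Ioo_subset_Icc_self hy))).2])
    have h4 := hup t htp
    have h5 := hup (t + 1) (by linarith)
    have h6 := (h t (hτ t htp)).1
    have h7 := (h (t + 1) (hτ _ (by linarith))).1
    rw [abs_le]
    constructor <;> linarith
  obtain ⟨n, hn⟩ := (o.tendsto.eventually_ge_atTop T).exists
  obtain ⟨s, hs, hs1⟩ := intermediate_value_Icc' (o.lt_min n).le
    (fun y hy => (h y ((o.lower n).trans_le hy.1)).2.1.continuousAt.continuousWithinAt :
      ContinuousOn u (Icc (τp n) (τm n))) ⟨(o.min_lt n).le, (o.max_gt n).le⟩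
  have hTs : T ≤ s := hn.trans hs.1
  have h1 := hEmono (τp 0) s (o.lower 0) (hT.trans hTs)
  have h2 : w s * v s ≤ e * (B + 1) := by
    refine (le_abs_self _).trans ?_
    rw [abs_mul]
    have h3 := hwT s hTs
    have h4 := hvT s hTs
    gcongr
  simp only [hE, hs1] at h1
  norm_num at h1
  have h3 : E (τp 0) = w (τp 0) * v (τp 0) + u (τp 0) + 1 / 2 * (u (τp 0) ^ 2)⁻¹ := rfl
  rw [hgdef, h3] at he2
  linarith

end FilmOscillation

end Energy

/-! ### The fall from a maximum to height one -/

section Fall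

variable {u v w : ℝ → ℝ} {L B s : ℝ}

/-- The estimates for the fall from a maximum of height `L` with second derivative `-B` to the
height one, during the time `s`, with final slope `-V` and final second derivative `-W`. -/
structure FallBounds (L B s V W : ℝ) : Prop where
  pos : 0 < s
  le_height : L - 1 ≤ B * s ^ 2 / 2 + s ^ 3 / 6
  height_le : B * s ^ 2 / 2 + s ^ 3 / 6 ≤ L - 1 + s ^ 3 / (4 * (L - 1))
  le_slope : B * s + s ^ 2 / 2 - s ^ 2 / (2 * (L - 1)) ≤ V
  slope_le : V ≤ B * s + s ^ 2 / 2
  second_pos : 0 < W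
  second_le : W ≤ B + s

theorem chord_le_of_antitone_slope (hs : 0 < s) (hu : ∀ t ∈ Icc 0 s, HasDerivAt u (v t) t)
    (hv : AntitoneOn v (Icc 0 s)) {t : ℝ} (ht : t ∈ Icc 0 s) :
    u 0 + (u s - u 0) / s * t ≤ u t := by
  rcases le_total ((u s - u 0) / s) (v t) with hle | hle
  · have := sub_le_sub_of_deriv_le ht.1
      (fun y _ => hasDerivAt_affine 0 ((u s - u 0) / s) 0 y)
      (fun y hy => hu y ⟨hy.1, hy.2.trans ht.2⟩)
      (fun y hy => hle.trans (hv ⟨hy.1.le, hy.2.le.trans ht.2⟩ ht hy.2.le))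
    linarith
  · have := sub_le_sub_of_deriv_le ht.2
      (fun y hy => hu y ⟨ht.1.trans hy.1, hy.2⟩)
      (fun y _ => hasDerivAt_affine 0 ((u s - u 0) / s) 0 y)
      (fun y hy => (hv ht ⟨ht.1.trans hy.1.le, hy.2.le⟩ hy.1.le).trans hle)
    have h2 : (u s - u 0) / s * s = u s - u 0 := by field_simp
    linarith

theorem SolvesOn.fallBounds (h : SolvesOn 1 (Icc 0 s) u v w) (hs : 0 < s) (hL : 1 < L) (hB : 0 < B)
    (hu0 : u 0 = L) (hv0 : v 0 = 0) (hw0 : w 0 = -B) (hu : ∀ t ∈ Icc 0 s, 1 ≤ u t)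
    (hus : u s = 1) : FallBounds L B s (-v s) (-w s) := by
  have hdw : ∀ t ∈ Icc 0 s, HasDerivAt w ((u t ^ 3)⁻¹ - 1) t := fun t ht => (h t ht).2.2.2
  have hdv : ∀ t ∈ Icc 0 s, HasDerivAt v (w t) t := fun t ht => (h t ht).2.2.1
  have hdu : ∀ t ∈ Icc 0 s, HasDerivAt u (v t) t := fun t ht => (h t ht).2.1
  have hsub : ∀ t ∈ Icc 0 s, ∀ y ∈ Icc 0 t, y ∈ Icc 0 s := fun t ht y hy => ⟨hy.1, hy.2.trans ht.2⟩
  have hwB : ∀ t ∈ Icc 0 s, w t ≤ -B := fun t ht => by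
    rw [← hw0]
    refine le_of_deriv_nonpos ht.1 (fun y hy => hdw y (hsub t ht y hy)) (fun y hy => ?_)
    have : (u y ^ 3)⁻¹ ≤ 1 :=
      inv_le_one_of_one_le₀ (one_le_pow₀ (hu y (hsub t ht y (Ioo_subset_Icc_self hy))))
    linarith
  have hvanti : AntitoneOn v (Icc 0 s) := fun x hx y hy hxy =>
    le_of_deriv_nonpos hxy (fun z hz => hdv z ⟨hx.1.trans hz.1, hz.2.trans hy.2⟩)
      (fun z hz => (hwB z ⟨hx.1.trans hz.1.le, hz.2.le.trans hy.2⟩).trans (by linarith))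
  have hL1 : 0 < L - 1 := by linarith
  have hch : ∀ t ∈ Icc 0 s, L + (-(L - 1) / s) * t ≤ u t := fun t ht => by
    have := chord_le_of_antitone_slope hs hdu hvanti ht
    rw [hus, hu0] at this
    rwa [show -(L - 1) = 1 - L by ring]
  have hpos : ∀ t ∈ Icc 0 s, 1 ≤ L + (-(L - 1) / s) * t := fun t ht => by
    have : (L - 1) / s * t ≤ L - 1 := by
      rw [div_mul_eq_mul_div, div_le_iff₀ hs]
      exact mul_le_mul_of_nonneg_left ht.2 hL1.le
    rw [neg_div]
    linarith
  -- lower bounds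
  have hwl : ∀ t ∈ Icc 0 s, -B - t ≤ w t := fun t ht => by
    have := sub_le_sub_of_deriv_le ht.1 (fun y _ => hasDerivAt_affine 0 (-1) 0 y)
      (fun y hy => hdw y (hsub t ht y hy)) (fun y hy => by
        have := (h y (hsub t ht y (Ioo_subset_Icc_self hy))).1
        have : 0 < (u y ^ 3)⁻¹ := by positivity
        linarith)
    rw [hw0] at this
    linarith
  have hvl : ∀ t ∈ Icc 0 s, -B * t - t ^ 2 / 2 ≤ v t := fun t ht => by
    have := sub_le_sub_of_deriv_le ht.1 (fun y _ => hasDerivAt_quadratic 0 (-B) (-1) 0 y)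
      (fun y hy => hdv y (hsub t ht y hy)) (fun y hy => by
        have := hwl y (hsub t ht y (Ioo_subset_Icc_self hy))
        linarith)
    rw [hv0] at this
    linarith
  have hul := sub_le_sub_of_deriv_le hs.le (fun y _ => hasDerivAt_cubic 0 0 (-B) (-1) 0 y)
    hdu (fun y hy => by
      have := hvl y (Ioo_subset_Icc_self hy)
      linarith)
  -- upper bounds
  set ρ := s / (2 * (L - 1)) with hρ
  have hρ0 : 0 < ρ := by positivity
  have hwu : ∀ t ∈ Icc 0 s, w t ≤ -B - t + ρ := fun t ht => by
    have hd : ∀ y ∈ Icc 0 t, HasDerivAt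
        (fun y => ρ * ((L + (-(L - 1) / s) * (y - 0)) ^ 2)⁻¹ + (0 + -1 * (y - 0)))
        (ρ * (-2 * (-(L - 1) / s) * ((L + (-(L - 1) / s) * (y - 0)) ^ 3)⁻¹) + -1) y :=
      fun y hy => by
        have hy' := hpos y (hsub t ht y hy)
        exact ((hasDerivAt_inv_sq_comp (hasDerivAt_affine L (-(L - 1) / s) 0 y)
          (by rw [sub_zero]; linarith)).const_mul ρ).fun_add (hasDerivAt_affine 0 (-1) 0 y)
    have := sub_le_sub_of_deriv_le ht.1 (fun y hy => hdw y (hsub t ht y hy)) hd (fun y hy => by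
      have hy' := hsub t ht y (Ioo_subset_Icc_self hy)
      have h1 := hpos y hy'
      have h2 : (u y ^ 3)⁻¹ ≤ ((L + (-(L - 1) / s) * y) ^ 3)⁻¹ := by
        have := hch y hy'
        gcongr
      have h3 : ρ * (-2 * (-(L - 1) / s)) = 1 := by rw [hρ]; field_simp
      rw [sub_zero, ← mul_assoc, h3]
      linarith)
    have h1 : ((L + (-(L - 1) / s) * (t - 0)) ^ 2)⁻¹ ≤ 1 := by
      rw [sub_zero]
      exact inv_le_one_of_one_le₀ (one_le_pow₀ (hpos t ht))
    have h2 : 0 ≤ ((L + (-(L - 1) / s) * ((0:ℝ) - 0)) ^ 2)⁻¹ := by positivity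
    rw [hw0] at this
    nlinarith
  have hvu : ∀ t ∈ Icc 0 s, v t ≤ (-B + ρ) * t - t ^ 2 / 2 := fun t ht => by
    have := sub_le_sub_of_deriv_le ht.1 (fun y hy => hdv y (hsub t ht y hy))
      (fun y _ => hasDerivAt_quadratic 0 (-B + ρ) (-1) 0 y)
      (fun y hy => by
        have := hwu y (hsub t ht y (Ioo_subset_Icc_self hy))
        linarith)
    rw [hv0] at this
    linarith
  have huu := sub_le_sub_of_deriv_le hs.le hdu
    (fun y _ => hasDerivAt_cubic 0 0 (-B + ρ) (-1) 0 y) (fun y hy => by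
      have := hvu y (Ioo_subset_Icc_self hy)
      linarith)
  have hsm : s ∈ Icc 0 s := ⟨hs.le, le_rfl⟩
  rw [hus, hu0] at hul huu
  have e1 : s ^ 3 / (4 * (L - 1)) = ρ * s ^ 2 / 2 := by rw [hρ]; field_simp; ring
  have e2 : s ^ 2 / (2 * (L - 1)) = ρ * s := by rw [hρ]; field_simp
  refine ⟨hs, by linarith, ?_, ?_, ?_, ?_, ?_⟩
  · rw [e1]; linarith
  · rw [e2]; linarith [hvu s hsm]
  · linarith [hvl s hsm]
  · linarith [hwB s hsm]
  · linarith [hwl s hsm]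

namespace FallBounds

variable {V W : ℝ}

/-- Crude bounds needing no information on the size of B, which is known only after a passage. The
last makes the slope at height one blow up; the one for W makes the second derivative negligible on
entry into the layer. -/
theorem weak (f : FallBounds L B s V W) (hL : 4 ≤ L) (hB : 0 < B) :
    s ^ 3 ≤ 12 * (L - 1) ∧ 0 < V ∧ (L - 1) * W ≤ 3 / 2 * V ^ 2 ∧ (L - 1) ^ 2 ≤ V ^ 3 := by
  obtain ⟨hs, h1, h2, h3, h4, h5, h6⟩ := f
  have e1 : s ^ 3 / (4 * (L - 1)) ≤ s ^ 3 / 12 := by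
    gcongr
    linarith
  have e2 : s ^ 2 / (2 * (L - 1)) ≤ s ^ 2 / 6 := by
    gcongr
    linarith
  have hV1 : s * (B + s) ≤ 3 * V := by nlinarith [mul_pos hB hs]
  have hV0 : 0 < V := by nlinarith [mul_pos hs (add_pos hB hs)]
  have hV2 : 2 * (L - 1) ≤ s * V := by
    have : s * (B * s + s ^ 2 / 3) ≤ s * V := by
      gcongr
      linarith
    nlinarith
  have hV3 : 2 * (L - 1) * (B + s) ≤ 3 * V ^ 2 := by
    have h7 : 2 * (L - 1) * (B + s) ≤ s * V * (B + s) := by gcongr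
    have h8 : V * (s * (B + s)) ≤ V * (3 * V) := by gcongr
    linarith
  refine ⟨?_, hV0, ?_, ?_⟩
  · have : 0 ≤ B * s ^ 2 := by positivity
    linarith
  · have : (L - 1) * W ≤ (L - 1) * (B + s) := by
      gcongr
      linarith
    linarith
  · have h7 : s ^ 2 ≤ 3 * V := by nlinarith
    have h8 : (2 * (L - 1)) ^ 2 ≤ (s * V) ^ 2 := by
      gcongr
      linarith
    have h9 : s ^ 2 * V ^ 2 ≤ 3 * V * V ^ 2 := by gcongr
    nlinarith [pow_pos hV0 3]

end FallBounds

/-- The limiting shape of the fall, when the second derivatives at the maxima scale like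
`L ^ (1 / 3)`, here written `lam`. -/
theorem tendsto_fall {lam B s V W : ℕ → ℝ} {a : ℝ} (ha : 0 < a) (ha3 : a ^ 3 = 3 / 2)
    (hf : ∀ᶠ n in atTop, FallBounds (lam n ^ 3) (B n) (s n) (V n) (W n))
    (hlam : Tendsto lam atTop atTop) (hB : ∀ᶠ n in atTop, 0 < B n)
    (hb : Tendsto (fun n => B n / lam n) atTop (𝓝 a)) :
    Tendsto (fun n => s n / lam n) atTop (𝓝 a) ∧
      Tendsto (fun n => V n / lam n ^ 2) atTop (𝓝 (3 / 2 * a ^ 2)) := by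
  set b : ℕ → ℝ := fun n => B n / lam n with hbdef
  set x : ℕ → ℝ := fun n => s n / lam n with hxdef
  have hl3 : Tendsto (fun n => lam n ^ 3) atTop atTop :=
    (tendsto_pow_atTop (by norm_num)).comp hlam
  have hinv : Tendsto (fun n => (lam n ^ 3)⁻¹) atTop (𝓝 0) := tendsto_inv_atTop_zero.comp hl3
  have hinv1 : Tendsto (fun n => (lam n ^ 3 - 1)⁻¹) atTop (𝓝 0) :=
    tendsto_inv_atTop_zero.comp (tendsto_atTop_add_const_right _ (-1) hl3)
  have key : ∀ᶠ n in atTop, 0 < x n ∧ x n ≤ 3 ∧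
      1 - (lam n ^ 3)⁻¹ ≤ b n * x n ^ 2 / 2 + x n ^ 3 / 6 ∧
      b n * x n ^ 2 / 2 + x n ^ 3 / 6 ≤ 1 - (lam n ^ 3)⁻¹ + x n ^ 3 / 4 * (lam n ^ 3 - 1)⁻¹ ∧
      b n * x n + x n ^ 2 / 2 - x n ^ 2 / 2 * (lam n ^ 3 - 1)⁻¹ ≤ V n / lam n ^ 2 ∧
      V n / lam n ^ 2 ≤ b n * x n + x n ^ 2 / 2 := by
    filter_upwards [hf, hlam.eventually_gt_atTop 0, hl3.eventually_ge_atTop 4, hB]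
      with n f h0 h4 hBn
    have hw := (f.weak h4 hBn).1
    have hne : lam n ^ 3 - 1 ≠ 0 := by linarith
    have hxs : s n = x n * lam n := by simp only [hxdef]; field_simp
    have hbB : B n = b n * lam n := by simp only [hbdef]; field_simp
    have hx0 : 0 < x n := div_pos f.pos h0
    obtain ⟨_, h1, h2, h3, h5, _, _⟩ := f
    rw [hxs] at hw h1 h2 h3 h5
    rw [hbB] at h1 h2 h3 h5
    have hl : 0 < lam n ^ 3 := by positivity
    have e1 : b n * lam n * (x n * lam n) ^ 2 / 2 + (x n * lam n) ^ 3 / 6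
      = (b n * x n ^ 2 / 2 + x n ^ 3 / 6) * lam n ^ 3 := by ring
    refine ⟨hx0, ?_, ?_, ?_, ?_, ?_⟩
    · by_contra hgt
      push Not at hgt
      have : (3 : ℝ) ^ 3 ≤ x n ^ 3 := by gcongr
      rw [mul_pow] at hw
      nlinarith
    · rw [e1] at h1
      refine le_of_mul_le_mul_right ?_ hl
      rw [sub_mul, inv_mul_cancel₀ hl.ne']
      linarith
    · rw [e1] at h2
      refine le_of_mul_le_mul_right (h2.trans_eq ?_) hl
      field_simp
    · rw [le_div_iff₀ (by positivity)]
      refine le_of_eq_of_le ?_ h3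
      field_simp
    · rw [div_le_iff₀ (by positivity)]
      refine h5.trans_eq ?_
      ring
  have bdd : ∀ k : ℕ, ∀ᶠ n in atTop, ‖x n ^ k‖ ≤ 3 ^ k := fun k => by
    filter_upwards [key] with n hn
    rw [norm_pow, Real.norm_of_nonneg hn.1.le]
    exact pow_le_pow_left₀ hn.1.le hn.2.1 k
  have hz : ∀ (k : ℕ) (e : ℕ → ℝ), Tendsto e atTop (𝓝 0) →
      Tendsto (fun n => x n ^ k * e n) atTop (𝓝 0) := fun k e he =>
    bdd_le_mul_tendsto_zero' (3 ^ k) (bdd k) he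
  have hb0 : Tendsto (fun n => b n - a) atTop (𝓝 0) := by
    simpa using hb.sub_const a
  have hq : Tendsto (fun n => b n * x n ^ 2 / 2 + x n ^ 3 / 6) atTop (𝓝 1) := by
    refine tendsto_of_tendsto_of_tendsto_of_le_of_le'
      (g := fun n => 1 - (lam n ^ 3)⁻¹)
      (h := fun n => 1 - (lam n ^ 3)⁻¹ + x n ^ 3 / 4 * (lam n ^ 3 - 1)⁻¹) ?_ ?_ ?_ ?_
    · simpa using hinv.const_sub 1
    · have := (hinv.const_sub 1).add ((hz 3 _ hinv1).div_const 4)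
      simp only [zero_div, add_zero, sub_zero] at this
      refine this.congr fun n => ?_
      ring
    · exact key.mono fun n hn => hn.2.2.1
    · exact key.mono fun n hn => hn.2.2.2.1
  have hqa : Tendsto (fun n => a * x n ^ 2 / 2 + x n ^ 3 / 6 - 1) atTop (𝓝 0) := by
    have := (hq.sub ((hz 2 _ hb0).div_const 2)).sub_const 1
    simp only [zero_div, sub_zero, sub_self] at this
    refine this.congr fun n => ?_
    ring
  have hxa : Tendsto x atTop (𝓝 a) := by
    rw [tendsto_iff_norm_sub_tendsto_zero]
    have h1 := (hqa.norm.div_const (a ^ 2 / 2))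
    simp only [norm_zero, zero_div] at h1
    refine tendsto_of_tendsto_of_tendsto_of_le_of_le' tendsto_const_nhds h1
      (Eventually.of_forall fun n => norm_nonneg _) ?_
    filter_upwards [key] with n hn
    have hx0 := hn.1
    rw [le_div_iff₀ (by positivity)]
    -- By a³ = 3/2, the number a is a root of the limiting cubic; the cofactor is at least a²/2 for
    -- x > 0, so the residual controls |x - a|.
    have e : a * x n ^ 2 / 2 + x n ^ 3 / 6 - 1
        = (x n - a) * (a * (x n + a) / 2 + (x n ^ 2 + x n * a + a ^ 2) / 6) := by
      linear_combination (2 / 3 : ℝ) * ha3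
    rw [e, norm_mul]
    gcongr
    rw [Real.norm_of_nonneg (by positivity)]
    nlinarith [mul_pos ha hx0, sq_nonneg (x n), sq_nonneg a]
  refine ⟨hxa, ?_⟩
  have hlim : Tendsto (fun n => b n * x n + x n ^ 2 / 2) atTop (𝓝 (3 / 2 * a ^ 2)) := by
    have := (hb.mul hxa).add ((hxa.pow 2).div_const 2)
    convert this using 2
    ring
  refine tendsto_of_tendsto_of_tendsto_of_le_of_le' ?_ hlim
    (key.mono fun n hn => hn.2.2.2.2.1) (key.mono fun n hn => hn.2.2.2.2.2)
  have := hlim.sub ((hz 2 _ hinv1).div_const 2)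
  simp only [zero_div, sub_zero] at this
  refine this.congr fun n => ?_
  ring

theorem FilmOscillation.exists_fall {τ₀ : ℝ} {τp τm : ℕ → ℝ}
    (o : FilmOscillation τ₀ u v w τp τm) (h : SolvesOn 1 (Ioi τ₀) u v w) (n : ℕ) :
    ∃ t, τp n < t ∧ t < τm n ∧ u t = 1 ∧
      FallBounds (u (τp n)) (-w (τp n)) (t - τp n) (-v t) (-w t) := by
  have hτ : ∀ t, τp n ≤ t → τ₀ < t := fun t ht => (o.lower n).trans_le ht
  have hcu : ContinuousOn (fun t => u t - 1) (Icc (τp n) (τm n)) := fun t ht =>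
    ((h t (hτ t ht.1)).2.1.continuousAt.sub continuousAt_const).continuousWithinAt
  obtain ⟨t, ht1, ht2, ht3, ht4⟩ := exists_isLeast_zero (o.lt_min n).le hcu
    (by linarith [o.max_gt n]) (by linarith [o.min_lt n])
  have hut : u t = 1 := by linarith
  have htm : t < τm n := lt_of_le_of_ne ht2 fun he => by
    have := o.min_lt n
    rw [← he] at this
    linarith
  refine ⟨t, ht1, htm, hut, ?_⟩
  have h' : SolvesOn 1 (Icc 0 (t - τp n)) (fun s => u (s + τp n)) (fun s => v (s + τp n))
      (fun s => w (s + τp n)) := h.comp_add (τp n) fun s hs => hτ _ (by linarith [hs.1])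
  have := h'.fallBounds (L := u (τp n)) (B := -w (τp n)) (by linarith) (o.max_gt n)
    (by linarith [o.second_max n]) (by simp) (by simpa using o.deriv_max n) (by simp)
    (fun s hs => by
      rcases eq_or_lt_of_le hs.2 with he | hlt
      · simp only [he, sub_add_cancel, hut, le_refl]
      · have := ht4 (s + τp n) ⟨by linarith [hs.1], by linarith⟩
        linarith)
    (by simpa using hut)
  simpa using this

end Fall

/-! ### From one maximum to the next -/

/-- The passage from the `n`-th to the `(n + 1)`-st maximum of an oscillating film, in terms of the
scaling parameter `κ n` of its inner layer, with `φ` of minimum `m` as the inner profile. -/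
structure FilmPassage (K m ℓ : ℝ) (u w : ℝ → ℝ) (τp τm κ s W : ℕ → ℝ) : Prop where
  pos : ∀ n, 0 < κ n
  fall : ∀ n, FallBounds (u (τp n)) (-w (τp n)) (s n) (K / κ n) (W n)
  tendsto_min : Tendsto (fun n => u (τm n) / κ n ^ 3) atTop (𝓝 m)
  tendsto_min_time : Tendsto (fun n => τm n - τp n - s n) atTop (𝓝 0)
  tendsto_rise : Tendsto (fun n => κ n ^ 5 * (τp (n + 1) - τm n)) atTop (𝓝 (2 * ℓ))
  tendsto_second : Tendsto (fun n => κ n ^ 5 * w (τp (n + 1))) atTop (𝓝 (-ℓ))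
  tendsto_max : Tendsto (fun n => κ n ^ 15 * u (τp (n + 1))) atTop (𝓝 (2 / 3 * ℓ ^ 3))

theorem FilmOscillation.exists_filmPassage {τ₀ K ℓ s₀ : ℝ} {u v w φ φ₁ φ₂ : ℝ → ℝ} {τp τm : ℕ → ℝ}
    (o : FilmOscillation τ₀ u v w τp τm) (h : SolvesOn 1 (Ioi τ₀) u v w)
    (hφ : IsProfile K φ φ₁ φ₂) (hK : 0 < K) (hY : 24 ≤ K ^ 3 * φ 0)
    (hφs : ∀ s, s ≤ 0 → φ₁ s ≤ -K / 2) (hℓ : 0 < ℓ) (hl : Tendsto φ₂ atTop (𝓝 ℓ))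
    (hs₀ : φ₁ s₀ = 0) (hmin : ∀ t, φ s₀ ≤ φ t) :
    ∃ κ s W, FilmPassage K (φ s₀) ℓ u w τp τm κ s W := by
  choose t₁ ht1 htm hut hf using o.exists_fall h
  have hV : ∀ n, v (t₁ n) < 0 := fun n => o.decreasing n _ ⟨ht1 n, htm n⟩
  -- Chosen so that the rescaled slope at height one is exactly -K, as `IsProfile.arrival` requires;
  -- the rescaled starting height is κ⁻³.
  set κ : ℕ → ℝ := fun n => K / -v (t₁ n) with hκdef
  have hκ : ∀ n, 0 < κ n := fun n => div_pos hK (by linarith [hV n])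
  have hκne : ∀ n, κ n ≠ 0 := fun n => (hκ n).ne'
  have hκV : ∀ n, K / κ n = -v (t₁ n) := fun n => by
    have := (hV n).ne
    simp only [hκdef]
    field_simp
  have hvκ : ∀ n, κ n * v (t₁ n) = -K := fun n => by
    have := (hV n).ne
    simp only [hκdef]
    field_simp
  have hL := o.tendsto_max_height h
  have hL1 : Tendsto (fun n => u (τp n) - 1) atTop atTop :=
    tendsto_atTop_add_const_right _ (-1) hL
  have hweak := (hL.eventually_ge_atTop 4).mono fun n hn =>
    (hf n).weak hn (by linarith [o.second_max n])
  have hVt : Tendsto (fun n => -v (t₁ n)) atTop atTop := by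
    rw [tendsto_atTop]
    intro b
    have h2 : Tendsto (fun n => (u (τp n) - 1) ^ 2) atTop atTop :=
      (tendsto_pow_atTop (by norm_num)).comp hL1
    filter_upwards [hweak, h2.eventually_gt_atTop (b ^ 3)] with n hn hb
    by_contra hlt
    push Not at hlt
    have := pow_le_pow_left₀ (by linarith [hV n]) hlt.le 3
    linarith [hn.2.2.2]
  have hκ0 : Tendsto κ atTop (𝓝 0) := by
    have := (tendsto_inv_atTop_zero.comp hVt).const_mul K
    rw [mul_zero] at this
    exact this
  have hτ : ∀ n t, t₁ n ≤ t → τ₀ < t := fun n t ht => ((o.lower n).trans (ht1 n)).trans_le ht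
  set U : ℕ → ℝ → ℝ := fun n t => u (t₁ n + κ n ^ 4 * t) / κ n ^ 3 with hU
  set V : ℕ → ℝ → ℝ := fun n t => κ n * v (t₁ n + κ n ^ 4 * t) with hVdef
  set W : ℕ → ℝ → ℝ := fun n t => κ n ^ 5 * w (t₁ n + κ n ^ 4 * t) with hW
  have hsol : ∀ n, SolvesOn (κ n ^ 9) (Ici 0) (U n) (V n) (W n) := fun n =>
    h.rescale (hκ n) (t₁ n) fun t ht => hτ n _ (by
      have : 0 ≤ κ n ^ 4 * t := mul_nonneg (pow_pos (hκ n) 4).le ht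
      linarith)
  have hh : Tendsto (fun n => (κ n ^ 3)⁻¹) atTop atTop := by
    apply tendsto_inv_nhdsGT_zero.comp
    rw [tendsto_nhdsWithin_iff]
    exact ⟨by simpa using hκ0.pow 3, Eventually.of_forall fun n => pow_pos (hκ n) 3⟩
  -- The quantity is κ²w. By κV = K and the bound (L - 1)W ≤ (3/2)V² it is O(1/(L - 1)).
  have hw0 : Tendsto (fun n => (κ n ^ 3)⁻¹ * W n 0) atTop (𝓝 0) := by
    have h0 : Tendsto (fun n => K ^ 2 * (3 / 2) * (u (τp n) - 1)⁻¹) atTop (𝓝 0) := by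
      simpa using (tendsto_inv_atTop_zero.comp hL1).const_mul (K ^ 2 * (3 / 2))
    refine squeeze_zero_norm' ?_ h0
    filter_upwards [hweak] with n hn
    have hw1 := (hf n).second_pos
    have hL0 : 0 < u (τp n) - 1 := by linarith [o.max_gt n]
    have e : (κ n ^ 3)⁻¹ * W n 0 = -(κ n ^ 2 * -w (t₁ n)) := by
      have := hκne n
      simp only [hW, mul_zero, add_zero]
      field_simp
    rw [e, norm_neg, Real.norm_of_nonneg (mul_nonneg (sq_nonneg _) hw1.le), ← div_eq_mul_inv,
      le_div_iff₀ hL0]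
    have h1 : κ n ^ 2 * ((u (τp n) - 1) * -w (t₁ n)) ≤ κ n ^ 2 * (3 / 2 * (-v (t₁ n)) ^ 2) :=
      mul_le_mul_of_nonneg_left hn.2.2.1 (sq_nonneg _)
    have h2 : κ n ^ 2 * (3 / 2 * (-v (t₁ n)) ^ 2) = 3 / 2 * (κ n * v (t₁ n)) ^ 2 := by ring
    rw [h2, hvκ] at h1
    linarith
  obtain ⟨T, hT, hTv, hTw⟩ := hφ.arrival hK hY hφs (u := U) (v := V) (w := W)
    (c := fun n => κ n ^ 9) hh
    (fun n => by rw [inv_pow, inv_inv]; ring) (Eventually.of_forall hsol)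
    (fun n => by simp only [hU, mul_zero, add_zero, hut, one_div])
    (Eventually.of_forall fun n => by simp only [hVdef, mul_zero, add_zero, hvκ]) hw0
  set sm : ℕ → ℝ := fun n => (τm n - t₁ n) / κ n ^ 4 - T n with hsm
  set sp : ℕ → ℝ := fun n => (τp (n + 1) - t₁ n) / κ n ^ 4 - T n with hsp
  have hAm : ∀ n, t₁ n + κ n ^ 4 * (sm n + T n) = τm n := fun n => by
    have := hκne n
    simp only [hsm]
    field_simp
    ring
  have hAp : ∀ n, t₁ n + κ n ^ 4 * (sp n + T n) = τp (n + 1) := fun n => by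
    have := hκne n
    simp only [hsp]
    field_simp
    ring
  have hsol' : ∀ᶠ n in atTop, SolvesOn (κ n ^ 9) (Ici 0) (fun t => U n (t + T n))
      (fun t => V n (t + T n)) (fun t => W n (t + T n)) := hT.mono fun n hn =>
    (hsol n).comp_add (T n) fun t ht => by
      have : 0 ≤ t := ht
      exact mem_Ici.2 (by linarith [hn.1])
  have hu0' : Tendsto (fun n => U n (0 + T n)) atTop (𝓝 (φ 0)) :=
    tendsto_const_nhds.congr' (hT.mono fun n hn => by
      simp only [zero_add, hn.2.2.1])
  have hz : ∀ᶠ n in atTop, 0 < sm n ∧ sm n < sp n ∧ (∀ t ∈ Ico 0 (sm n), V n (t + T n) < 0) ∧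
      V n (sm n + T n) = 0 ∧ (∀ t ∈ Ioo (sm n) (sp n), 0 < V n (t + T n)) ∧
      V n (sp n + T n) = 0 := by
    filter_upwards [hT] with n hn
    have hk4 : 0 < κ n ^ 4 := pow_pos (hκ n) 4
    have hVm : V n (sm n + T n) = 0 := by simp only [hVdef, hAm, o.deriv_min, mul_zero]
    refine ⟨?_, ?_, fun t ht => ?_, hVm, fun t ht => ?_, ?_⟩
    · by_contra hle
      push Not at hle
      have h1 : 0 < κ n ^ 4 * (sm n + T n) := by linarith [hAm n, htm n]
      have h2 := hn.2.2.2 (sm n + T n) ⟨(pos_of_mul_pos_right h1 hk4.le).le, by linarith⟩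
      linarith
    · have h1 : κ n ^ 4 * (sm n + T n) < κ n ^ 4 * (sp n + T n) := by
        linarith [hAm n, hAp n, o.lt_max n]
      linarith [lt_of_mul_lt_mul_left h1 hk4.le]
    · refine mul_neg_of_pos_of_neg (hκ n) (o.decreasing n _ ⟨?_, ?_⟩)
      · have : 0 ≤ κ n ^ 4 * (t + T n) := mul_nonneg hk4.le (by linarith [ht.1, hn.1])
        linarith [ht1 n]
      · have : κ n ^ 4 * (t + T n) < κ n ^ 4 * (sm n + T n) := by
          have := ht.2
          gcongr
        linarith [hAm n]
    · refine mul_pos (hκ n) (o.increasing n _ ⟨?_, ?_⟩)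
      · have : κ n ^ 4 * (sm n + T n) < κ n ^ 4 * (t + T n) := by
          have := ht.1
          gcongr
        linarith [hAm n]
      · have : κ n ^ 4 * (t + T n) < κ n ^ 4 * (sp n + T n) := by
          have := ht.2
          gcongr
        linarith [hAp n]
    · simp only [hVdef, hAp, o.deriv_max, mul_zero]
  have hc0 : Tendsto (fun n => κ n ^ 9) atTop (𝓝 0) := by simpa using hκ0.pow 9
  have hTv' : Tendsto (fun n => V n (0 + T n)) atTop (𝓝 (φ₁ 0)) := by simpa using hTv
  have hTw' : Tendsto (fun n => W n (0 + T n)) atTop (𝓝 (φ₂ 0)) := by simpa using hTw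
  obtain ⟨hM, Tb, hTb⟩ := hφ.passage_min hK hc0 hsol' hu0' hTv' hTw'
    (by linarith [hφs 0 le_rfl]) hz hs₀ hmin
  obtain ⟨hP1, hP2, hP3⟩ := hφ.passage_max hK hℓ hl (fun n => pow_pos (hκ n) 9) hc0 hsol' hu0'
    hTv' hTw' hz
  -- From height one to the minimum: the scaled descent time is O(κ⁻³) and `sm n` is bounded, so in
  -- original time the layer takes only O(κ).
  have hTmin : Tendsto (fun n => κ n ^ 4 * (sm n + T n)) atTop (𝓝 0) := by
    have h0 : Tendsto (fun n => κ n ^ 4 * Tb + 2 / K * κ n) atTop (𝓝 0) := by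
      simpa using ((hκ0.pow 4).mul_const Tb).add (hκ0.const_mul (2 / K))
    refine tendsto_of_tendsto_of_tendsto_of_le_of_le' tendsto_const_nhds h0 ?_ ?_
    · exact Eventually.of_forall fun n => by linarith [hAm n, htm n]
    · filter_upwards [hT, hTb] with n hn hb
      have h1 : T n ≤ 2 / K * (κ n ^ 3)⁻¹ := by
        rw [div_mul_eq_mul_div, le_div_iff₀ hK]
        linarith [hn.2.1]
      have h2 : κ n ^ 4 * (sm n + T n) ≤ κ n ^ 4 * (Tb + 2 / K * (κ n ^ 3)⁻¹) := by
        have := (hκ n).le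
        gcongr
      refine h2.trans_eq ?_
      have := hκne n
      field_simp
  have hcsm : Tendsto (fun n => κ n ^ 9 * sm n) atTop (𝓝 0) := by
    have h0 : Tendsto (fun n => κ n ^ 9 * Tb) atTop (𝓝 0) := by simpa using hc0.mul_const Tb
    refine tendsto_of_tendsto_of_tendsto_of_le_of_le' tendsto_const_nhds h0 ?_ ?_
    · exact hz.mono fun n hn => mul_nonneg (pow_pos (hκ n) 9).le hn.1.le
    · exact hTb.mono fun n hn => mul_le_mul_of_nonneg_left hn (pow_pos (hκ n) 9).le
  refine ⟨κ, fun n => t₁ n - τp n, fun n => -w (t₁ n), hκ, fun n => ?_, ?_, ?_, ?_, ?_, ?_⟩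
  · rw [hκV]
    exact hf n
  · refine hM.congr fun n => ?_
    simp only [hU, hAm]
  · refine hTmin.congr fun n => ?_
    linarith [hAm n]
  · have := hP1.sub hcsm
    rw [sub_zero] at this
    refine this.congr fun n => ?_
    have := hκne n
    simp only [hsm, hsp]
    field_simp
    ring
  · refine hP2.congr fun n => ?_
    simp only [hW, hAp]
  · refine hP3.congr fun n => ?_
    have := hκne n
    simp only [hU, hAp]
    field_simp

/-! ### Asymptotics of recursively defined sequences -/

theorem tendsto_of_affine_rec {x c r : ℕ → ℝ} {l : ℝ} (h : ∀ n, x (n + 1) = c n + r n * x n)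
    (hc : Tendsto c atTop (𝓝 l)) (hr : Tendsto r atTop (𝓝 0)) : Tendsto x atTop (𝓝 l) := by
  have h1 : ∀ᶠ n in atTop, |c n| ≤ |l| + 1 ∧ |r n| ≤ 1 / 2 := by
    refine (hc.abs.eventually (eventually_le_nhds (by linarith))).and ?_
    have := hr.abs
    rw [abs_zero] at this
    exact this.eventually (eventually_le_nhds (by norm_num))
  obtain ⟨N, hN⟩ := eventually_atTop.1 h1
  have hb : ∀ n, N ≤ n → |x n| ≤ 2 * (|l| + 1) + |x N| := by
    intro n hn
    induction n, hn using Nat.le_induction with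
    | base => linarith [abs_nonneg l]
    | succ n hn ih =>
      rw [h n]
      have h2 : |r n * x n| ≤ 1 / 2 * (2 * (|l| + 1) + |x N|) := by
        rw [abs_mul]
        exact mul_le_mul (hN n hn).2 ih (abs_nonneg _) (by norm_num)
      have h3 := abs_add_le (c n) (r n * x n)
      linarith [(hN n hn).1, abs_nonneg (x N)]
  rw [← tendsto_add_atTop_iff_nat 1]
  have h0 : Tendsto (fun n => x n * r n) atTop (𝓝 0) :=
    bdd_le_mul_tendsto_zero' (2 * (|l| + 1) + |x N|) (eventually_atTop.2 ⟨N, hb⟩) hr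
  have := hc.add h0
  rw [add_zero] at this
  refine this.congr fun n => ?_
  rw [h n, mul_comm (x n)]

/-- After the shift z = y + e/(b - 1) the defect z(n+1) - b·z(n) tends to zero, so z/bⁿ converges
geometrically to some C. The tail of the series beyond n is o(b⁻ⁿ), so z - C·bⁿ → 0, which is
precise enough to be exponentiated. -/
theorem exists_tendsto_sub_const_mul_pow {y : ℕ → ℝ} {b e : ℝ} (hb : 1 < b)
    (h : Tendsto (fun n => y (n + 1) - b * y n) atTop (𝓝 e)) :
    ∃ C, Tendsto (fun n => y n - C * b ^ n) atTop (𝓝 (-e / (b - 1))) := by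
  have hb1 : 0 < b - 1 := by linarith
  have hb0 : 0 < b := by linarith
  set z : ℕ → ℝ := fun n => y n + e / (b - 1) with hz
  set d : ℕ → ℝ := fun n => z (n + 1) - b * z n with hd
  have hd0 : Tendsto d atTop (𝓝 0) := by
    have := h.sub_const e
    rw [sub_self] at this
    refine this.congr fun n => ?_
    simp only [hd, hz]
    field_simp
    ring
  set p : ℕ → ℝ := fun n => z n / b ^ n with hp
  have hdist : ∀ n D, |d n| ≤ D → dist (p n) (p (n + 1)) ≤ D / b * (b⁻¹) ^ n := fun n D hD => by
    have e1 : p (n + 1) - p n = d n / b * (b⁻¹) ^ n := by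
      simp only [hp, hd, inv_pow, pow_succ]
      field_simp
    rw [dist_comm, Real.dist_eq, e1, abs_mul, abs_div, abs_of_pos hb0,
      abs_of_pos (pow_pos (inv_pos.2 hb0) n)]
    gcongr
  obtain ⟨D, hD⟩ := hd0.abs.bddAbove_range
  have hbinv : b⁻¹ < 1 := inv_lt_one_of_one_lt₀ hb
  obtain ⟨C, hC⟩ := cauchySeq_tendsto_of_complete
    (cauchySeq_of_le_geometric (b⁻¹) (D / b) hbinv fun n => hdist n D (hD ⟨n, rfl⟩))
  refine ⟨C, ?_⟩
  have hzC : Tendsto (fun n => z n - C * b ^ n) atTop (𝓝 0) := by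
    rw [Metric.tendsto_atTop]
    intro ε hε
    obtain ⟨N, hN⟩ := Metric.tendsto_atTop.1 hd0 (ε * (b - 1) / 2) (by positivity)
    refine ⟨N, fun n hn => ?_⟩
    have h1 := dist_le_of_le_geometric_of_tendsto₀ (b⁻¹)
      (ε * (b - 1) / 2 / b * (b⁻¹) ^ n) hbinv (f := fun k => p (n + k)) (a := C)
      (fun k => by
        have := hdist (n + k) (ε * (b - 1) / 2) (by
          have := hN (n + k) (by omega)
          rw [Real.dist_eq, sub_zero] at this
          exact this.le)
        refine this.trans_eq ?_
        rw [pow_add]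
        ring)
      (by
        have := (tendsto_add_atTop_iff_nat n).2 hC
        refine this.congr fun k => ?_
        rw [add_comm])
    rw [add_zero, Real.dist_eq] at h1
    have e1 : z n - C * b ^ n = (p n - C) * b ^ n := by
      simp only [hp]
      field_simp
    rw [Real.dist_eq, sub_zero, e1, abs_mul, abs_of_pos (pow_pos hb0 n)]
    have h2 : |p n - C| * b ^ n ≤ ε * (b - 1) / 2 / b * (b⁻¹) ^ n / (1 - b⁻¹) * b ^ n := by
      gcongr
    have hne : b - 1 ≠ 0 := hb1.ne'
    have e2 : ε * (b - 1) / 2 / b * (b⁻¹) ^ n / (1 - b⁻¹) * b ^ n = ε / 2 := by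
      rw [show 1 - b⁻¹ = (b - 1) / b by field_simp, inv_pow]
      field_simp
    linarith
  have := hzC.sub_const (e / (b - 1))
  rw [zero_sub, ← neg_div] at this
  refine this.congr fun n => ?_
  simp only [hz]
  ring

/-- Logarithms make the power recursion affine. A nonpositive C is excluded because log lam is
unbounded above. -/
theorem exists_tendsto_div_exp {lam : ℕ → ℝ} {b q : ℝ} (hb : 1 < b) (hq : 0 < q)
    (hpos : ∀ n, 0 < lam n) (hlam : Tendsto lam atTop atTop)
    (h : Tendsto (fun n => lam (n + 1) / lam n ^ b) atTop (𝓝 q)) :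
    ∃ C, 0 < C ∧ Tendsto (fun n => lam n / Real.exp (C * b ^ n)) atTop
      (𝓝 (q ^ (-1 / (b - 1)))) := by
  have hlog : Tendsto (fun n => Real.log (lam (n + 1)) - b * Real.log (lam n)) atTop
      (𝓝 (Real.log q)) := by
    refine (h.log hq.ne').congr fun n => ?_
    rw [Real.log_div (hpos _).ne' (Real.rpow_pos_of_pos (hpos n) b).ne', Real.log_rpow (hpos n)]
  obtain ⟨C, hC⟩ := exists_tendsto_sub_const_mul_pow (y := fun n => Real.log (lam n)) hb hlog
  refine ⟨C, ?_, ?_⟩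
  · by_contra hle
    push Not at hle
    have h1 : Tendsto (fun n => Real.log (lam n)) atTop atTop := Real.tendsto_log_atTop.comp hlam
    refine not_tendsto_nhds_of_tendsto_atTop (tendsto_atTop_mono (fun n => ?_) h1) _ hC
    have : C * b ^ n ≤ 0 := mul_nonpos_of_nonpos_of_nonneg hle (by positivity)
    linarith
  · have := (Real.continuous_exp.tendsto _).comp hC
    rw [show Real.exp (-Real.log q / (b - 1)) = q ^ (-1 / (b - 1)) by
      rw [Real.rpow_def_of_pos hq]; ring_nf] at this
    refine this.congr fun n => ?_
    simp only [Function.comp_def]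
    rw [Real.exp_sub, Real.exp_log (hpos n)]

/-! ### Asymptotics of the oscillations -/

/-- The asymptotics of the oscillations in terms of the cube roots `lam n` of the maxima. -/
structure FilmAsymptotics (a m ℓ : ℝ) (u w : ℝ → ℝ) (τp τm lam : ℕ → ℝ) : Prop where
  min : Tendsto (fun n => u (τm n) * u (τp n) ^ 2) atTop (𝓝 m)
  second : Tendsto (fun n => w (τp n) / lam n) atTop (𝓝 (-a))
  max_time : Tendsto (fun n => τp n / lam n) atTop (𝓝 (2 * a))
  min_time : Tendsto (fun n => τm n / lam n) atTop (𝓝 (3 * a))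
  ratio : Tendsto (fun n => lam (n + 1) / lam n ^ 10) atTop (𝓝 (ℓ / a))

/-- The exit from each layer fixes w/lam at the following maximum; only then does `tendsto_fall`
give the sharp relation κ·lam² → 1, which turns the limits expressed in κ into limits expressed in
lam. -/
theorem FilmPassage.filmAsymptotics {K m ℓ a : ℝ} {u w : ℝ → ℝ} {τp τm κ s W lam : ℕ → ℝ}
    (P : FilmPassage K m ℓ u w τp τm κ s W) (hℓ : 0 < ℓ) (ha : 0 < a) (ha3 : a ^ 3 = 3 / 2)
    (hK : K = 3 / 2 * a ^ 2) (hlam0 : ∀ n, 0 < lam n) (hlam3 : ∀ n, lam n ^ 3 = u (τp n))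
    (hlam : Tendsto lam atTop atTop) (hw : ∀ n, w (τp n) < 0) :
    FilmAsymptotics a m ℓ u w τp τm lam := by
  have hlne : ∀ n, lam n ≠ 0 := fun n => (hlam0 n).ne'
  have hκne : ∀ n, κ n ≠ 0 := fun n => (P.pos n).ne'
  have hK0 : K ≠ 0 := by rw [hK]; positivity
  have hr : Tendsto (fun n => κ n ^ 5 * lam (n + 1)) atTop (𝓝 (ℓ / a)) := by
    have h1 := P.tendsto_max.rpow_const (p := 1 / 3) (Or.inr (by norm_num))
    rw [show 2 / 3 * ℓ ^ 3 = (ℓ / a) ^ 3 by rw [div_pow, ha3]; ring,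
      ← Real.rpow_natCast (ℓ / a), ← Real.rpow_mul (by positivity)] at h1
    norm_num at h1
    refine h1.congr fun n => ?_
    have h2 : 0 ≤ κ n ^ 5 * lam (n + 1) := mul_nonneg (pow_pos (P.pos n) 5).le (hlam0 _).le
    rw [← hlam3, show κ n ^ 15 * lam (n + 1) ^ 3 = (κ n ^ 5 * lam (n + 1)) ^ 3 by ring,
      ← Real.rpow_natCast (κ n ^ 5 * lam (n + 1)), ← Real.rpow_mul h2]
    norm_num
  have hq0 : ℓ / a ≠ 0 := by positivity
  have hsecond : Tendsto (fun n => w (τp n) / lam n) atTop (𝓝 (-a)) := by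
    rw [← tendsto_add_atTop_iff_nat 1]
    have := P.tendsto_second.div hr hq0
    rw [show -ℓ / (ℓ / a) = -a by field_simp] at this
    refine this.congr fun n => ?_
    have := hκne n
    simp only [Pi.div_apply]
    field_simp
  have hfall := tendsto_fall ha ha3 (lam := lam) (B := fun n => -w (τp n)) (s := s)
    (V := fun n => K / κ n) (W := W)
    (Eventually.of_forall fun n => by rw [hlam3]; exact P.fall n) hlam
    (Eventually.of_forall fun n => by linarith [hw n])
    (by
      have := hsecond.neg
      rw [neg_neg] at this
      refine this.congr fun n => ?_
      rw [neg_div])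
  obtain ⟨hsl, hVl⟩ := hfall
  have hκl : Tendsto (fun n => κ n * lam n ^ 2) atTop (𝓝 1) := by
    rw [← hK] at hVl
    have := (hVl.inv₀ hK0).const_mul K
    rw [mul_inv_cancel₀ hK0] at this
    refine this.congr fun n => ?_
    have := hκne n
    have := hlne n
    field_simp
  have hratio : Tendsto (fun n => lam (n + 1) / lam n ^ 10) atTop (𝓝 (ℓ / a)) := by
    have := hr.div (hκl.pow 5) (by norm_num)
    rw [one_pow, div_one] at this
    refine this.congr fun n => ?_
    have := hκne n
    have := hlne n
    simp only [Pi.div_apply]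
    field_simp
  have hdrop : Tendsto (fun n => (τm n - τp n) / lam n) atTop (𝓝 a) := by
    have := (P.tendsto_min_time.div_atTop hlam).add hsl
    rw [zero_add] at this
    refine this.congr fun n => ?_
    rw [← add_div, sub_add_cancel]
  have hrise : Tendsto (fun n => (τp (n + 1) - τm n) / lam (n + 1)) atTop (𝓝 (2 * a)) := by
    have := P.tendsto_rise.div hr hq0
    rw [show 2 * ℓ / (ℓ / a) = 2 * a by field_simp] at this
    refine this.congr fun n => ?_
    have := hκne n
    simp only [Pi.div_apply]
    field_simp
  have hsmall : Tendsto (fun n => lam n / lam (n + 1)) atTop (𝓝 0) := by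
    have h9 : Tendsto (fun n => (lam n ^ 9)⁻¹) atTop (𝓝 0) :=
      tendsto_inv_atTop_zero.comp ((tendsto_pow_atTop (by norm_num)).comp hlam)
    have := (hratio.inv₀ hq0).mul h9
    rw [mul_zero] at this
    refine this.congr fun n => ?_
    have := hlne n
    have := hlne (n + 1)
    field_simp
  have hmax : Tendsto (fun n => τp n / lam n) atTop (𝓝 (2 * a)) := by
    -- Each maximum time is dominated by the last rise, earlier durations being smaller by the
    -- factor lam n / lam (n + 1) → 0.
    refine tendsto_of_affine_rec (c := fun n => (τp (n + 1) - τm n) / lam (n + 1) +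
      (τm n - τp n) / lam n * (lam n / lam (n + 1))) (r := fun n => lam n / lam (n + 1))
      (fun n => ?_) ?_ hsmall
    · have := hlne n
      have := hlne (n + 1)
      field_simp
      ring
    · simpa using hrise.add (hdrop.mul hsmall)
  refine ⟨?_, hsecond, hmax, ?_, hratio⟩
  · have := P.tendsto_min.mul (hκl.pow 3)
    rw [one_pow, mul_one] at this
    refine this.congr fun n => ?_
    have := hκne n
    rw [← hlam3 n]
    field_simp
  · have := hdrop.add hmax
    rw [show a + 2 * a = 3 * a by ring] at this
    refine this.congr fun n => ?_
    rw [← add_div, sub_add_cancel]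

/-! ### The inner profile and the film as solutions of first order systems -/

theorem filmA_pos : 0 < filmA := Real.rpow_pos_of_pos (by norm_num) _

theorem filmK_pos : 0 < filmK := Real.rpow_pos_of_pos (by norm_num) _

theorem filmA_pow_three : filmA ^ 3 = 3 / 2 := by
  rw [filmA, ← Real.rpow_natCast, ← Real.rpow_mul (by norm_num)]
  norm_num

theorem filmK_eq : filmK = 3 / 2 * filmA ^ 2 := by
  rw [filmK, filmA, ← Real.rpow_natCast, ← Real.rpow_mul (by norm_num)]
  nth_rewrite 2 [← Real.rpow_one (3 / 2 : ℝ)]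
  rw [← Real.rpow_add (by norm_num)]
  norm_num

theorem IsInnerProfile.isProfile {φ : ℝ → ℝ} (h : IsInnerProfile φ) :
    IsProfile filmK φ (deriv φ) (iteratedDeriv 2 φ) := by
  obtain ⟨hc, hs, he⟩ := h
  refine IsProfile.of_isEquivalent filmK_pos (fun t _ => ?_) he
  obtain ⟨h1, h2, h3⟩ := hasDerivAt_of_contDiffAt_three (hc.contDiffAt (x := t))
  exact ⟨(hs t).1, h1, h2, h3.congr_deriv (by rw [(hs t).2, one_div, sub_zero])⟩

theorem IsProfile.isInnerProfile {φ φ₁ φ₂ : ℝ → ℝ} (h : IsProfile filmK φ φ₁ φ₂) :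
    IsInnerProfile φ := by
  have e1 : deriv φ = φ₁ := funext fun t => (h.solves t (mem_univ t)).2.1.deriv
  have e2 : deriv φ₁ = φ₂ := funext fun t => (h.solves t (mem_univ t)).2.2.1.deriv
  have e3 : deriv φ₂ = fun t => (φ t ^ 3)⁻¹ - 0 :=
    funext fun t => (h.solves t (mem_univ t)).2.2.2.deriv
  have d0 : Differentiable ℝ φ := fun t => (h.solves t (mem_univ t)).2.1.differentiableAt
  have d1 : Differentiable ℝ φ₁ := fun t => (h.solves t (mem_univ t)).2.2.1.differentiableAt
  have d2 : Differentiable ℝ φ₂ := fun t => (h.solves t (mem_univ t)).2.2.2.differentiableAt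
  refine ⟨?_, fun t => ⟨h.pos t, ?_⟩, h.isEquivalent_atBot filmK_pos⟩
  · have c1 : ContDiff ℝ 1 φ₂ := by
      rw [contDiff_one_iff_deriv, e3]
      exact ⟨d2, ((d0.continuous.pow 3).inv₀ fun t => (pow_pos (h.pos t) 3).ne').sub
        continuous_const⟩
    have c2 : ContDiff ℝ (1 + 1) φ₁ := by
      rw [contDiff_succ_iff_deriv, e2]
      exact ⟨d1, by simp, c1⟩
    have c3 : ContDiff ℝ (1 + 1 + 1) φ := by
      rw [contDiff_succ_iff_deriv, e1]
      exact ⟨d0, by simp, c2⟩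
    convert c3 using 1
    norm_num
  · rw [iteratedDeriv_succ, iteratedDeriv_succ, iteratedDeriv_one, e1, e2, e3]
    simp only [sub_zero, one_div]

theorem IsFilmSolution.solvesOn {τ₀ : ℝ} {Φ : ℝ → ℝ} (h : IsFilmSolution τ₀ Φ) :
    SolvesOn 1 (Ioi τ₀) Φ (deriv Φ) (iteratedDeriv 2 Φ) := fun t ht => by
  obtain ⟨hc, hs⟩ := h
  obtain ⟨h1, h2, h3⟩ := hasDerivAt_of_contDiffAt_three (hc.contDiffAt (Ioi_mem_nhds ht))
  obtain ⟨hpos, heq⟩ := hs t ht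
  refine ⟨hpos, h1, h2, h3.congr_deriv ?_⟩
  rw [eq_sub_iff_add_eq]
  exact eq_inv_of_mul_eq_one_left heq

theorem exists_isProfile_normalized {K : ℝ} (hK : 0 < K) :
    ∃ φ φ₁ φ₂, IsProfile K φ φ₁ φ₂ ∧ 24 ≤ K ^ 3 * φ 0 ∧ ∀ s, s ≤ 0 → φ₁ s ≤ -K / 2 := by
  obtain ⟨φ, φ₁, φ₂, hφ⟩ := exists_isProfile hK
  obtain ⟨Y, hY⟩ := hφ.exists_level hK
  obtain ⟨ζ, h1, h2⟩ := hY (max Y (24 / K ^ 3)) (le_max_left _ _)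
  refine ⟨_, _, _, hφ.comp_add ζ, ?_, fun s hs => h2 _ (by linarith)⟩
  rw [zero_add, h1, mul_comm, ← div_le_iff₀ (by positivity)]
  exact le_max_right _ _

theorem isEquivalent_const_mul_of_tendsto {f g : ℕ → ℝ} {c : ℝ} (hc : c ≠ 0)
    (hg : ∀ n, g n ≠ 0) (h : Tendsto (fun n => f n / g n) atTop (𝓝 c)) :
    f ~[atTop] fun n => c * g n := by
  rw [isEquivalent_iff_tendsto_one (Eventually.of_forall fun n => mul_ne_zero hc (hg n))]
  have := h.div_const c
  rw [div_self hc] at this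
  refine this.congr fun n => ?_
  rw [Pi.div_apply, div_div, mul_comm c]

theorem growth_constants {a ℓ : ℝ} (ha : 0 < a) (hℓ : 0 < ℓ) :
    ((ℓ / a) ^ (-1 / ((10 : ℝ) - 1))) ^ 3 = a ^ (1 / 3 : ℝ) / ℓ ^ (1 / 3 : ℝ) ∧
    2 * a * (ℓ / a) ^ (-1 / ((10 : ℝ) - 1)) = 2 * a ^ (10 / 9 : ℝ) * ℓ ^ (-(1 / 9) : ℝ) ∧
    3 * a * (ℓ / a) ^ (-1 / ((10 : ℝ) - 1)) =
      2 * a ^ (10 / 9 : ℝ) * ℓ ^ (-(1 / 9) : ℝ) + a * a ^ (1 / 9 : ℝ) / ℓ ^ (1 / 9 : ℝ) := by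
  have e1 : (ℓ / a) ^ (-1 / ((10 : ℝ) - 1)) = a ^ (1 / 9 : ℝ) / ℓ ^ (1 / 9 : ℝ) := by
    rw [show (-1 / ((10 : ℝ) - 1)) = -(1 / 9) by norm_num, Real.rpow_neg (by positivity),
      Real.div_rpow hℓ.le ha.le, inv_div]
  have e2 : a ^ (10 / 9 : ℝ) = a * a ^ (1 / 9 : ℝ) := by
    nth_rewrite 2 [← Real.rpow_one a]
    rw [← Real.rpow_add ha]
    norm_num
  have e3 : ∀ y : ℝ, 0 < y → (y ^ (1 / 9 : ℝ)) ^ 3 = y ^ (1 / 3 : ℝ) := fun y hy => by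
    rw [← Real.rpow_natCast, ← Real.rpow_mul hy.le]
    norm_num
  refine ⟨?_, ?_, ?_⟩
  · rw [e1, div_pow, e3 a ha, e3 ℓ hℓ]
  · rw [e1, e2, Real.rpow_neg hℓ.le]
    ring
  · rw [e1, e2, Real.rpow_neg hℓ.le]
    ring

theorem FilmAsymptotics.isEquivalent {a m ℓ : ℝ} {u w : ℝ → ℝ} {τp τm lam : ℕ → ℝ}
    (A : FilmAsymptotics a m ℓ u w τp τm lam) (ha : 0 < a) (hℓ : 0 < ℓ) (hlam0 : ∀ n, 0 < lam n)
    (hlam3 : ∀ n, lam n ^ 3 = u (τp n)) (hlam : Tendsto lam atTop atTop) :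
    ∃ C : ℝ, 0 < C ∧
      (fun n => u (τp n)) ~[atTop]
        (fun n : ℕ => a ^ (1 / 3 : ℝ) * Real.exp (C * 10 ^ n) / ℓ ^ (1 / 3 : ℝ)) ∧
      τp ~[atTop] (fun n : ℕ => 2 * a ^ (10 / 9 : ℝ) * ℓ ^ (-(1 / 9) : ℝ) *
        Real.exp (C / 3 * 10 ^ n)) ∧
      τm ~[atTop] (fun n : ℕ => (2 * a ^ (10 / 9 : ℝ) * ℓ ^ (-(1 / 9) : ℝ) +
        a * a ^ (1 / 9 : ℝ) / ℓ ^ (1 / 9 : ℝ)) * Real.exp (C / 3 * 10 ^ n)) := by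
  obtain ⟨C, hC, hlim⟩ := exists_tendsto_div_exp (b := 10) (by norm_num) (div_pos hℓ ha) hlam0 hlam
    (by simpa only [Real.rpow_ofNat] using A.ratio)
  obtain ⟨g1, g2, g3⟩ := growth_constants ha hℓ
  have hg : 0 < (ℓ / a) ^ (-1 / ((10 : ℝ) - 1)) := by positivity
  have hE : ∀ n : ℕ, Real.exp (C * 10 ^ n) ≠ 0 := fun n => (Real.exp_pos _).ne'
  have hlne : ∀ n, lam n ≠ 0 := fun n => (hlam0 n).ne'
  -- The heights are lam³, while the times are proportional to lam; hence C and C/3 in the two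
  -- exponents.
  refine ⟨3 * C, by positivity, ?_, ?_, ?_⟩
  · have h1 := isEquivalent_const_mul_of_tendsto (f := fun n => u (τp n))
      (g := fun n => Real.exp (C * 10 ^ n) ^ 3) (pow_pos hg 3).ne'
      (fun n => pow_ne_zero 3 (hE n))
      ((hlim.pow 3).congr fun n => by rw [div_pow, hlam3])
    refine h1.congr_right (Eventually.of_forall fun n => ?_)
    simp only
    rw [g1, ← Real.exp_nat_mul, div_mul_eq_mul_div]
    push_cast
    ring_nf
  · have h1 := isEquivalent_const_mul_of_tendsto (f := τp)
      (g := fun n => Real.exp (C * 10 ^ n)) (mul_pos (mul_pos two_pos ha) hg).ne' hE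
      ((A.max_time.mul hlim).congr fun n => by
        have := hlne n
        field_simp)
    rwa [g2, show C = 3 * C / 3 by ring] at h1
  · have h1 := isEquivalent_const_mul_of_tendsto (f := τm)
      (g := fun n => Real.exp (C * 10 ^ n)) (mul_pos (mul_pos three_pos ha) hg).ne' hE
      ((A.min_time.mul hlim).congr fun n => by
        have := hlne n
        field_simp)
    rwa [g3, show C = 3 * C / 3 by ring] at h1

theorem film_oscillation_asymptotics {φ φ₁ φ₂ Φ : ℝ → ℝ} {s₀ ℓ τ₀ : ℝ}
    (hφ : IsProfile filmK φ φ₁ φ₂) (hY : 24 ≤ filmK ^ 3 * φ 0)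
    (hφs : ∀ s, s ≤ 0 → φ₁ s ≤ -filmK / 2) (hℓ : 0 < ℓ) (hl : Tendsto φ₂ atTop (𝓝 ℓ))
    (hs₀ : φ₁ s₀ = 0) (hmin : ∀ t, φ s₀ ≤ φ t) (hΦ : IsFilmSolution τ₀ Φ)
    (hns : ¬ OnStableManifold Φ) :
    ∃ τp τm lam : ℕ → ℝ, FilmOscillation τ₀ Φ (deriv Φ) (iteratedDeriv 2 Φ) τp τm ∧
      FilmAsymptotics filmA (φ s₀) ℓ Φ (iteratedDeriv 2 Φ) τp τm lam ∧
      (∀ n, 0 < lam n) ∧ (∀ n, lam n ^ 3 = Φ (τp n)) ∧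
      (∀ n, lam n = Φ (τp n) ^ (1 / 3 : ℝ)) ∧ Tendsto lam atTop atTop := by
  have h := hΦ.solvesOn
  obtain ⟨τp, τm, o⟩ := exists_filmOscillation h hns
  have hpos : ∀ n, 0 < Φ (τp n) := fun n => one_pos.trans (o.max_gt n)
  have hlam : Tendsto (fun n => Φ (τp n) ^ (1 / 3 : ℝ)) atTop atTop :=
    (tendsto_rpow_atTop (by norm_num)).comp (o.tendsto_max_height h)
  have hlam0 : ∀ n, 0 < Φ (τp n) ^ (1 / 3 : ℝ) := fun n => Real.rpow_pos_of_pos (hpos n) _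
  have hlam3 : ∀ n, (Φ (τp n) ^ (1 / 3 : ℝ)) ^ 3 = Φ (τp n) := fun n => by
    rw [← Real.rpow_natCast, ← Real.rpow_mul (hpos n).le]
    norm_num
  obtain ⟨κ, s, W, P⟩ := o.exists_filmPassage h hφ filmK_pos hY hφs hℓ hl hs₀ hmin
  exact ⟨τp, τm, _, o, P.filmAsymptotics hℓ filmA_pos filmA_pow_three filmK_eq hlam0 hlam3 hlam
    o.second_max, hlam0, hlam3, fun n => rfl, hlam⟩

theorem theorem3p1 :
    -- the inner profile `φ`, unique up to translation, its growth constant `Γ` and its minimum `m`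
    ∃ (φ : ℝ → ℝ) (Γ m : ℝ),
      IsInnerProfile φ ∧
      (∀ ψ : ℝ → ℝ, IsInnerProfile ψ → ∃ c : ℝ, ∀ ζ, ψ ζ = φ (ζ + c)) ∧
      0 < Γ ∧ φ ~[atTop] (fun ζ => Γ * ζ ^ 2) ∧
      IsLeast (range φ) m ∧
      ∀ (τ₀ : ℝ) (Φ : ℝ → ℝ), IsFilmSolution τ₀ Φ → ¬ OnStableManifold Φ →
        ∃ (τp τm : ℕ → ℝ),
          -- the alternating sequences of critical points
          StrictMono τp ∧ StrictMono τm ∧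
          (∀ n, τ₀ < τp n ∧ τp n < τm n ∧ τm n < τp (n + 1)) ∧
          Tendsto τp atTop atTop ∧
          (∀ n, IsLocalMax Φ (τp n) ∧ IsLocalMin Φ (τm n)) ∧
          (∀ n, deriv Φ (τp n) = 0 ∧ deriv Φ (τm n) = 0) ∧
          (∀ n, ∀ τ ∈ Ioo (τp n) (τm n), deriv Φ τ < 0) ∧
          (∀ n, ∀ τ ∈ Ioo (τm n) (τp (n + 1)), 0 < deriv Φ τ) ∧
          -- the asymptotics of `L_n = Φ (τp n)`, `τp n`, `M_n = Φ (τm n)` and `τm n`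
          (∃ C : ℝ, 0 < C ∧
            (fun n => Φ (τp n)) ~[atTop]
              (fun n : ℕ => filmA ^ (1 / 3 : ℝ) * Real.exp (C * 10 ^ n) / (2 * Γ) ^ (1 / 3 : ℝ)) ∧
            τp ~[atTop]
              (fun n : ℕ => 2 * filmA ^ (10 / 9 : ℝ) * (2 * Γ) ^ (-(1 / 9) : ℝ) *
                Real.exp (C / 3 * 10 ^ n)) ∧
            (fun n => Φ (τm n)) ~[atTop] (fun n => m / Φ (τp n) ^ 2) ∧
            τm ~[atTop]
              (fun n : ℕ => (2 * filmA ^ (10 / 9 : ℝ) * (2 * Γ) ^ (-(1 / 9) : ℝ) +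
                filmA * filmA ^ (1 / 9 : ℝ) / (2 * Γ) ^ (1 / 9 : ℝ)) *
                Real.exp (C / 3 * 10 ^ n))) ∧
          -- the second derivative at the maxima
          (fun n => iteratedDeriv 2 Φ (τp n)) ~[atTop]
            (fun n => -(3 / 2 : ℝ) ^ (1 / 3 : ℝ) * Φ (τp n) ^ (1 / 3 : ℝ)) := by
  obtain ⟨φ, φ₁, φ₂, hφ, hY, hφs⟩ := exists_isProfile_normalized filmK_pos
  obtain ⟨ℓ, hℓ, hl⟩ := hφ.exists_tendsto_second
  obtain ⟨s₀, hs₀, hmin⟩ := hφ.exists_isLeast filmK_pos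
  -- φ'' → ℓ gives φ ~ (ℓ/2)ζ², so Γ = ℓ/2 and 2Γ is the limiting second derivative.
  refine ⟨φ, ℓ / 2, φ s₀, hφ.isInnerProfile,
    fun ψ hψ => hφ.unique_up_to_translation hψ.isProfile filmK_pos, half_pos hℓ,
    hφ.isEquivalent_atTop hℓ hl, ⟨mem_range_self s₀, ?_⟩, fun τ₀ Φ hΦ hns => ?_⟩
  · rintro _ ⟨t, rfl⟩
    exact hmin t
  obtain ⟨τp, τm, lam, o, A, hlam0, hlam3, hlamdef, hlam⟩ :=
    film_oscillation_asymptotics hφ hY hφs hℓ hl hs₀ hmin hΦ hns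
  have h := hΦ.solvesOn
  have hm : ∀ n, τ₀ < τm n := fun n => (o.lower n).trans (o.lt_min n)
  have hLne : ∀ n, Φ (τp n) ≠ 0 := fun n => by linarith [o.max_gt n]
  obtain ⟨C, hC, h1, h2, h3⟩ := A.isEquivalent filmA_pos hℓ hlam0 hlam3 hlam
  rw [mul_div_cancel₀ ℓ two_ne_zero]
  refine ⟨τp, τm, o.strictMono_max, o.strictMono_min,
    fun n => ⟨o.lower n, o.lt_min n, o.lt_max n⟩, o.tendsto, fun n => ⟨?_, ?_⟩,
    fun n => ⟨o.deriv_max n, o.deriv_min n⟩, o.decreasing, o.increasing,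
    ⟨C, hC, h1, h2, ?_, h3⟩, ?_⟩
  · obtain ⟨_, d1, d2, _⟩ := h _ (o.lower n)
    exact isLocalMax_of_deriv_deriv_neg (by rw [d2.deriv]; exact o.second_max n) (o.deriv_max n)
      d1.continuousAt
  · obtain ⟨_, d1, d2, _⟩ := h _ (hm n)
    exact isLocalMin_of_deriv_deriv_pos (by rw [d2.deriv]; exact o.second_min n) (o.deriv_min n)
      d1.continuousAt
  · have h4 := isEquivalent_const_mul_of_tendsto (f := fun n => Φ (τm n))
      (g := fun n => (Φ (τp n) ^ 2)⁻¹) (hφ.pos s₀).ne'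
      (fun n => inv_ne_zero (pow_ne_zero 2 (hLne n)))
      (A.min.congr fun n => by rw [div_inv_eq_mul])
    simpa only [div_eq_mul_inv] using h4
  · have h4 := isEquivalent_const_mul_of_tendsto (neg_ne_zero.2 filmA_pos.ne')
      (fun n => (hlam0 n).ne') A.second
    simpa only [hlamdef, filmA] using h4
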